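/- Let $n\ge 1$. Let $B_n$ be the hyperoctahedral group of permutations $w$ of $\{-n,\dots,n\}$ with $w(-i)=-w(i)$, with Coxeter generators $s_0=[-1,2,\dots,n]$ and $s_i=[1,\dots,i+1,i,\dots,n]$ ($1\le i\le n-1$), Coxeter length $l$, and right descent sets $D(w)=\{i\in\{0,\dots,n-1\}: l(ws_i)<l(w)\}$. Put $$L(w)=\tfrac12\,\bigl|\{(i,j)\in\{-n,\dots,n\}^2 : i<j,\ w(i)>w(j),\ i\not\equiv j\}\bigr| ,$$ where here and below all congruences are modulo $2$. The signed permutation matrix of $w$ has $w_{i,j}=1$ if $w(j)=i$, $w_{i,j}=-1$ if $w(j)=-i$, and $w_{i,j}=0$ otherwise ($1\le i,j\le n$). Write $i(c)$ for the row of the nonzero entry of column $c$, and $j(r)$ for the column of the nonzero entry of row $r$. Let $C_n$ be the set of $w\in B_n$ such that $w_{i,j}\ne0$ implies $i\equiv j$. For $I\subseteq\{0,\dots,n-1\}$ with complement $I^c$ in $\{0,\dots,n-1\}$, let $C_n^{I^c}=\{w\in C_n: D(w)\subseteq I\}$, and let $(C_n^{I^c})_k$ be the set of $w\in C_n^{I^c}$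 with $w(k)=n$ or ($k<n$ and $w(k+1)=-n$). Fix $k\in\{0,\dots,n\}$. Row $r$ *lies right of $k$* if $j(r)>k$. A *block* $B_{r,s}$ ($1\le r\le s\le n$) is a maximal interval $\{r,\dots,s\}$ of rows that all lie right of $k$. A *block of ones* $P_{r,s}$ (*block of minus ones* $N_{r,s}$) is a maximal interval $\{r,\dots,s\}$ of rows $t$ that all lie right of $k$ and have $w_{t,j(t)}=1$ (respectively $-1$). Each of these is *even* if $r\not\equiv s$ (an even number of rows) and *odd* if $r\equiv s$. For $a,b\in\{1,-1\}$, columns $t,t+1$ form an $(a,b)_t$ *pair* if $k<t<n$, $t\not\equiv n$, $w_{i(t),t}=a$ and $w_{i(t+1),t+1}=b$. Row $q$ is *between* rows $x$ and $y$ if $\min(x,y)<q<\max(x,y)$. An element $w\in(C_n^{I^c})_k$ is *initially uncanceled* with respect to $k$, written $w\in(U_n^{I^c})_k$, if: 1. $j(n-1)<k$ or $w_{n-1,j(n-1)}=-1$ (no condition if $n=1$). 2. There are no odd blocks. 3. Every row $t$ right of $k$ with $w_{t,j(t)}=1$ lies in an even block of ones, except possibly if every row $q<t$ lies right of $k$ and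 has $w_{q,j(q)}=1$. 4. If $n$ is even, there are no $(-1,1)_t$ pairs. If $n$ is odd, there is at most one $(-1,1)_t$ pair; if it exists, then $i(t+1)=1$ and every row $q<i(t)$ lies right of $k$ and has $w_{q,j(q)}=1$. 5. For every $(-1,-1)_t$ pair, every row $q$ between $i(t)$ and $i(t+1)$ lies right of $k$ and has $w_{q,j(q)}=1$. 6. For every block of minus ones $N_{p,q}\subsetneq B_{r,s}$ with $B_{r,s}$ a block, $N_{p,q}$ is odd if and only if $p=r$ or $q=s$. 7. For every even block $B_{r,s}$: if $r\ne1$ and $P_{r,q}$ is a block of ones, then $q=s$; and if $P_{p,s}$ is a block of ones, then $p=r$. An element $w\in C_n^{I^c}$ is *finally uncanceled* with respect to $k$, written $w\in(V_n^{I^c})_k$, if: 1. $j(n)\le k$ or $w_{n,j(n)}=1$. 2. There are no odd blocks. 3. Every row $t$ right of $k$ with $w_{t,j(t)}=-1$ lies in an even block of minus ones, except possibly if every row $q<t$ lies right of $k$ and has $w_{q,j(q)}=-1$. 4. If $n$ is odd, there are no $(-1,1)_t$ pairs. If $n$ is even, there is at most one $(-1,1)_t$ pair; if it exists, then $i(t)=1$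 and every row $q<i(t+1)$ lies right of $k$ and has $w_{q,j(q)}=-1$. 5. For every $(1,1)_t$ pair, every row $q$ between $i(t)$ and $i(t+1)$ lies right of $k$ and has $w_{q,j(q)}=-1$. 6. For every block of ones $P_{p,q}\subsetneq B_{r,s}$ with $B_{r,s}$ a block, $P_{p,q}$ is odd if and only if $p=r$ or $q=s$. 7. For every even block $B_{r,s}$: if $r\ne1$ and $N_{r,q}$ is a block of minus ones, then $q=s$; and if $N_{p,s}$ is a block of minus ones, then $p=r$. **Theorem.** Let $n\ge1$, $I\subseteq\{0,\dots,n-1\}$ and $k\in I\cup\{n\}$, and suppose $i\equiv k$ for all $i\in I\cup\{n\}$ with $i>k$. Then, in $\mathbb Z[X]$, $$\sum_{w\in C_n^{I^c}}(-1)^{l(w)}X^{L(w)}=\sum_{w\in(V_n^{I^c})_k}(-1)^{l(w)}X^{L(w)},$$ $$\sum_{w\in(C_n^{I^c})_k}(-1)^{l(w)}X^{L(w)}=\sum_{w\in(U_n^{I^c})_k}(-1)^{l(w)}X^{L(w)}.$$ -/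

import Mathlib

open Polynomial

/-- The hyperoctahedral group `B_n`: permutations `w` of `{-n, …, n}` with `w (-i) = -w i`,
regarded as permutations of `ℤ` fixing everything outside `{-n, …, n}`. -/
def hyperoctahedral (n : ℕ) : Subgroup (Equiv.Perm ℤ) where
  carrier := {w | (∀ i, w (-i) = -w i) ∧ ∀ i, (n : ℤ) < |i| → w i = i}
  mul_mem' := by
    rintro a b ⟨ha, ha'⟩ ⟨hb, hb'⟩
    refine ⟨fun i => ?_, fun i hi => ?_⟩
    · simp [Equiv.Perm.mul_apply, hb, ha]
    · simp [Equiv.Perm.mul_apply, hb' i hi, ha' i hi]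
  one_mem' := by
    refine ⟨fun i => ?_, fun i _ => ?_⟩ <;> simp
  inv_mem' := by
    rintro a ⟨ha, ha'⟩
    refine ⟨fun i => ?_, fun i hi => ?_⟩
    · rw [Equiv.Perm.inv_eq_iff_eq, ha]
      simp
    · rw [Equiv.Perm.inv_eq_iff_eq, ha' i hi]

instance hyperoctahedral_finite (n : ℕ) : Finite (hyperoctahedral n) := by
  have hfin : Finite {i : ℤ // i ∈ Finset.Icc (-(n : ℤ)) n} := inferInstance
  have e := Equiv.Perm.subtypeEquivSubtypePerm (fun i : ℤ => i ∈ Finset.Icc (-(n : ℤ)) n)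
  have : Finite {f : Equiv.Perm ℤ // ∀ a, ¬ a ∈ Finset.Icc (-(n : ℤ)) n → f a = a} :=
    Finite.of_equiv _ e
  refine Finite.of_injective
    (fun w : hyperoctahedral n =>
      (⟨w.1, fun a ha => w.2.2 a ?_⟩ :
        {f : Equiv.Perm ℤ // ∀ a, ¬ a ∈ Finset.Icc (-(n : ℤ)) n → f a = a})) ?_
  · rw [Finset.mem_Icc] at ha
    by_contra h
    exact ha (abs_le.mp (not_lt.mp h))
  · intro a b h
    simp only [Subtype.mk.injEq] at h
    exact Subtype.ext h

noncomputable instance hyperoctahedral_fintype (n : ℕ) : Fintype (hyperoctahedral n) :=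
  Fintype.ofFinite _

/-! ### Coxeter generators, length, descents, and the statistic `L` -/

/-- The Coxeter generators: `s_0 = [-1, 2, 3, …]` and `s_i` (for `i > 0`) exchanging
`i` and `i + 1` (and `-i` and `-(i + 1)`). -/
def coxGen (i : ℕ) : Equiv.Perm ℤ :=
  if i = 0 then Equiv.swap 1 (-1)
  else Equiv.swap (i : ℤ) (i + 1) * Equiv.swap (-(i : ℤ)) (-(i + 1))

/-- The Coxeter length on `B_n`: the least length of a word in `s_0, …, s_{n-1}`
whose product is `w`. -/
noncomputable def coxLength (n : ℕ) (w : Equiv.Perm ℤ) : ℕ :=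
  sInf {m | ∃ u : List ℕ, (∀ i ∈ u, i < n) ∧ (u.map coxGen).prod = w ∧ u.length = m}

/-- The right descent set `D(w) = {i ∈ {0, …, n-1} | l(w s_i) < l(w)}`. -/
noncomputable def descents (n : ℕ) (w : Equiv.Perm ℤ) : Finset ℕ :=
  (Finset.range n).filter fun i => coxLength n (w * coxGen i) < coxLength n w

/-- The pairs `(i, j) ∈ {-n, …, n}²` with `i < j`, `w i > w j` and `i ≢ j (mod 2)`. -/
noncomputable def oddInversions (n : ℕ) (w : Equiv.Perm ℤ) : Finset (ℤ × ℤ) :=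
  (Finset.Icc (-(n : ℤ)) n ×ˢ Finset.Icc (-(n : ℤ)) n).filter fun p =>
    p.1 < p.2 ∧ w p.2 < w p.1 ∧ ¬ p.1 ≡ p.2 [ZMOD 2]

/-- The statistic `L`: half the number of odd inversions. -/
noncomputable def statL (n : ℕ) (w : Equiv.Perm ℤ) : ℕ := (oddInversions n w).card / 2

/-- The number of odd inversions is even, so the division in `statL` is exact. -/
theorem two_mul_statL (n : ℕ) (w : hyperoctahedral n) :
    2 * statL n w = (oddInversions n w).card := by
  have h : ((oddInversions n w).card : ZMod 2) = 0 := by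
    rw [Finset.cast_card]
    refine Finset.sum_involution (fun p _ => (-p.2, -p.1)) ?_ ?_ ?_ ?_
    · intro p _
      decide
    · rintro ⟨a, b⟩ hp _ heq
      simp only [oddInversions, Finset.mem_filter, Prod.mk.injEq] at hp heq
      have h3 := hp.2.2.2
      unfold Int.ModEq at h3
      omega
    · rintro ⟨a, b⟩ hp
      have ha := w.2.1 a
      have hb := w.2.1 b
      simp only [oddInversions, Finset.mem_filter, Finset.mem_product, Finset.mem_Icc] at hp ⊢
      obtain ⟨h1, h2, h3, h4⟩ := hp
      unfold Int.ModEq at h4 ⊢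
      rw [ha, hb]
      omega
    · rintro ⟨a, b⟩ _
      simp
  rw [ZMod.natCast_eq_zero_iff] at h
  exact Nat.mul_div_cancel' h

/-! ### The signed permutation matrix -/

/-- The entry `w_{i,j}` (`1 ≤ i, j ≤ n`) of the signed permutation matrix of `w`. -/
def entry (w : Equiv.Perm ℤ) (i j : ℕ) : ℤ :=
  if w j = i then 1 else if w j = -i then -1 else 0

/-- `i(c)`: the row containing the nonzero entry of column `c`. -/
def rowOf (w : Equiv.Perm ℤ) (c : ℕ) : ℕ := (w c).natAbs

/-- `j(r)`: the column containing the nonzero entry of row `r`. -/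
def colOf (w : Equiv.Perm ℤ) (r : ℕ) : ℕ := (w⁻¹ r).natAbs

theorem entry_ne_zero_iff_row (w : Equiv.Perm ℤ) (i j : ℕ) :
    entry w i j ≠ 0 ↔ i = rowOf w j := by
  unfold entry rowOf
  split_ifs <;> simp <;> omega

theorem entry_ne_zero_iff_col {n : ℕ} (w : hyperoctahedral n) (i j : ℕ) :
    entry w i j ≠ 0 ↔ j = colOf w i := by
  have h1 : (w : Equiv.Perm ℤ) j = i ↔ (j : ℤ) = (w : Equiv.Perm ℤ)⁻¹ i :=
    Equiv.Perm.eq_inv_iff_eq.symm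
  have h2 : (w : Equiv.Perm ℤ) j = -i ↔ (j : ℤ) = -(w : Equiv.Perm ℤ)⁻¹ i := by
    have h3 : (w : Equiv.Perm ℤ)⁻¹ (-i) = -(w : Equiv.Perm ℤ)⁻¹ i := (w⁻¹).2.1 i
    rw [← h3]
    exact Equiv.Perm.eq_inv_iff_eq.symm
  unfold entry colOf
  simp only [h1, h2]
  generalize (w : Equiv.Perm ℤ)⁻¹ (i : ℤ) = x
  split_ifs with a b <;> simp <;> omega

/-! ### Quotients and chessboard elements -/

/-- The quotient `B_n^J = {w ∈ B_n | D(w) ⊆ {0, …, n-1} \ J}`. -/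
def quotientB (n : ℕ) (J : Finset ℕ) : Set (hyperoctahedral n) :=
  {w | descents n w ⊆ Finset.range n \ J}

/-- The chessboard elements `C_n`. -/
def chessboard (n : ℕ) : Set (hyperoctahedral n) :=
  {w | ∀ i ∈ Finset.Icc 1 n, ∀ j ∈ Finset.Icc 1 n, entry w i j ≠ 0 → Even (i + j)}

/-- `C_n^J = C_n ∩ B_n^J`. -/
def quotientC (n : ℕ) (J : Finset ℕ) : Set (hyperoctahedral n) :=
  chessboard n ∩ quotientB n J

/-- `(C_n^J)_k`: the `w ∈ C_n^J` with `w(k) = n` or `w(k+1) = -n`. -/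
def quotientCAt (n : ℕ) (J : Finset ℕ) (k : ℕ) : Set (hyperoctahedral n) :=
  {w | w ∈ quotientC n J ∧
    ((w : Equiv.Perm ℤ) k = n ∨ (w : Equiv.Perm ℤ) (k + 1) = -n)}

/-- The signed generating function `∑_{w ∈ S} (-1)^{l(w)} X^{L(w)}`. -/
noncomputable def signedSum (n : ℕ) (S : Set (hyperoctahedral n)) : ℤ[X] :=
  ∑ w ∈ S.toFinite.toFinset, (-1) ^ coxLength n w * X ^ statL n w

/-! ### Blocks and pairs, with respect to a column `k` -/

/-- `B^k_{r,s}` is a block: a maximal interval of rows `r ≤ t ≤ s` (all inside `{1, …, n}`)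
whose nonzero entries lie strictly right of column `k`. -/
def IsBlock (n : ℕ) (w : Equiv.Perm ℤ) (k r s : ℕ) : Prop :=
  1 ≤ r ∧ r ≤ s ∧ s ≤ n ∧
  (∀ t, r ≤ t → t ≤ s → k < colOf w t) ∧
  (s ≠ n → colOf w (s + 1) ≤ k) ∧
  (r ≠ 1 → colOf w (r - 1) ≤ k)

/-- A block of ones `P^k_{r,s}` (for `ε = 1`) or of minus ones `N^k_{r,s}` (for `ε = -1`):
a maximal interval of rows whose nonzero entries lie strictly right of column `k` and
equal `ε`. -/
def IsSignBlock (ε : ℤ) (n : ℕ) (w : Equiv.Perm ℤ) (k r s : ℕ) : Prop :=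
  1 ≤ r ∧ r ≤ s ∧ s ≤ n ∧
  (∀ t, r ≤ t → t ≤ s → k < colOf w t ∧ entry w t (colOf w t) = ε) ∧
  (s ≠ n → colOf w (s + 1) ≤ k ∨ entry w (s + 1) (colOf w (s + 1)) = -ε) ∧
  (r ≠ 1 → colOf w (r - 1) ≤ k ∨ entry w (r - 1) (colOf w (r - 1)) = -ε)

/-- An interval of rows `r, …, s` has even size. -/
def EvenRows (r s : ℕ) : Prop := ¬ r ≡ s [MOD 2]

/-- An interval of rows `r, …, s` has odd size. -/
def OddRows (r s : ℕ) : Prop := r ≡ s [MOD 2]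

/-- Columns `t, t+1` form an `(a, b)^k_t` pair. -/
def IsPair (n : ℕ) (w : Equiv.Perm ℤ) (k : ℕ) (a b : ℤ) (t : ℕ) : Prop :=
  k < t ∧ t + 1 ≤ n ∧ ¬ t ≡ n [MOD 2] ∧
  entry w (rowOf w t) t = a ∧ entry w (rowOf w (t + 1)) (t + 1) = b

/-- Row `q` lies strictly between rows `x` and `y`. -/
def RowBetween (x y q : ℕ) : Prop := min x y < q ∧ q < max x y

/-! ### Initially and finally uncanceled elements -/

/-- The seven properties of an initially uncanceled element with respect to column `j`. -/
structure IsInitiallyUncanceled (n : ℕ) (w : Equiv.Perm ℤ) (j : ℕ) : Prop where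
  /-- Vacuous for `n = 1`, where there is no row `n - 1`. -/
  prop1 : ∀ r, 1 ≤ r → r + 1 = n → colOf w r < j ∨ entry w r (colOf w r) = -1
  prop2 : ∀ r s, IsBlock n w j r s → ¬ OddRows r s
  prop3 : ∀ t, 1 ≤ t → t ≤ n → j < colOf w t → entry w t (colOf w t) = 1 →
    (∃ r s, IsSignBlock 1 n w j r s ∧ EvenRows r s ∧ r ≤ t ∧ t ≤ s) ∨
    (∀ q, 1 ≤ q → q < t → j < colOf w q ∧ entry w q (colOf w q) = 1)
  prop4_even : Even n → ∀ t, ¬ IsPair n w j (-1) 1 t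
  prop4_odd : Odd n →
    (∀ t t', IsPair n w j (-1) 1 t → IsPair n w j (-1) 1 t' → t = t') ∧
    ∀ t, IsPair n w j (-1) 1 t → rowOf w (t + 1) = 1 ∧
      ∀ q, 1 ≤ q → q < rowOf w t → entry w q (colOf w q) = 1 ∧ j < colOf w q
  prop5 : ∀ t, IsPair n w j (-1) (-1) t → ∀ q, RowBetween (rowOf w t) (rowOf w (t + 1)) q →
    entry w q (colOf w q) = 1 ∧ j < colOf w q
  prop6 : ∀ r s p q, IsBlock n w j r s → IsSignBlock (-1) n w j p q → r ≤ p → q ≤ s →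
    ¬ (p = r ∧ q = s) → (OddRows p q ↔ p = r ∨ q = s)
  /-- The topmost block, `r = 1`, is exempt: it may begin with a block of ones, as the
  exceptions in properties 3 and 4 require. -/
  prop7_top : ∀ r s q, IsBlock n w j r s → EvenRows r s → r ≠ 1 →
    IsSignBlock 1 n w j r q → q = s
  prop7_bot : ∀ r s p, IsBlock n w j r s → EvenRows r s → IsSignBlock 1 n w j p s → p = r

/-- The seven properties of a finally uncanceled element with respect to column `k`. -/
structure IsFinallyUncanceled (n : ℕ) (w : Equiv.Perm ℤ) (k : ℕ) : Prop where
  /-- Weakly left of `k`. -/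
  prop1 : colOf w n ≤ k ∨ entry w n (colOf w n) = 1
  prop2 : ∀ r s, IsBlock n w k r s → ¬ OddRows r s
  prop3 : ∀ t, 1 ≤ t → t ≤ n → k < colOf w t → entry w t (colOf w t) = -1 →
    (∃ r s, IsSignBlock (-1) n w k r s ∧ EvenRows r s ∧ r ≤ t ∧ t ≤ s) ∨
    (∀ q, 1 ≤ q → q < t → k < colOf w q ∧ entry w q (colOf w q) = -1)
  prop4_even : Even n →
    (∀ t t', IsPair n w k (-1) 1 t → IsPair n w k (-1) 1 t' → t = t') ∧
    ∀ t, IsPair n w k (-1) 1 t → rowOf w t = 1 ∧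
      ∀ q, 1 ≤ q → q < rowOf w (t + 1) → entry w q (colOf w q) = -1 ∧ k < colOf w q
  prop4_odd : Odd n → ∀ t, ¬ IsPair n w k (-1) 1 t
  prop5 : ∀ t, IsPair n w k 1 1 t → ∀ q, RowBetween (rowOf w t) (rowOf w (t + 1)) q →
    entry w q (colOf w q) = -1 ∧ k < colOf w q
  prop6 : ∀ r s p q, IsBlock n w k r s → IsSignBlock 1 n w k p q → r ≤ p → q ≤ s →
    ¬ (p = r ∧ q = s) → (OddRows p q ↔ p = r ∨ q = s)
  /-- The topmost block, `r = 1`, is exempt: it may begin with a block of minus ones, as the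
  exceptions in properties 3 and 4 require. -/
  prop7_top : ∀ r s q, IsBlock n w k r s → EvenRows r s → r ≠ 1 →
    IsSignBlock (-1) n w k r q → q = s
  prop7_bot : ∀ r s p, IsBlock n w k r s → EvenRows r s → IsSignBlock (-1) n w k p s → p = r

/-- `(U_n^J)_j`: the initially uncanceled elements of `(C_n^J)_j`. -/
def initiallyUncanceled (n : ℕ) (J : Finset ℕ) (j : ℕ) : Set (hyperoctahedral n) :=
  {w | w ∈ quotientCAt n J j ∧ IsInitiallyUncanceled n w j}

/-- `(V_n^J)_k`: the finally uncanceled elements of `C_n^J`. -/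
def finallyUncanceled (n : ℕ) (J : Finset ℕ) (k : ℕ) : Set (hyperoctahedral n) :=
  {w | w ∈ quotientC n J ∧ IsFinallyUncanceled n w k}

/-! ### The Coxeter length of `B_n` -/

section Length

variable {n : ℕ}

/-! Both identities come from sign-reversing involutions that preserve `L` and pair off all elements
that are not uncanceled. The length of `w` counts inversion classes, so multiplication by any
reflection reverses the sign; the work lies in finding reflections that preserve everything else.

The elements of `I` from `k` on cut the columns right of `k` into segments, on each of which `w`
increases. Segments carry signed numbers, the columns between `-k` and `k` forming segment `0`. Let
`u < v` be values of equal parity such that each value of the other parity strictly between them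
lies in a segment beyond those of `u` and `v`, or before both. Exchanging `u` and `v` (and `-u` and
`-v`) then keeps, for any two positions of opposite parity, either the order of their values or the
order of the relabelled positions. Hence `L` and the quotient of `C_n` are preserved
(`IsExchangeable.reflection_mul`).

Let `G r` be the signed segment of row `r`. The first cancellation takes the first row with `G r =
0` that breaks the alternation in parity of such rows, and exchanges it with the previous one, or
with its own negative if there is none. The survivors are the elements without odd blocks.

For the second cancellation, the congruences on `I` and `n` make each segment right of `k` a union
of column pairs, on which parities alternate; this gives the constraints `IsRowPattern` on `G`. Read
the rows from the bottom in twos. Unless a negative row `r + 1` fails to be continued by row `r`,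
the scan is in one of two states: all segments filled evenly, or exactly one nonnegative and one
negative segment filled oddly (`IsRowPattern.complete_or_pending`). At the first failure met, row
`r` and the next nonnegative row `r₀` below it have equal parity and only negative rows between
them, so they can be exchanged, and the same failure remains.

What is left has alternating zeros and no failure. There the pairing of rows forces all seven
properties of a finally uncanceled element; conversely properties 2 and 3 already exclude both
defects (`isFinallyUncanceled_iff`). For the second identity row `n` lies in column `k`; deleting it
shifts all parities by one, which amounts to replacing `G` by `-G`, so the same analysis applies
with `m = n - 1`. -/

theorem hyperoctahedral_map_neg (w : hyperoctahedral n) (x : ℤ) : w.1 (-x) = -w.1 x := w.2.1 x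

theorem hyperoctahedral_map_zero (w : hyperoctahedral n) : w.1 0 = 0 := by
  have := w.2.1 0
  simp only [neg_zero] at this
  omega

theorem hyperoctahedral_inv_neg (w : hyperoctahedral n) (x : ℤ) :
    w.1⁻¹ (-x) = -w.1⁻¹ x := (w⁻¹).2.1 x

theorem hyperoctahedral_abs_le (w : hyperoctahedral n) {x : ℤ} (hx : |x| ≤ n) :
    |w.1 x| ≤ n := by
  by_contra h
  have h1 := w.2.2 _ (not_le.mp h)
  have h2 := w.1.injective h1
  rw [h2] at h
  exact h hx

theorem hyperoctahedral_inv_abs_le (w : hyperoctahedral n) {x : ℤ} (hx : |x| ≤ n) :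
    |w.1⁻¹ x| ≤ n := hyperoctahedral_abs_le w⁻¹ hx

theorem coxGen_zero_apply (x : ℤ) :
    coxGen 0 x = if x = 1 then -1 else if x = -1 then 1 else x := by
  simp [coxGen, Equiv.swap_apply_def]

theorem coxGen_pos_apply {i : ℕ} (hi : 0 < i) (x : ℤ) :
    coxGen i x = if x = i then (i : ℤ) + 1 else if x = i + 1 then (i : ℤ) else
      if x = -i then -(i + 1 : ℤ) else if x = -(i + 1) then -(i : ℤ) else x := by
  have h : i ≠ 0 := by omega
  simp only [coxGen, h, if_false, Equiv.Perm.mul_apply, Equiv.swap_apply_def]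
  split_ifs <;> first | rfl | omega

theorem coxGen_involutive (i : ℕ) (x : ℤ) : coxGen i (coxGen i x) = x := by
  rcases Nat.eq_zero_or_pos i with rfl | hi
  · simp only [coxGen_zero_apply]; split_ifs <;> first | rfl | omega | simp_all
  · simp only [coxGen_pos_apply hi]; split_ifs <;> first | rfl | omega

theorem coxGen_mul_self (i : ℕ) : coxGen i * coxGen i = 1 :=
  Equiv.ext fun x => coxGen_involutive i x

theorem coxGen_mem {i : ℕ} (hi : i < n) : coxGen i ∈ hyperoctahedral n := by
  refine ⟨fun x => ?_, fun x hx => ?_⟩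
  · rcases Nat.eq_zero_or_pos i with rfl | h0
    · simp only [coxGen_zero_apply]; split_ifs <;> omega
    · simp only [coxGen_pos_apply h0]; split_ifs <;> omega
  · rw [lt_abs] at hx
    rcases Nat.eq_zero_or_pos i with rfl | h0
    · simp only [coxGen_zero_apply]; split_ifs <;> omega
    · simp only [coxGen_pos_apply h0]; split_ifs <;> omega

/-- One representative of each class of inversions of `w` under `(a, b) ↦ (-b, -a)`. -/
noncomputable def inversions (n : ℕ) (w : Equiv.Perm ℤ) : Finset (ℤ × ℤ) :=
  (Finset.Icc (-(n : ℤ)) n ×ˢ Finset.Icc (-(n : ℤ)) n).filter fun p => |p.1| < p.2 ∧ w p.2 < w p.1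

theorem mem_inversions {w : Equiv.Perm ℤ} {a b : ℤ} :
    (a, b) ∈ inversions n w ↔ -b < a ∧ a < b ∧ b ≤ n ∧ w b < w a := by
  simp only [inversions, Finset.mem_filter, Finset.mem_product, Finset.mem_Icc, abs_lt]
  constructor <;> intro h <;> refine ⟨?_, ?_⟩ <;> omega

/-- `coxGen i` acting on the index set of `inversions`. -/
def genPair (i : ℕ) (p : ℤ × ℤ) : ℤ × ℤ :=
  if p = (-(i : ℤ), (i : ℤ) + 1) then p else (coxGen i p.1, coxGen i p.2)

/-- `coxGen i` takes representatives of inversion classes to representatives except at two pairs.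
The pair `(i, i + 1)` is reversed and is excluded. The pair `(-i, i + 1)` goes to `(-(i + 1), i)`,
which represents the same class, so `genPair` fixes it. For `i = 0` the two exceptions coincide. -/
theorem genPair_mem {i : ℕ} (hi : i < n) (w : hyperoctahedral n) {p : ℤ × ℤ}
    (hp : p ∈ inversions n w.1) (hne : p ≠ ((i : ℤ), (i : ℤ) + 1)) :
    genPair i p ∈ inversions n (w.1 * coxGen i) ∧ genPair i p ≠ ((i : ℤ), (i : ℤ) + 1) ∧
      genPair i (genPair i p) = p := by
  obtain ⟨a, b⟩ := p
  rw [mem_inversions] at hp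
  obtain ⟨h1, h2, h3, h4⟩ := hp
  simp only [ne_eq, Prod.mk.injEq] at hne
  unfold genPair
  by_cases hab : (a, b) = (-(i : ℤ), (i : ℤ) + 1)
  · simp only [hab, if_true]
    simp only [Prod.mk.injEq] at hab
    refine ⟨?_, by simpa [hab] using hne, trivial⟩
    rw [mem_inversions]
    refine ⟨by omega, by omega, by omega, ?_⟩
    simp only [Equiv.Perm.mul_apply]
    have e1 : coxGen i ((i : ℤ) + 1) = i := by
      rcases Nat.eq_zero_or_pos i with rfl | h0
      · simp at hab hne; omega
      · simp only [coxGen_pos_apply h0]; split_ifs <;> omega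
    have e2 : coxGen i (-(i : ℤ)) = -(i + 1 : ℤ) := by
      rcases Nat.eq_zero_or_pos i with rfl | h0
      · simp at hab hne; omega
      · simp only [coxGen_pos_apply h0]; split_ifs <;> omega
    rw [e1, e2]
    rw [hab.1, hab.2, w.2.1] at h4
    have := w.2.1 (i + 1)
    omega
  · simp only [hab, if_false, coxGen_involutive]
    simp only [Prod.mk.injEq] at hab
    have key : -coxGen i b < coxGen i a ∧ coxGen i a < coxGen i b ∧ coxGen i b ≤ n := by
      rcases Nat.eq_zero_or_pos i with rfl | h0
      · simp only [coxGen_zero_apply, Nat.cast_zero] at *; split_ifs <;> omega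
      · simp only [coxGen_pos_apply h0]; split_ifs <;> omega
    have ne1 : ¬ (coxGen i a = -(i : ℤ) ∧ coxGen i b = (i : ℤ) + 1) := by
      rcases Nat.eq_zero_or_pos i with rfl | h0
      · simp only [coxGen_zero_apply, Nat.cast_zero] at *; split_ifs <;> omega
      · simp only [coxGen_pos_apply h0]; split_ifs <;> omega
    have ne2 : ¬ (coxGen i a = (i : ℤ) ∧ coxGen i b = (i : ℤ) + 1) := by
      rcases Nat.eq_zero_or_pos i with rfl | h0
      · simp only [coxGen_zero_apply, Nat.cast_zero] at *; split_ifs <;> omega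
      · simp only [coxGen_pos_apply h0]; split_ifs <;> omega
    refine ⟨?_, by simpa using ne2, by simp [ne1]⟩
    rw [mem_inversions]
    simp only [Equiv.Perm.mul_apply, coxGen_involutive]
    exact ⟨key.1, key.2.1, key.2.2, h4⟩

theorem coxGen_apply_succ (w : hyperoctahedral n) (i : ℕ) (h : w.1 i < w.1 (i + 1)) :
    (w.1 * coxGen i) (i + 1) < (w.1 * coxGen i) i := by
  simp only [Equiv.Perm.mul_apply]
  have h0 := hyperoctahedral_map_zero w
  have h1 := w.2.1 1
  rcases Nat.eq_zero_or_pos i with rfl | hi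
  · simp [coxGen_zero_apply] at h ⊢
    omega
  · simp only [coxGen_pos_apply hi, if_true]
    rw [if_neg (by omega)]
    exact h

/-- At an ascent, `(i, i + 1)` is the only inversion gained; `genPair` matches all the others. -/
theorem card_inversions_mul_coxGen (w : hyperoctahedral n) {i : ℕ} (hi : i < n)
    (h : w.1 i < w.1 (i + 1)) :
    (inversions n (w.1 * coxGen i)).card = (inversions n w.1).card + 1 := by
  have hmem : ((i : ℤ), (i : ℤ) + 1) ∈ inversions n (w.1 * coxGen i) := by
    rw [mem_inversions]
    exact ⟨by omega, by omega, by omega, coxGen_apply_succ w i h⟩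
  have hnot : ((i : ℤ), (i : ℤ) + 1) ∉ inversions n w.1 := by
    rw [mem_inversions]
    omega
  rw [← Finset.card_erase_add_one hmem]
  congr 1
  have hw' : w.1 * coxGen i ∈ hyperoctahedral n := mul_mem w.2 (coxGen_mem hi)
  symm
  refine Finset.card_nbij' (genPair i) (genPair i) ?_ ?_ ?_ ?_
  · intro p hp
    have hne : p ≠ ((i : ℤ), (i : ℤ) + 1) := fun e => hnot (e ▸ hp)
    obtain ⟨h1, h2, -⟩ := genPair_mem hi w hp hne
    exact Finset.mem_coe.mpr (Finset.mem_erase.mpr ⟨h2, h1⟩)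
  · intro p hp
    obtain ⟨hne, hp⟩ := Finset.mem_erase.mp (Finset.mem_coe.mp hp)
    obtain ⟨h1, -, -⟩ := genPair_mem hi ⟨_, hw'⟩ hp hne
    simpa [mul_assoc, coxGen_mul_self] using h1
  · intro p hp
    exact (genPair_mem hi w hp fun e => hnot (e ▸ hp)).2.2
  · intro p hp
    obtain ⟨hne, hp⟩ := Finset.mem_erase.mp (Finset.mem_coe.mp hp)
    exact (genPair_mem hi ⟨_, hw'⟩ hp hne).2.2

theorem card_inversions_mul_coxGen_of_gt (w : hyperoctahedral n) {i : ℕ} (hi : i < n)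
    (h : w.1 (i + 1) < w.1 i) :
    (inversions n w.1).card = (inversions n (w.1 * coxGen i)).card + 1 := by
  have hw' : w.1 * coxGen i ∈ hyperoctahedral n := mul_mem w.2 (coxGen_mem hi)
  have := card_inversions_mul_coxGen ⟨_, hw'⟩ hi (by
    have h0 := hyperoctahedral_map_zero w
    have h1 := w.2.1 1
    simp only [Equiv.Perm.mul_apply]
    rcases Nat.eq_zero_or_pos i with rfl | hi
    · simp [coxGen_zero_apply] at h ⊢
      omega
    · simp only [coxGen_pos_apply hi, if_true]
      rw [if_neg (by omega)]
      exact h)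
  simpa [mul_assoc, coxGen_mul_self] using this

theorem apply_ne_apply_succ (w : Equiv.Perm ℤ) (i : ℕ) : w i ≠ w (i + 1) := fun h => by
  have := w.injective h
  omega

/-! ### Words in the generators and reduced length -/

theorem word_mem {u : List ℕ} (hu : ∀ i ∈ u, i < n) : (u.map coxGen).prod ∈ hyperoctahedral n := by
  refine Subgroup.list_prod_mem _ fun x hx => ?_
  obtain ⟨i, hi, rfl⟩ := List.mem_map.mp hx
  exact coxGen_mem (hu i hi)

theorem card_inversions_mul_coxGen_le (w : hyperoctahedral n) {i : ℕ} (hi : i < n) :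
    (inversions n (w.1 * coxGen i)).card ≤ (inversions n w.1).card + 1 := by
  rcases lt_or_gt_of_ne (apply_ne_apply_succ w.1 i) with h | h
  · exact (card_inversions_mul_coxGen w hi h).le
  · have := card_inversions_mul_coxGen_of_gt w hi h
    omega

theorem inversions_one : inversions n 1 = ∅ := by
  ext ⟨a, b⟩
  rw [mem_inversions]
  simp
  omega

theorem card_inversions_word_le {u : List ℕ} (hu : ∀ i ∈ u, i < n) :
    (inversions n (u.map coxGen).prod).card ≤ u.length := by
  induction u using List.reverseRecOn with
  | nil => simp [inversions_one]
  | append_singleton l a ih =>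
    have hl : ∀ i ∈ l, i < n := fun i hi => hu i (by simp [hi])
    have := card_inversions_mul_coxGen_le ⟨_, word_mem hl⟩ (hu a (by simp))
    have := ih hl
    simp only [List.map_append, List.prod_append, List.map_cons, List.map_nil, List.prod_singleton,
      List.length_append, List.length_singleton]
    simp only at *
    omega

/-- Strict increase from `w 0 = 0` forces `w i ≥ i`, while descending from the bound `w n ≤ n`
forces `w i ≤ i`. -/
theorem eq_one_of_increasing (w : hyperoctahedral n) (h : ∀ i : ℕ, i < n → w.1 i < w.1 (i + 1)) :
    w.1 = 1 := by
  have h1 : ∀ i : ℕ, i ≤ n → (i : ℤ) ≤ w.1 i := by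
    intro i
    induction i with
    | zero => intro _; simp [hyperoctahedral_map_zero w]
    | succ i ih =>
      intro hi
      have := ih (by omega)
      have := h i (by omega)
      push_cast
      omega
  have h2 : ∀ d i : ℕ, i + d = n → w.1 i ≤ i := by
    intro d
    induction d with
    | zero =>
      intro i hi
      have := hyperoctahedral_abs_le w (x := i) (by rw [abs_of_nonneg] <;> omega)
      have := le_abs_self (w.1 i)
      omega
    | succ d ih =>
      intro i hi
      have := ih (i + 1) (by omega)
      have := h i (by omega)
      push_cast at *
      omega
  have h3 : ∀ i : ℕ, w.1 i = i := by
    intro i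
    by_cases hi : i ≤ n
    · exact le_antisymm (h2 (n - i) i (by omega)) (h1 i hi)
    · exact w.2.2 _ (by rw [abs_of_nonneg] <;> omega)
  ext x
  simp only [Equiv.Perm.one_apply]
  rcases le_total 0 x with hx | hx
  · lift x to ℕ using hx
    exact h3 x
  · obtain ⟨y, rfl⟩ : ∃ y, x = -y := ⟨-x, by simp⟩
    have hy : 0 ≤ y := by omega
    lift y to ℕ using hy
    rw [w.2.1, h3]

/-- Sorting: as long as `w` is not the identity it has a descent, and multiplying by that generator
removes exactly one inversion. -/
theorem exists_word (w : hyperoctahedral n) :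
    ∃ u : List ℕ, (∀ i ∈ u, i < n) ∧ (u.map coxGen).prod = w.1 ∧
      u.length = (inversions n w.1).card := by
  induction hN : (inversions n w.1).card generalizing w with
  | zero =>
    refine ⟨[], by simp, ?_, by simp⟩
    rw [List.map_nil, List.prod_nil, eq_one_of_increasing w]
    intro i hi
    rcases lt_or_gt_of_ne (apply_ne_apply_succ w.1 i) with h | h
    · exact h
    · have := card_inversions_mul_coxGen_of_gt w hi h
      omega
  | succ N ih =>
    obtain ⟨i, hi, h⟩ : ∃ i : ℕ, i < n ∧ w.1 (i + 1) < w.1 i := by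
      by_contra! hcon
      rw [eq_one_of_increasing w fun i hi =>
        lt_of_le_of_ne (hcon i hi) (apply_ne_apply_succ w.1 i), inversions_one] at hN
      simp at hN
    have := card_inversions_mul_coxGen_of_gt w hi h
    obtain ⟨u, hu, hprod, hlen⟩ :=
      ih ⟨w.1 * coxGen i, mul_mem w.2 (coxGen_mem hi)⟩ (by simp only; omega)
    refine ⟨u ++ [i], ?_, ?_, by simp [hlen]⟩
    · intro j hj
      rcases List.mem_append.mp hj with hj | hj
      · exact hu j hj
      · simp at hj; omega
    · simp [hprod, mul_assoc, coxGen_mul_self]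

theorem coxLength_eq_card_inversions (w : hyperoctahedral n) :
    coxLength n w.1 = (inversions n w.1).card := by
  obtain ⟨u, hu, hprod, hlen⟩ := exists_word w
  refine le_antisymm (Nat.sInf_le ⟨u, hu, hprod, hlen⟩) ?_
  refine le_csInf ⟨_, u, hu, hprod, hlen⟩ ?_
  rintro m ⟨v, hv, hvw, rfl⟩
  rw [← hvw]
  exact card_inversions_word_le hv

theorem mem_descents_iff (w : hyperoctahedral n) {i : ℕ} :
    i ∈ descents n w.1 ↔ i < n ∧ w.1 (i + 1) < w.1 i := by
  unfold descents
  rw [Finset.mem_filter, Finset.mem_range]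
  refine and_congr_right fun hi => ?_
  have e : coxLength n (w.1 * coxGen i) = _ :=
    coxLength_eq_card_inversions ⟨w.1 * coxGen i, mul_mem w.2 (coxGen_mem hi)⟩
  rw [coxLength_eq_card_inversions w, e]
  rcases lt_or_gt_of_ne (apply_ne_apply_succ w.1 i) with h | h
  · have := card_inversions_mul_coxGen w hi h
    simp only at *
    omega
  · have := card_inversions_mul_coxGen_of_gt w hi h
    simp only at *
    omega

theorem neg_one_pow_coxLength_mul_coxGen (w : hyperoctahedral n) {i : ℕ} (hi : i < n) :
    (-1 : ℤ[X]) ^ coxLength n (w.1 * coxGen i) = -(-1) ^ coxLength n w.1 := by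
  have e : coxLength n (w.1 * coxGen i) = _ :=
    coxLength_eq_card_inversions ⟨w.1 * coxGen i, mul_mem w.2 (coxGen_mem hi)⟩
  rw [coxLength_eq_card_inversions w, e]
  rcases lt_or_gt_of_ne (apply_ne_apply_succ w.1 i) with h | h
  · rw [card_inversions_mul_coxGen w hi h, pow_succ]
    ring
  · rw [card_inversions_mul_coxGen_of_gt w hi h, pow_succ]
    ring

theorem neg_one_pow_coxLength_mul_word (w : hyperoctahedral n) {u : List ℕ}
    (hu : ∀ i ∈ u, i < n) :
    (-1 : ℤ[X]) ^ coxLength n (w.1 * (u.map coxGen).prod) =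
      (-1) ^ u.length * (-1) ^ coxLength n w.1 := by
  induction u using List.reverseRecOn with
  | nil => simp
  | append_singleton l a ih =>
    have hl : ∀ i ∈ l, i < n := fun i hi => hu i (by simp [hi])
    have := neg_one_pow_coxLength_mul_coxGen
      ⟨w.1 * (l.map coxGen).prod, mul_mem w.2 (word_mem hl)⟩ (hu a (by simp))
    simp only [List.map_append, List.prod_append, List.map_cons, List.map_nil, List.prod_singleton,
      List.length_append, List.length_singleton, ← mul_assoc]
    rw [this, ih hl, pow_succ]
    ring

/-- The sign changes with each letter of a word. The letters of `g` and `g⁻¹` cancel because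
multiplying `w` by both returns `w` (this is `h4`), so only the generator in the middle counts. -/
theorem neg_one_pow_coxLength_mul_conj (w g : hyperoctahedral n) {i : ℕ} (hi : i < n) :
    (-1 : ℤ[X]) ^ coxLength n (w.1 * (g.1 * coxGen i * g.1⁻¹)) = -(-1) ^ coxLength n w.1 := by
  obtain ⟨u, hu, hprod, -⟩ := exists_word g
  obtain ⟨v, hv, hvprod, -⟩ := exists_word g⁻¹
  have h1 := neg_one_pow_coxLength_mul_word ⟨w.1, w.2⟩ hu
  have h2 := neg_one_pow_coxLength_mul_coxGen ⟨w.1 * g.1, mul_mem w.2 g.2⟩ hi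
  have h3 := neg_one_pow_coxLength_mul_word
    ⟨w.1 * g.1 * coxGen i, mul_mem (mul_mem w.2 g.2) (coxGen_mem hi)⟩ hv
  have h4 := neg_one_pow_coxLength_mul_word ⟨w.1 * g.1, mul_mem w.2 g.2⟩ hv
  simp only [hprod, hvprod, InvMemClass.coe_inv] at h1 h2 h3 h4
  rw [mul_inv_cancel_right] at h4
  rw [← mul_assoc, ← mul_assoc, h3, h2, h4]
  ring

end Length

/-! ### Reflections -/

section Reflection

variable {n : ℕ}

theorem perm_apply_inv_apply (w : Equiv.Perm ℤ) (x : ℤ) : w (w⁻¹ x) = x := w.apply_symm_apply x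

theorem perm_inv_apply_apply (w : Equiv.Perm ℤ) (x : ℤ) : w⁻¹ (w x) = x := w.symm_apply_apply x

/-- The map exchanging `u` with `v` and `-u` with `-v`. -/
def reflFun (u v x : ℤ) : ℤ :=
  if x = u then v else if x = v then u else if x = -u then -v else if x = -v then -u else x

theorem reflFun_involutive {u v : ℤ} (hu : u ≠ 0) (hv : v ≠ 0) :
    Function.Involutive (reflFun u v) := by
  intro x
  unfold reflFun
  split_ifs <;> omega

theorem reflFun_neg {u v : ℤ} (hu : u ≠ 0) (hv : v ≠ 0) (x : ℤ) :
    reflFun u v (-x) = -reflFun u v x := by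
  unfold reflFun
  split_ifs <;> omega

theorem reflFun_left (u v : ℤ) : reflFun u v u = v := by simp [reflFun]

theorem reflFun_of_ne {u v x : ℤ} (h1 : x ≠ u) (h2 : x ≠ v) (h3 : x ≠ -u) (h4 : x ≠ -v) :
    reflFun u v x = x := by simp [reflFun, h1, h2, h3, h4]

/-- The nonzero elements of `{-n, …, n}`. -/
def IsLetter (n : ℕ) (u : ℤ) : Prop := u ≠ 0 ∧ |u| ≤ n

theorem IsLetter.map {u : ℤ} (hu : IsLetter n u) (w : hyperoctahedral n) :
    IsLetter n (w.1 u) := by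
  refine ⟨fun h => hu.1 (w.1.injective ?_), hyperoctahedral_abs_le w hu.2⟩
  rw [h, hyperoctahedral_map_zero]

theorem reflFun_abs_le {u v x : ℤ} (hu : IsLetter n u) (hv : IsLetter n v) (hx : |x| ≤ n) :
    |reflFun u v x| ≤ n := by
  obtain ⟨-, hu⟩ := hu
  obtain ⟨-, hv⟩ := hv
  unfold reflFun
  split_ifs <;> simp [*]

/-- The reflection exchanging the values `u` and `v`. -/
def reflection {u v : ℤ} (hu : IsLetter n u) (hv : IsLetter n v) : hyperoctahedral n :=
  ⟨(reflFun_involutive hu.1 hv.1).toPerm, reflFun_neg hu.1 hv.1, fun x hx => by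
    obtain ⟨-, hu⟩ := hu
    obtain ⟨-, hv⟩ := hv
    rw [abs_le] at hu hv
    rw [lt_abs] at hx
    exact reflFun_of_ne (by omega) (by omega) (by omega) (by omega)⟩

theorem reflection_apply {u v : ℤ} (hu : IsLetter n u) (hv : IsLetter n v) (x : ℤ) :
    (reflection hu hv).1 x = reflFun u v x := rfl

theorem reflection_mul_self {u v : ℤ} (hu : IsLetter n u) (hv : IsLetter n v) :
    reflection hu hv * reflection hu hv = 1 :=
  Subtype.ext (Equiv.ext fun x => reflFun_involutive hu.1 hv.1 x)

theorem reflection_inv_apply {u v : ℤ} (hu : IsLetter n u) (hv : IsLetter n v) (x : ℤ) :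
    (reflection hu hv).1⁻¹ x = reflFun u v x := by
  rw [Equiv.Perm.inv_eq_iff_eq, reflection_apply, reflFun_involutive hu.1 hv.1]

/-- Conjugating a reflection gives a reflection. -/
theorem map_reflFun {u v : ℤ} (g : hyperoctahedral n) (x : ℤ) :
    g.1 (reflFun u v x) = reflFun (g.1 u) (g.1 v) (g.1 x) := by
  have e : ∀ y, g.1 x = -g.1 y ↔ x = -y := fun y => by
    rw [← hyperoctahedral_map_neg, g.1.injective.eq_iff]
  simp only [reflFun, e, g.1.injective.eq_iff]
  split_ifs <;> simp [hyperoctahedral_map_neg]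

theorem coxGen_zero_eq_reflFun (x : ℤ) : coxGen 0 x = reflFun 1 (-1) x := by
  simp only [coxGen_zero_apply, reflFun]
  split_ifs <;> omega

theorem coxGen_one_eq_reflFun (x : ℤ) : coxGen 1 x = reflFun 1 2 x := by
  simp only [coxGen_pos_apply one_pos, reflFun]
  split_ifs <;> omega

/-- If `v = -u`, an element taking `1` to `u` conjugates `s_0` to the reflection. Otherwise one
taking `1` to `u` and `2` to `v` conjugates `s_1`. -/
theorem exists_conj_eq_refl {u v : ℤ} (hu : IsLetter n u) (hv : IsLetter n v) (huv : u ≠ v) :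
    ∃ (g : hyperoctahedral n) (i : ℕ), i < n ∧ (reflection hu hv).1 = g.1 * coxGen i * g.1⁻¹ := by
  have hun := hu.2
  have hu0 := hu.1
  have hvn := hv.2
  have hv0 := hv.1
  rw [abs_le] at hun hvn
  have one : IsLetter n 1 := ⟨one_ne_zero, by rw [abs_one]; omega⟩
  by_cases h : v = -u
  · subst h
    refine ⟨reflection one hu, 0, by omega, Equiv.ext fun x => ?_⟩
    simp only [Equiv.Perm.mul_apply, coxGen_zero_eq_reflFun]
    rw [map_reflFun, ← Equiv.Perm.mul_apply _ _⁻¹ x, mul_inv_cancel,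
      hyperoctahedral_map_neg]
    simp [reflection_apply, reflFun_left]
  -- Here `|u| ≠ |v|`, which forces `n ≥ 2`.
  · have two : IsLetter n 2 := ⟨two_ne_zero, by
      rw [abs_of_pos two_pos]
      omega⟩
    have hz : IsLetter n ((reflection one hu).1⁻¹ v) := hv.map (reflection one hu)⁻¹
    -- The preimage of `v` under the first reflection is not `±1` because `v ≠ ±u`; so the second
    -- reflection can place `2` without disturbing `1`.
    have e1 : (reflection two hz).1 1 = 1 := by
      rw [reflection_apply]
      refine reflFun_of_ne (by omega) ?_ (by omega) ?_
      · rw [ne_eq, Equiv.Perm.eq_inv_iff_eq, reflection_apply, reflFun_left]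
        exact huv
      · rw [ne_eq, ← hyperoctahedral_inv_neg, Equiv.Perm.eq_inv_iff_eq, reflection_apply,
          reflFun_left]
        omega
    have e2 : (reflection two hz).1 2 = (reflection one hu).1⁻¹ v := by
      rw [reflection_apply, reflFun_left]
    refine ⟨reflection one hu * reflection two hz, 1, by omega, Equiv.ext fun x => ?_⟩
    simp only [Equiv.Perm.mul_apply, coxGen_one_eq_reflFun]
    rw [map_reflFun, ← Equiv.Perm.mul_apply _ _⁻¹ x, mul_inv_cancel]
    simp only [Subgroup.coe_mul, Equiv.Perm.mul_apply, e1, e2, Equiv.Perm.one_apply,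
      perm_apply_inv_apply]
    simp [reflection_apply, reflFun_left]

theorem neg_one_pow_coxLength_reflection_mul {u v : ℤ} (hu : IsLetter n u) (hv : IsLetter n v)
    (huv : u ≠ v) (w : hyperoctahedral n) :
    (-1 : ℤ[X]) ^ coxLength n (reflection hu hv * w).1 = -(-1) ^ coxLength n w.1 := by
  obtain ⟨g, i, hi, h⟩ := exists_conj_eq_refl hu hv huv
  rw [← neg_one_pow_coxLength_mul_conj w (w⁻¹ * g) hi, Subgroup.coe_mul, h]
  congr 2
  simp [mul_assoc]

end Reflection

/-! ### Elements of `C_n` whose descents are allowed -/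

section Segments

variable {n : ℕ}

/-- Membership in `C_n^{I^c}` in terms of values. -/
structure IsChessboardQuotient (n : ℕ) (I : Finset ℕ) (w : Equiv.Perm ℤ) : Prop where
  parity : ∀ x : ℤ, |x| ≤ n → Even (w x - x)
  increasing : ∀ i : ℕ, i < n → i ∉ I → w i < w (i + 1)

theorem mem_quotientC_iff {I : Finset ℕ} (hI : I ⊆ Finset.range n) (w : hyperoctahedral n) :
    w ∈ quotientC n (Finset.range n \ I) ↔ IsChessboardQuotient n I w.1 := by
  have hQ : w ∈ quotientB n (Finset.range n \ I) ↔
      ∀ i : ℕ, i < n → i ∉ I → w.1 i < w.1 (i + 1) := by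
    simp only [quotientB, Set.mem_ofPred_eq, Finset.sdiff_sdiff_eq_self hI]
    constructor
    · intro h i hi hiI
      rcases lt_or_gt_of_ne (apply_ne_apply_succ w.1 i) with h1 | h1
      · exact h1
      · exact absurd (h ((mem_descents_iff w).mpr ⟨hi, h1⟩)) hiI
    · intro h i hi
      obtain ⟨h1, h2⟩ := (mem_descents_iff w).mp hi
      by_contra h3
      exact absurd (h i h1 h3) (not_lt.mpr h2.le)
  have hC : w ∈ chessboard n ↔ ∀ x, |x| ≤ (n : ℤ) → Even (w.1 x - x) := by
    simp only [chessboard, Set.mem_ofPred_eq, entry_ne_zero_iff_row, Finset.mem_Icc]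
    constructor
    · intro h
      have pos : ∀ x : ℕ, x ≤ n → Even (w.1 x - x) := by
        intro x hx
        rcases Nat.eq_zero_or_pos x with rfl | h0
        · simp [hyperoctahedral_map_zero w]
        · have hL : IsLetter n (x : ℤ) := ⟨by omega, by rw [abs_of_nonneg] <;> omega⟩
          obtain ⟨h1, h2⟩ := hL.map w
          rw [abs_le] at h2
          have := h (rowOf w.1 x) (by unfold rowOf; omega) x (by omega) rfl
          unfold rowOf at this
          rw [Int.even_iff]
          rw [Nat.even_iff] at this
          omega
      intro x hx
      rcases le_total 0 x with h0 | h0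
      · lift x to ℕ using h0
        exact pos x (by rw [abs_of_nonneg] at hx <;> omega)
      · obtain ⟨y, rfl⟩ : ∃ y, x = -y := ⟨-x, by simp⟩
        have hy : 0 ≤ y := by omega
        lift y to ℕ using hy
        have := pos y (by rw [abs_neg, abs_of_nonneg] at hx <;> omega)
        rw [hyperoctahedral_map_neg, Int.even_iff]
        rw [Int.even_iff] at this
        omega
    · rintro h i - j hj rfl
      have := h j (by rw [abs_of_nonneg] <;> omega)
      unfold rowOf
      rw [Int.even_iff] at this
      rw [Nat.even_iff]
      omega
  rw [quotientC, Set.mem_inter_iff, hQ, hC]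
  exact ⟨fun h => ⟨h.1, h.2⟩, fun h => ⟨h.1, h.2⟩⟩

/-- The number of the seg, right of column `k`, which contains position `p`: `0` for
`|p| ≤ k`, and odd in `p`. -/
noncomputable def seg (I : Finset ℕ) (k : ℕ) (p : ℤ) : ℤ :=
  p.sign * (I.filter fun c => k ≤ c ∧ (c : ℤ) < |p|).card

theorem seg_neg (I : Finset ℕ) (k : ℕ) (p : ℤ) : seg I k (-p) = -seg I k p := by
  simp [seg]

theorem seg_mono (I : Finset ℕ) (k : ℕ) : Monotone (seg I k) := by
  have nonneg : ∀ p, 0 ≤ p → 0 ≤ seg I k p := fun p hp => by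
    unfold seg
    have := Int.sign_nonneg_iff.mpr hp
    positivity
  have pos : ∀ p q, 0 ≤ p → p ≤ q → seg I k p ≤ seg I k q := by
    intro p q hp hpq
    rcases hp.eq_or_lt with rfl | hp
    · have := nonneg q hpq
      simpa [seg] using this
    · simp only [seg, Int.sign_eq_one_of_pos hp, Int.sign_eq_one_of_pos (hp.trans_le hpq),
        one_mul, Nat.cast_le]
      refine Finset.card_le_card fun c hc => ?_
      rw [Finset.mem_filter] at hc ⊢
      rw [abs_of_pos hp] at hc
      rw [abs_of_pos (hp.trans_le hpq)]
      exact ⟨hc.1, hc.2.1, by omega⟩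
  intro p q hpq
  rcases le_total 0 p with hp | hp
  · exact pos p q hp hpq
  · have hp' := nonneg (-p) (by omega)
    rcases le_total 0 q with hq | hq
    · have := nonneg q hq
      rw [seg_neg] at hp'
      omega
    · have := pos (-q) (-p) (by omega) (by omega)
      simp only [seg_neg] at this
      omega

theorem seg_succ {I : Finset ℕ} {i : ℕ} (hi : i ∉ I) (k : ℕ) :
    seg I k (i + 1) = seg I k i := by
  have e : ∀ c ∈ I, ((k ≤ c ∧ (c : ℤ) < |(i : ℤ) + 1|) ↔ (k ≤ c ∧ (c : ℤ) < |(i : ℤ)|)) := by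
    intro c hc
    have : c ≠ i := fun h => hi (h ▸ hc)
    rw [abs_of_nonneg (by omega), abs_of_nonneg (by omega)]
    omega
  rw [seg, seg, Finset.filter_congr e]
  rcases Nat.eq_zero_or_pos i with rfl | h0
  · simp
  · rw [Int.sign_eq_one_of_pos (by omega), Int.sign_eq_one_of_pos (by omega)]

theorem seg_lt {I : Finset ℕ} {k c : ℕ} (hc : c ∈ I) (hkc : k ≤ c) {p q : ℤ} (hp : k < p)
    (hpc : p ≤ c) (hcq : c < q) : seg I k p < seg I k q := by
  simp only [seg, Int.sign_eq_one_of_pos (show 0 < p by omega),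
    Int.sign_eq_one_of_pos (show 0 < q by omega), one_mul, Nat.cast_lt]
  refine Finset.card_lt_card (Finset.ssubset_iff_of_subset ?_ |>.mpr ⟨c, ?_, ?_⟩)
  · intro d hd
    rw [Finset.mem_filter] at hd ⊢
    rw [abs_of_pos (show 0 < p by omega)] at hd
    rw [abs_of_pos (show 0 < q by omega)]
    exact ⟨hd.1, hd.2.1, by omega⟩
  · rw [Finset.mem_filter, abs_of_pos (show 0 < q by omega)]
    exact ⟨hc, hkc, hcq⟩
  · rw [Finset.mem_filter, abs_of_pos (show 0 < p by omega)]
    omega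

theorem seg_eq_zero {I : Finset ℕ} {k : ℕ} {p : ℤ} (hp : |p| ≤ k) : seg I k p = 0 := by
  unfold seg
  rw [Finset.filter_false_of_mem]
  · simp
  · intro c _
    omega

theorem seg_pos_iff {I : Finset ℕ} {k : ℕ} (hk : k ∈ insert n I) {p : ℤ} (hp : |p| ≤ n) :
    0 < seg I k p ↔ k < p := by
  constructor
  · intro h
    by_contra hc
    by_cases h0 : -(k : ℤ) ≤ p
    · rw [seg_eq_zero (abs_le.mpr ⟨h0, by omega⟩)] at h
      omega
    · have := seg_mono I k (show p ≤ 0 by omega)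
      rw [seg_eq_zero (p := 0) (by simp)] at this
      omega
  · intro h
    rw [abs_le] at hp
    rcases Finset.mem_insert.mp hk with rfl | hk
    · omega
    · unfold seg
      rw [Int.sign_eq_one_of_pos (by omega), one_mul, Nat.cast_pos, Finset.card_pos]
      refine ⟨k, Finset.mem_filter.mpr ⟨hk, le_rfl, ?_⟩⟩
      rw [abs_of_pos] <;> omega

theorem seg_neg_iff {I : Finset ℕ} {k : ℕ} (hk : k ∈ insert n I) {p : ℤ} (hp : |p| ≤ n) :
    seg I k p < 0 ↔ p < -k := by
  have := seg_pos_iff hk (p := -p) (by rwa [abs_neg])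
  rw [seg_neg] at this
  omega

theorem seg_eq_zero_iff {I : Finset ℕ} {k : ℕ} (hk : k ∈ insert n I) {p : ℤ} (hp : |p| ≤ n) :
    seg I k p = 0 ↔ |p| ≤ k := by
  have h1 := seg_pos_iff hk hp
  have h2 := seg_neg_iff hk hp
  rw [abs_le]
  omega

/-- A descent between `p` and `q` would be an element of `I` separating their segments. -/
theorem lt_of_segment_eq {I : Finset ℕ} {w : Equiv.Perm ℤ} (hw : IsChessboardQuotient n I w)
    {k : ℕ} {p q : ℤ} (hp : k < p) (hpq : p < q) (hq : q ≤ n)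
    (h : seg I k p = seg I k q) : w p < w q := by
  obtain ⟨d, rfl⟩ : ∃ d : ℕ, q = p + (d + 1 : ℕ) := ⟨(q - p - 1).toNat, by omega⟩
  have hp0 : 0 ≤ p := by omega
  lift p to ℕ using hp0
  clear hpq
  have step : ∀ c : ℕ, p ≤ c → c < p + (d + 1) → w c < w (c + 1) := by
    intro c h1 h2
    refine hw.increasing c (by omega) fun hc => ?_
    have := seg_lt hc (by omega) hp (by omega : (p : ℤ) ≤ c)
      (q := (p : ℤ) + (d + 1 : ℕ)) (by push_cast; omega)
    omega
  clear h hq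
  induction d with
  | zero => simpa using step p le_rfl (by omega)
  | succ d ih =>
    have h1 := ih fun c h1 h2 => step c h1 (by omega)
    have h2 := step (p + (d + 1)) (by omega) (by omega)
    push_cast at h1 h2 ⊢
    rw [← add_assoc] at h2 ⊢
    exact h1.trans (by simpa [add_assoc] using h2)

end Segments

/-! ### Exchanging two values -/

section Exchange

variable {n : ℕ}

/-- The segment containing value `v`. -/
noncomputable def segmentOf (I : Finset ℕ) (k : ℕ) (w : Equiv.Perm ℤ) (v : ℤ) : ℤ :=
  seg I k (w⁻¹ v)

theorem segmentOf_neg (I : Finset ℕ) (k : ℕ) (w : hyperoctahedral n) (v : ℤ) :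
    segmentOf I k w.1 (-v) = -segmentOf I k w.1 v := by
  rw [segmentOf, hyperoctahedral_inv_neg, seg_neg, segmentOf]

theorem segmentOf_reflection_mul {u v : ℤ} (hu : IsLetter n u) (hv : IsLetter n v) (I : Finset ℕ)
    (k : ℕ) (w : hyperoctahedral n) (x : ℤ) :
    segmentOf I k (reflection hu hv * w).1 x = segmentOf I k w.1 (reflFun u v x) := by
  rw [segmentOf, Subgroup.coe_mul, mul_inv_rev, Equiv.Perm.mul_apply, reflection_inv_apply,
    segmentOf]

/-- Odd inversions of `w` and `w'` are matched pair by pair. A pair that both compare alike is kept;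
any other pair is moved by `ρ`, which by hypothesis preserves the order of its positions, and `w' =
w ∘ ρ` carries the inversion over. -/
theorem statL_eq_of_involutive {w w' : Equiv.Perm ℤ} {ρ : ℤ → ℤ} (hρ : Function.Involutive ρ)
    (hw : ∀ i, w' i = w (ρ i)) (hn : ∀ i : ℤ, |i| ≤ n → |ρ i| ≤ n)
    (hpar : ∀ i : ℤ, |i| ≤ n → Even (ρ i - i))
    (h : ∀ i j : ℤ, |i| ≤ n → |j| ≤ n → Odd (i - j) →
      (w' i < w' j ↔ w i < w j) ∨ (ρ i < ρ j ↔ i < j)) :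
    statL n w' = statL n w := by
  have hw2 : ∀ i, w i = w' (ρ i) := fun i => by rw [hw, hρ]
  let φ : ℤ × ℤ → ℤ × ℤ := fun p =>
    if (w' p.1 < w' p.2 ↔ w p.1 < w p.2) then p else (ρ p.1, ρ p.2)
  have key : ∀ a b : Equiv.Perm ℤ, (a = w ∧ b = w' ∨ a = w' ∧ b = w) →
      ∀ p ∈ oddInversions n a, φ p ∈ oddInversions n b ∧ φ (φ p) = p := by
    rintro a b hab ⟨i, j⟩ hp
    simp only [oddInversions, Finset.mem_filter, Finset.mem_product, Finset.mem_Icc,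
      Int.modEq_iff_dvd] at hp
    obtain ⟨⟨hi, hj⟩, hij, hinv, hodd⟩ := hp
    have hi' : |i| ≤ n := abs_le.mpr hi
    have hj' : |j| ≤ n := abs_le.mpr hj
    have hij' := h i j hi' hj' (by rw [Int.odd_iff]; omega)
    have hpi := hpar i hi'
    have hpj := hpar j hj'
    have hni := abs_le.mp (hn i hi')
    have hnj := abs_le.mp (hn j hj')
    have ni : w i ≠ w j := fun e => by have := w.injective e; omega
    have ni' : w' i ≠ w' j := fun e => by have := w'.injective e; omega
    by_cases hc : w' i < w' j ↔ w i < w j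
    · simp only [φ, hc, if_true, and_true]
      simp only [oddInversions, Finset.mem_filter, Finset.mem_product, Finset.mem_Icc,
        Int.modEq_iff_dvd]
      refine ⟨⟨hi, hj⟩, hij, ?_, hodd⟩
      rcases hab with ⟨rfl, rfl⟩ | ⟨rfl, rfl⟩ <;> omega
    · have hρij : ρ i < ρ j := by tauto
      -- The test defining `φ` has the same outcome at the moved pair, so `φ` is an involution.
      have hc2 : ¬ (w' (ρ i) < w' (ρ j) ↔ w (ρ i) < w (ρ j)) := by
        rw [← hw, ← hw, ← hw2, ← hw2]
        tauto
      simp only [φ, hc, hc2, if_false, hρ i, hρ j, and_true]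
      simp only [oddInversions, Finset.mem_filter, Finset.mem_product, Finset.mem_Icc,
        Int.modEq_iff_dvd]
      rw [Int.even_iff] at hpi hpj
      refine ⟨⟨hni, hnj⟩, hρij, ?_, by omega⟩
      rcases hab with ⟨rfl, rfl⟩ | ⟨rfl, rfl⟩
      · rw [← hw2, ← hw2]; exact hinv
      · rw [← hw, ← hw]; exact hinv
  unfold statL
  congr 1
  exact Finset.card_nbij' φ φ (fun p hp => (key w' w (Or.inr ⟨rfl, rfl⟩) p hp).1)
    (fun p hp => (key w w' (Or.inl ⟨rfl, rfl⟩) p hp).1)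
    (fun p hp => (key w' w (Or.inr ⟨rfl, rfl⟩) p hp).2)
    (fun p hp => (key w w' (Or.inl ⟨rfl, rfl⟩) p hp).2)

/-- The values `u` and `v` may be exchanged: all values of the other parity between them lie in
segments on one side of those of `u` and `v`. -/
def IsExchangeable (I : Finset ℕ) (k : ℕ) (w : Equiv.Perm ℤ) (u v : ℤ) : Prop :=
  u < v ∧ Even (u - v) ∧ ∀ z, u < z → z < v → Odd (z - u) →
    (segmentOf I k w z < segmentOf I k w u ∧ segmentOf I k w z < segmentOf I k w v) ∨
    (segmentOf I k w u < segmentOf I k w z ∧ segmentOf I k w v < segmentOf I k w z)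

theorem reflFun_sub_even {u v : ℤ} (h : Even (u - v)) (x : ℤ) : Even (reflFun u v x - x) := by
  rw [Int.even_iff] at *
  unfold reflFun
  split_ifs <;> omega

/-- The order of values can change only for a moved value and a value of the other parity between
`u` and `v`, or between `-v` and `-u`. The latter lies in a segment on one side of both exchanged
ones, so the order of positions is then unaffected. -/
theorem IsExchangeable.order {I : Finset ℕ} {k : ℕ} {w : hyperoctahedral n} {u v : ℤ}
    (h : IsExchangeable I k w.1 u v) (hu : u ≠ 0) (hv : v ≠ 0) {x y : ℤ} (hxy : Odd (x - y)) :
    (reflFun u v x < reflFun u v y ↔ x < y) ∨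
      ((w.1⁻¹ (reflFun u v x) < w.1⁻¹ (reflFun u v y) ↔ w.1⁻¹ x < w.1⁻¹ y) ∧
        segmentOf I k w.1 x ≠ segmentOf I k w.1 y) := by
  obtain ⟨huv, heven, h⟩ := h
  have key : ∀ z, u < z → z < v → Odd (z - u) →
      (segmentOf I k w.1 z ≠ segmentOf I k w.1 u ∧ segmentOf I k w.1 z ≠ segmentOf I k w.1 v) ∧
      ((w.1⁻¹ z < w.1⁻¹ u ∧ w.1⁻¹ z < w.1⁻¹ v) ∨ (w.1⁻¹ u < w.1⁻¹ z ∧ w.1⁻¹ v < w.1⁻¹ z)) := by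
    intro z h1 h2 h3
    have mono : ∀ a b, segmentOf I k w.1 a < segmentOf I k w.1 b → w.1⁻¹ a < w.1⁻¹ b :=
      fun a b hab => (seg_mono I k).reflect_lt hab
    rcases h z h1 h2 h3 with ⟨h4, h5⟩ | ⟨h4, h5⟩
    · exact ⟨⟨h4.ne, h5.ne⟩, Or.inl ⟨mono _ _ h4, mono _ _ h5⟩⟩
    · exact ⟨⟨h4.ne', h5.ne'⟩, Or.inr ⟨mono _ _ h4, mono _ _ h5⟩⟩
  have nu := segmentOf_neg I k w u
  have nv := segmentOf_neg I k w v
  have pu := hyperoctahedral_inv_neg w u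
  have pv := hyperoctahedral_inv_neg w v
  have rv : reflFun u v v = u := by unfold reflFun; split_ifs <;> omega
  have ru' : reflFun u v (-u) = -v := by unfold reflFun; split_ifs <;> omega
  have rv' : reflFun u v (-v) = -u := by unfold reflFun; split_ifs <;> omega
  -- The four moved values have equal parity, so at most one of `x` and `y` is moved. If `u < 0 <
  -- v`, both `y` and `-y` may lie between `u` and `v`.
  have moved : ∀ x y, (x = u ∨ x = v ∨ x = -u ∨ x = -v) → Odd (x - y) →
      ((reflFun u v x < y ↔ x < y) ∧ (y < reflFun u v x ↔ y < x)) ∨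
      ((w.1⁻¹ (reflFun u v x) < w.1⁻¹ y ↔ w.1⁻¹ x < w.1⁻¹ y) ∧
        (w.1⁻¹ y < w.1⁻¹ (reflFun u v x) ↔ w.1⁻¹ y < w.1⁻¹ x) ∧
        segmentOf I k w.1 x ≠ segmentOf I k w.1 y) := by
    intro x y hx hxy
    rw [Int.odd_iff] at hxy
    rw [Int.even_iff] at heven
    have ny := segmentOf_neg I k w y
    have py := hyperoctahedral_inv_neg w y
    by_cases h1 : u < y ∧ y < v
    · obtain ⟨⟨k1, k2⟩, k3⟩ := key y h1.1 h1.2 (by rw [Int.odd_iff]; omega)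
      by_cases h2 : u < -y ∧ -y < v
      · obtain ⟨⟨k4, k5⟩, k6⟩ := key (-y) h2.1 h2.2 (by rw [Int.odd_iff]; omega)
        rcases hx with rfl | rfl | rfl | rfl
        · rw [reflFun_left]; omega
        · rw [rv]; omega
        · rw [ru']; omega
        · rw [rv']; omega
      · rcases hx with rfl | rfl | rfl | rfl
        · rw [reflFun_left]; omega
        · rw [rv]; omega
        · rw [ru']; omega
        · rw [rv']; omega
    · by_cases h2 : u < -y ∧ -y < v
      · obtain ⟨⟨k4, k5⟩, k6⟩ := key (-y) h2.1 h2.2 (by rw [Int.odd_iff]; omega)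
        clear key h
        rcases hx with rfl | rfl | rfl | rfl
        · rw [reflFun_left]; omega
        · rw [rv]; omega
        · rw [ru']; omega
        · rw [rv']; omega
      · clear key h
        rcases hx with rfl | rfl | rfl | rfl
        · rw [reflFun_left]; omega
        · rw [rv]; omega
        · rw [ru']; omega
        · rw [rv']; omega
  by_cases hx : x = u ∨ x = v ∨ x = -u ∨ x = -v
  · have hy : reflFun u v y = y := by
      rw [Int.odd_iff] at hxy
      rw [Int.even_iff] at heven
      exact reflFun_of_ne (by omega) (by omega) (by omega) (by omega)
    rw [hy]
    rcases moved x y hx hxy with h1 | h1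
    · exact Or.inl h1.1
    · exact Or.inr ⟨h1.1, h1.2.2⟩
  · have hx' : reflFun u v x = x := by
      simp only [not_or] at hx
      exact reflFun_of_ne hx.1 hx.2.1 hx.2.2.1 hx.2.2.2
    rw [hx']
    by_cases hy : y = u ∨ y = v ∨ y = -u ∨ y = -v
    · rcases moved y x hy (by rw [Int.odd_iff] at *; omega) with h1 | h1
      · exact Or.inl h1.2
      · exact Or.inr ⟨h1.2.1, h1.2.2.symm⟩
    · simp only [not_or] at hy
      rw [reflFun_of_ne hy.1 hy.2.1 hy.2.2.1 hy.2.2.2]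
      exact Or.inl Iff.rfl

theorem IsExchangeable.reflection_mul {I : Finset ℕ} {k : ℕ} {w : hyperoctahedral n}
    (hw : IsChessboardQuotient n I w.1) {u v : ℤ} (h : IsExchangeable I k w.1 u v)
    (hu : IsLetter n u) (hv : IsLetter n v) :
    IsChessboardQuotient n I (reflection hu hv * w).1 ∧
      statL n (reflection hu hv * w).1 = statL n w.1 ∧
      (-1 : ℤ[X]) ^ coxLength n (reflection hu hv * w).1 = -(-1) ^ coxLength n w.1 := by
  have happ : ∀ x, (reflection hu hv * w).1 x = reflFun u v (w.1 x) := fun x => rfl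
  have hpar : ∀ x : ℤ, |x| ≤ n → Even (w.1 x - x) := hw.parity
  have hodd : ∀ x y : ℤ, |x| ≤ n → |y| ≤ n → Odd (x - y) → Odd (w.1 x - w.1 y) := by
    intro x y hx hy hxy
    have h1 := hpar x hx
    have h2 := hpar y hy
    rw [Int.even_iff] at *
    rw [Int.odd_iff] at *
    omega
  refine ⟨⟨fun x hx => ?_, fun i hi hiI => ?_⟩, ?_,
    neg_one_pow_coxLength_reflection_mul hu hv h.1.ne w⟩
  · rw [happ]
    have := (reflFun_sub_even h.2.1 (w.1 x)).add (hpar x hx)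
    simpa using this
  · rw [happ, happ]
    have hlt := hw.increasing i hi hiI
    have hO := hodd i (i + 1) (by rw [abs_of_nonneg] <;> omega) (by rw [abs_of_nonneg] <;> omega)
      (by rw [Int.odd_iff]; omega)
    rcases h.order hu.1 hv.1 hO with h1 | ⟨-, h2⟩
    · exact h1.mpr hlt
    -- Positions `i` and `i + 1` share a segment since `i ∉ I`, so the order of their values must be
    -- the thing preserved.
    · refine absurd ?_ h2
      simp only [segmentOf, perm_inv_apply_apply]
      exact (seg_succ hiI k).symm
  · refine statL_eq_of_involutive (ρ := fun x => w.1⁻¹ (reflFun u v (w.1 x))) ?_ ?_ ?_ ?_ ?_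
    · intro x
      simp only [perm_apply_inv_apply]
      rw [reflFun_involutive hu.1 hv.1, perm_inv_apply_apply]
    · intro x
      rw [happ, perm_apply_inv_apply]
    · intro x hx
      exact hyperoctahedral_inv_abs_le w (reflFun_abs_le hu hv (hyperoctahedral_abs_le w hx))
    · intro x hx
      have h1 := hpar _ (hyperoctahedral_inv_abs_le w
        (reflFun_abs_le hu hv (hyperoctahedral_abs_le w hx)))
      rw [perm_apply_inv_apply] at h1
      have h2 := reflFun_sub_even h.2.1 (w.1 x)
      have h3 := hpar x hx
      rw [Int.even_iff] at *
      omega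
    · intro x y hx hy hxy
      rw [happ, happ]
      have := h.order hu.1 hv.1 (hodd x y hx hy hxy)
      simp only [perm_inv_apply_apply] at this
      tauto

end Exchange

/-! ### Row patterns -/

section RowPattern

variable {m : ℕ} {G : ℕ → ℤ}

/-- The number of rows `q` in `{r + 1, …, m}` with `G q = j`. -/
def rowCount (G : ℕ → ℤ) (m : ℕ) (j : ℤ) (r : ℕ) : ℕ :=
  ((Finset.Ioc r m).filter fun q => G q = j).card

/-- The parity constraints which the columns of an element of `C_n` right of `k` impose on the map
`G` from rows to signed segments: entries of a segment alternate in parity. -/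
structure IsRowPattern (m : ℕ) (G : ℕ → ℤ) : Prop where
  alternating : ∀ r, 1 ≤ r → r ≤ m → (Even (rowCount G m (G r) r + m + r) ↔ 0 ≤ G r)
  even_add : ∀ j, j ≠ 0 → Even (rowCount G m j 0 + rowCount G m (-j) 0)
  even_zero : Even (rowCount G m 0 0 + m)

/-- Row `r` fails to complete a pair begun in row `r + 1`. -/
def IsFailure (m : ℕ) (G : ℕ → ℤ) (r : ℕ) : Prop :=
  1 ≤ r ∧ r < m ∧ Even (m + r) ∧ G (r + 1) < 0 ∧ G r ≠ G (r + 1)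

/-- All segments are filled to an even extent by the rows below row `r`. -/
def FilledEvenly (m : ℕ) (G : ℕ → ℤ) (r : ℕ) : Prop :=
  (∀ j, Even (rowCount G m j r)) ∧ (r < m → 0 ≤ G (r + 1))

/-- Row `r₀` is the last nonnegative row below `r`, and just its segment and that of row `r + 1` are
filled to an odd extent by the rows below row `r`. -/
def FilledPending (m : ℕ) (G : ℕ → ℤ) (r r₀ : ℕ) : Prop :=
  r + 1 < r₀ ∧ r₀ ≤ m ∧ Even (m + r₀) ∧ 0 ≤ G r₀ ∧ (∀ q, r < q → q < r₀ → G q < 0) ∧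
    ∀ j, Odd (rowCount G m j r) ↔ j = G r₀ ∨ j = G (r + 1)

theorem rowCount_self (j : ℤ) : rowCount G m j m = 0 := by simp [rowCount]

theorem rowCount_succ {r : ℕ} (hr : r < m) (j : ℤ) :
    rowCount G m j r = rowCount G m j (r + 1) + if G (r + 1) = j then 1 else 0 := by
  have e : Finset.Ioc r m = insert (r + 1) (Finset.Ioc (r + 1) m) := by
    ext x
    simp only [Finset.mem_Ioc, Finset.mem_insert]
    omega
  unfold rowCount
  rw [e, Finset.filter_insert]
  split_ifs
  · rw [Finset.card_insert_of_notMem (by simp)]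
  · rfl

/-- Upward induction, two rows at a time. From the evenly filled state, `alternating` makes row `r +
2` nonnegative. Then row `r + 1` is either nonnegative, and parity puts it in the same segment, or
negative, which opens a pending state with `r₀ = r + 2`. From the pending state, absence of failure
makes row `r + 2` repeat the segment of row `r + 3`, so only `G r₀` stays odd. A nonnegative row `r
+ 1` must then fill that segment up, and a negative one keeps the state pending. -/
theorem IsRowPattern.complete_or_pending (h : IsRowPattern m G) (d r : ℕ) (hd : r + 2 * d = m)
    (hf : ∀ q, r < q → ¬ IsFailure m G q) :
    FilledEvenly m G r ∨ ∃ r₀, FilledPending m G r r₀ := by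
  induction d generalizing r with
  | zero =>
    left
    obtain rfl : r = m := by omega
    exact ⟨fun j => by simp [rowCount_self], by omega⟩
  | succ d ih =>
    have e1 := rowCount_succ (G := G) (show r < m by omega)
    have e2 := rowCount_succ (G := G) (show r + 1 < m by omega)
    have a1 := h.alternating (r + 1) (by omega) (by omega)
    have a2 := h.alternating (r + 2) (by omega) (by omega)
    have e2' := e2 (G (r + 1))
    simp only [add_assoc, Nat.reduceAdd] at e1 e2 e2' a1 a2
    rcases ih (r + 2) (by omega) fun q hq => hf q (by omega) with
      ⟨hc, -⟩ | ⟨r₀, h1, h2, h3, h4, h5, h6⟩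
    · have h0 : 0 ≤ G (r + 2) := by
        rw [← a2]
        have := hc (G (r + 2))
        rw [Nat.even_iff] at *
        omega
      have hc1 := hc (G (r + 1))
      by_cases hn : 0 ≤ G (r + 1)
      · have heq : G (r + 2) = G (r + 1) := by
          by_contra hne
          rw [if_neg hne] at e2'
          have := a1.mpr hn
          rw [Nat.even_iff] at *
          omega
        refine Or.inl ⟨fun j => ?_, fun _ => hn⟩
        rw [e1, e2, heq]
        have := hc j
        rw [Nat.even_iff] at *
        split_ifs <;> omega
      · refine Or.inr ⟨r + 2, by omega, by omega, ?_, h0, ?_, ?_⟩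
        · rw [Nat.even_iff]; omega
        · intro q hq1 hq2
          obtain rfl : q = r + 1 := by omega
          omega
        · intro j
          rw [e1, e2]
          have := hc j
          rw [Nat.even_iff] at this
          rw [Nat.odd_iff]
          split_ifs with i1 i2 <;> omega
    · have hb : G (r + 2) = G (r + 3) := by
        by_contra hne
        refine hf (r + 2) (by omega) ⟨by omega, by omega, ?_, h5 _ (by omega) (by omega), hne⟩
        rw [Nat.even_iff]; omega
      have hbneg := h5 (r + 3) (by omega) (by omega)
      have hodd : ∀ j, rowCount G m j (r + 1) % 2 = 1 ↔ j = G r₀ := by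
        intro j
        have := h6 j
        rw [e2, hb]
        rw [Nat.odd_iff] at this
        simp only [add_assoc, Nat.reduceAdd] at this
        split_ifs <;> omega
      have hodd1 := hodd (G (r + 1))
      by_cases hn : 0 ≤ G (r + 1)
      · have heq : G (r + 1) = G r₀ := by
          rw [← hodd]
          have := a1.mpr hn
          rw [Nat.even_iff] at *
          omega
        refine Or.inl ⟨fun j => ?_, fun _ => hn⟩
        rw [e1, heq]
        have := hodd j
        rw [Nat.even_iff]
        split_ifs <;> omega
      · refine Or.inr ⟨r₀, by omega, h2, h3, h4, ?_, ?_⟩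
        · intro q hq1 hq2
          rcases Nat.lt_or_ge (r + 2) q with h7 | h7
          · exact h5 q h7 hq2
          · rcases (show q = r + 1 ∨ q = r + 2 by omega) with rfl | rfl
            · omega
            · omega
        · intro j
          rw [e1]
          have := hodd j
          rw [Nat.odd_iff]
          split_ifs <;> omega

theorem IsRowPattern.nonneg_of_complete (h : IsRowPattern m G) {r : ℕ} (h1 : 1 ≤ r) (hr : r ≤ m)
    (hpar : Even (m + r)) (hc : FilledEvenly m G r) : 0 ≤ G r := by
  rw [← h.alternating r h1 hr]
  have := hc.1 (G r)
  rw [Nat.even_iff] at *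
  omega

/-- `r` is the largest failing row, and `r₀` the next larger nonnegative row. -/
structure IsLastFailure (m : ℕ) (G : ℕ → ℤ) (r r₀ : ℕ) : Prop where
  failure : IsFailure m G r
  last : ∀ q, r < q → ¬ IsFailure m G q
  lt : r + 1 < r₀
  le : r₀ ≤ m
  nonneg : 0 ≤ G r
  nonneg' : 0 ≤ G r₀
  even : Even (r + r₀)
  neg : ∀ q, r < q → q < r₀ → G q < 0

/-- Above the largest failure the scan must be pending, since row `r + 1` is negative; this supplies
`r₀`. If `G r` were negative, its segment would be filled oddly, hence equal to `G (r + 1)`, against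
the failure. -/
theorem IsRowPattern.exists_isLastFailure (h : IsRowPattern m G) (hf : ∃ r, IsFailure m G r) :
    ∃ r r₀, IsLastFailure m G r r₀ := by
  classical
  obtain ⟨q, hq⟩ := hf
  have hP := Nat.findGreatest_spec (P := IsFailure m G) (n := m) hq.2.1.le hq
  have hlast : ∀ q, Nat.findGreatest (IsFailure m G) m < q → ¬ IsFailure m G q :=
    fun q hq hF => absurd (Nat.le_findGreatest hF.2.1.le hF) (by omega)
  generalize Nat.findGreatest (IsFailure m G) m = r at hP hlast
  obtain ⟨h1, h2, h3, h4, h5⟩ := id hP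
  have hd : r + 2 * ((m - r) / 2) = m := by
    rw [Nat.even_iff] at h3
    omega
  rcases h.complete_or_pending _ r hd hlast with hc | ⟨r₀, p1, p2, p3, p4, p5, p6⟩
  · have := hc.2 h2
    omega
  · refine ⟨r, r₀, hP, hlast, p1, p2, ?_, p4, ?_, p5⟩
    · by_contra hneg
      have ha := h.alternating r h1 h2.le
      have hodd : Odd (rowCount G m (G r) r) := by
        rw [Nat.odd_iff]
        rw [Nat.even_iff] at *
        omega
      rcases (p6 _).mp hodd with e | e <;> omega
    · rw [Nat.even_iff] at *
      omega

theorem IsLastFailure.unique {r r₀ s s₀ : ℕ} (h : IsLastFailure m G r r₀)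
    (h' : IsLastFailure m G s s₀) : r = s ∧ r₀ = s₀ := by
  have e : r = s := by
    rcases lt_trichotomy r s with hlt | heq | hlt
    · exact absurd h'.failure (h.last s hlt)
    · exact heq
    · exact absurd h.failure (h'.last r hlt)
  subst e
  refine ⟨rfl, ?_⟩
  rcases lt_trichotomy r₀ s₀ with hlt | heq | hlt
  · have := h'.neg r₀ (by have := h.lt; omega) hlt
    have := h.nonneg'
    omega
  · exact heq
  · have := h.neg s₀ (by have := h'.lt; omega) hlt
    have := h'.nonneg'
    omega

/-- Failures do not see which nonnegative value a row has, so exchanging two nonnegative rows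
neither creates nor destroys any. -/
theorem isFailure_congr {G' : ℕ → ℤ} (h : ∀ q, 1 ≤ q → q ≤ m → G q = G' q ∨ (0 ≤ G q ∧ 0 ≤ G' q))
    (r : ℕ) : IsFailure m G r ↔ IsFailure m G' r := by
  unfold IsFailure
  constructor
  · rintro ⟨h1, h2, h3, h4, h5⟩
    have := h r h1 h2.le
    have := h (r + 1) (by omega) h2
    exact ⟨h1, h2, h3, by omega, by omega⟩
  · rintro ⟨h1, h2, h3, h4, h5⟩
    have := h r h1 h2.le
    have := h (r + 1) (by omega) h2
    exact ⟨h1, h2, h3, by omega, by omega⟩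

/-- Exchanging the values at `r` and `r₀` retains the last failure. -/
theorem IsLastFailure.exchange {G' : ℕ → ℤ} {r r₀ : ℕ} (h : IsLastFailure m G r r₀)
    (hr : G' r = G r₀) (hr₀ : G' r₀ = G r) (hG : ∀ q, 1 ≤ q → q ≤ m → q ≠ r → q ≠ r₀ → G' q = G q) :
    IsLastFailure m G' r r₀ := by
  have n1 := h.nonneg
  have n2 := h.nonneg'
  have l1 := h.lt
  have l2 := h.le
  have hc := isFailure_congr (m := m) (G := G) (G' := G') fun q h1 h2 => by
    by_cases e1 : q = r
    · subst e1; omega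
    · by_cases e2 : q = r₀
      · subst e2; omega
      · exact Or.inl (hG q h1 h2 e1 e2).symm
  exact ⟨(hc r).mp h.failure, fun q hq => (hc q).not.mp (h.last q hq), l1, l2, by omega, by omega,
    h.even, fun q h1 h2 => by
      rw [hG q (by omega) (by omega) (by omega) (by omega)]
      exact h.neg q h1 h2⟩

/-! ### Patterns without failure -/

theorem IsRowPattern.state (h : IsRowPattern m G) (hf : ∀ r, ¬ IsFailure m G r) {r : ℕ}
    (hr : r ≤ m) (hpar : Even (m + r)) : FilledEvenly m G r ∨ ∃ r₀, FilledPending m G r r₀ :=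
  h.complete_or_pending ((m - r) / 2) r (by rw [Nat.even_iff] at hpar; omega) fun q _ => hf q

theorem eq_of_not_isFailure (hf : ∀ r, ¬ IsFailure m G r) {r : ℕ} (h1 : 1 ≤ r)
    (hr : r < m) (hpar : Even (m + r)) (hneg : G (r + 1) < 0) : G r = G (r + 1) := by
  by_contra hne
  exact hf r ⟨h1, hr, hpar, hneg, hne⟩

theorem IsRowPattern.nonneg_last (h : IsRowPattern m G) (hm : 1 ≤ m) : 0 ≤ G m :=
  h.nonneg_of_complete hm le_rfl (by simp) ⟨fun j => by simp [rowCount_self], by omega⟩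

/-- In the pending state row `r` would have to repeat the negative row `r + 1`. -/
theorem IsRowPattern.complete_of_nonneg (h : IsRowPattern m G) (hf : ∀ r, ¬ IsFailure m G r)
    {r : ℕ} (h1 : 1 ≤ r) (hr : r ≤ m) (hpar : Even (m + r)) (hn : 0 ≤ G r) :
    FilledEvenly m G r := by
  rcases h.state hf hr hpar with hc | ⟨r₀, p1, p2, p3, p4, p5, p6⟩
  · exact hc
  · have hlt := p5 (r + 1) (by omega) p1
    have := eq_of_not_isFailure hf h1 (by omega) hpar hlt
    omega

/-- The scan pairs row `r` with row `r + 1` exactly when `m + r` is even. This fixes the parities of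
the ends of all runs of negative rows. -/
theorem IsRowPattern.neg_iff (h : IsRowPattern m G) (hf : ∀ r, ¬ IsFailure m G r)
    {r : ℕ} (h1 : 1 ≤ r) (hr : r < m) (hpar : Even (m + r)) : G r < 0 ↔ G (r + 1) < 0 := by
  constructor
  · intro hn
    rcases h.state hf hr.le hpar with hc | ⟨r₀, p1, p2, p3, p4, p5, p6⟩
    · have := h.nonneg_of_complete h1 hr.le hpar hc
      omega
    · exact p5 _ (by omega) p1
  · intro hn
    rw [eq_of_not_isFailure hf h1 hr hpar hn]
    exact hn

/-- Nonnegative rows come in pairs. -/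
theorem IsRowPattern.eq_of_next (h : IsRowPattern m G) (hf : ∀ r, ¬ IsFailure m G r) {r q : ℕ}
    (h1 : 1 ≤ r) (hrq : r < q) (hq : q ≤ m) (hpar : Even (m + q)) (hnr : 0 ≤ G r) (hnq : 0 ≤ G q)
    (hneg : ∀ x, r < x → x < q → G x < 0) : G r = G q ∧ Odd (m + r) := by
  have hparr : Odd (m + r) := by
    by_contra hcon
    rw [Nat.not_odd_iff_even] at hcon
    have h3 : r + 1 < q := by
      rw [Nat.even_iff] at *
      omega
    have := (h.neg_iff hf h1 (by omega) hcon).mpr (hneg _ (by omega) h3)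
    omega
  refine ⟨?_, hparr⟩
  have hal := (h.alternating r h1 (by omega)).mpr hnr
  have hcnt := rowCount_succ (G := G) (m := m) (show r < m by omega) (G r)
  rcases (show r + 1 = q ∨ r + 1 < q by omega) with rfl | hlt
  · have hc := (h.complete_of_nonneg hf (by omega) hq hpar hnq).1 (G r)
    split_ifs at hcnt with e
    · exact e.symm
    -- If the segments differed, `G r` would be filled evenly below row `r`, where `alternating`
    -- demands an odd count.
    · rw [Nat.even_iff] at *
      rw [Nat.odd_iff] at hparr
      omega
  · have hneg1 := hneg (r + 1) (by omega) hlt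
    have hpar1 : Even (m + (r + 1)) := by
      rw [Nat.odd_iff] at hparr
      rw [Nat.even_iff]
      omega
    rw [if_neg (by omega)] at hcnt
    rcases h.state hf (show r + 1 ≤ m by omega) hpar1 with hc | ⟨r₀, p1, p2, p3, p4, p5, p6⟩
    · have := h.nonneg_of_complete (by omega) (by omega) hpar1 hc
      omega
    · have e : r₀ = q := by
        rcases lt_trichotomy r₀ q with hlt | heq | hlt
        · have := hneg r₀ (by omega) hlt
          omega
        · exact heq
        · have := p5 q (by omega) hlt
          omega
      subst e
      have hodd : Odd (rowCount G m (G r) (r + 1)) := by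
        rw [Nat.odd_iff] at *
        rw [Nat.even_iff] at hal
        omega
      rcases (p6 _).mp hodd with e | e
      · exact e
      · have := p5 (r + 1 + 1) (by omega) p1
        omega

/-- If row `1` is negative, then it is paired with the first nonnegative row. -/
theorem IsRowPattern.eq_neg_of_first (h : IsRowPattern m G) (hf : ∀ r, ¬ IsFailure m G r) {q : ℕ}
    (hm : Even m) (h1 : 1 < q) (hq : q ≤ m) (hnq : 0 ≤ G q)
    (hneg : ∀ x, 1 ≤ x → x < q → G x < 0) : G q = -G 1 := by
  rcases h.state hf (Nat.zero_le m) (by simpa using hm) with hc | ⟨r₀, p1, p2, p3, p4, p5, p6⟩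
  · have := hc.2 (by omega)
    have := hneg 1 le_rfl h1
    rw [zero_add] at *
    omega
  · have e : r₀ = q := by
      rcases lt_trichotomy r₀ q with hlt | heq | hlt
      · have := hneg r₀ (by omega) hlt
        omega
      · exact heq
      · have := p5 q (by omega) hlt
        omega
    subst e
    have h0 := h.even_zero
    have hne : G r₀ ≠ 0 := fun e => by
      have := (p6 0).mpr (Or.inl e.symm)
      rw [Nat.even_iff] at *
      rw [Nat.odd_iff] at this
      omega
    -- Segments `G r₀` and `-G r₀` together hold an even number of rows, so both are filled oddly.
    -- The only oddly filled segments are `G r₀` and `G 1`.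
    have hs := h.even_add _ hne
    have ho := (p6 (G r₀)).mpr (Or.inl rfl)
    have ho' : Odd (rowCount G m (-G r₀) 0) := by
      rw [Nat.even_iff] at hs
      rw [Nat.odd_iff] at *
      omega
    rw [zero_add] at p6
    rcases (p6 _).mp ho' with e | e <;> omega

/-- A positive row `1` would leave an even number of zeros in the rows below it and hence in all,
but the number of zeros has the parity of `m`. -/
theorem IsRowPattern.first_nonpos (h : IsRowPattern m G) (hf : ∀ r, ¬ IsFailure m G r)
    (hm : Odd m) : G 1 ≤ 0 := by
  by_contra hcon
  have hm1 : 1 ≤ m := hm.pos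
  have hc := h.complete_of_nonneg hf le_rfl hm1
    (by rw [Nat.even_iff]; rw [Nat.odd_iff] at hm; omega)
    (by omega)
  have h0 := h.even_zero
  have h2 := hc.1 0
  rw [rowCount_succ (by omega), if_neg (by rw [zero_add]; omega)] at h0
  rw [Nat.even_iff] at *
  rw [Nat.odd_iff] at hm
  simp only [zero_add] at *
  omega

end RowPattern

/-! ### Blocks of a row pattern -/

section Blocks

variable {n m : ℕ} {G : ℕ → ℤ}

/-- A maximal interval of rows on which `G` does not vanish. -/
def IsNonzeroBlock (n : ℕ) (G : ℕ → ℤ) (r s : ℕ) : Prop :=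
  1 ≤ r ∧ r ≤ s ∧ s ≤ n ∧ (∀ t, r ≤ t → t ≤ s → G t ≠ 0) ∧ (s ≠ n → G (s + 1) = 0) ∧
    (r ≠ 1 → G (r - 1) = 0)

/-- A maximal interval of rows on which `G` is positive. -/
def IsPosBlock (n : ℕ) (G : ℕ → ℤ) (r s : ℕ) : Prop :=
  1 ≤ r ∧ r ≤ s ∧ s ≤ n ∧ (∀ t, r ≤ t → t ≤ s → 0 < G t) ∧ (s ≠ n → G (s + 1) ≤ 0) ∧
    (r ≠ 1 → G (r - 1) ≤ 0)

theorem exists_isPosBlock {t : ℕ} (h1 : 1 ≤ t) (hn : t ≤ n) (ht : 0 < G t) :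
    ∃ r s, IsPosBlock n G r s ∧ r ≤ t ∧ t ≤ s := by
  have up : ∀ d t, t + d = n → 0 < G t →
      ∃ s, t ≤ s ∧ s ≤ n ∧ (∀ q, t ≤ q → q ≤ s → 0 < G q) ∧ (s ≠ n → G (s + 1) ≤ 0) := by
    intro d
    induction d with
    | zero =>
      intro t htn ht
      refine ⟨t, le_rfl, by omega, fun q h2 h3 => ?_, by omega⟩
      obtain rfl : q = t := by omega
      exact ht
    | succ d ih =>
      intro t htn ht
      by_cases hp : 0 < G (t + 1)
      · obtain ⟨s, h2, h3, h4, h5⟩ := ih (t + 1) (by omega) hp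
        refine ⟨s, by omega, h3, fun q h6 h7 => ?_, h5⟩
        rcases h6.eq_or_lt with rfl | h6
        · exact ht
        · exact h4 q h6 h7
      · refine ⟨t, le_rfl, by omega, fun q h2 h3 => ?_, by omega⟩
        obtain rfl : q = t := by omega
        exact ht
  have down : ∀ t, 1 ≤ t → 0 < G t →
      ∃ r, 1 ≤ r ∧ r ≤ t ∧ (∀ q, r ≤ q → q ≤ t → 0 < G q) ∧ (r ≠ 1 → G (r - 1) ≤ 0) := by
    intro t h1
    induction t, h1 using Nat.le_induction with
    | base =>
      intro ht
      refine ⟨1, le_rfl, le_rfl, fun q h2 h3 => ?_, by omega⟩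
      obtain rfl : q = 1 := by omega
      exact ht
    | succ t h1 ih =>
      intro ht
      by_cases hp : 0 < G t
      · obtain ⟨r, h2, h3, h4, h5⟩ := ih hp
        refine ⟨r, h2, by omega, fun q h6 h7 => ?_, h5⟩
        rcases h7.eq_or_lt with rfl | h7
        · exact ht
        · exact h4 q h6 (by omega)
      · refine ⟨t + 1, by omega, le_rfl, fun q h2 h3 => ?_, fun _ => by simpa using hp⟩
        obtain rfl : q = t + 1 := by omega
        exact ht
  obtain ⟨s, s1, s2, s3, s4⟩ := up (n - t) t (by omega) ht
  obtain ⟨r, r1, r2, r3, r4⟩ := down t h1 ht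
  refine ⟨r, s, ⟨r1, by omega, s2, fun q h2 h3 => ?_, s4, r4⟩, r2, s1⟩
  rcases le_total q t with h | h
  · exact r3 q h2 h
  · exact s3 q h h3

theorem IsRowPattern.even_of_neg_start (h : IsRowPattern m G) (hf : ∀ r, ¬ IsFailure m G r)
    {p : ℕ} (h1 : 1 < p) (hp : p ≤ m) (hneg : G p < 0) (hprev : 0 ≤ G (p - 1)) : Even (m + p) := by
  by_contra hcon
  have := (h.neg_iff hf (r := p - 1) (by omega) (by omega)
    (by rw [Nat.even_iff] at *; omega)).mpr (by rwa [Nat.sub_add_cancel h1.le])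
  omega

theorem IsRowPattern.odd_of_neg_end (h : IsRowPattern m G) (hf : ∀ r, ¬ IsFailure m G r)
    {q : ℕ} (h1 : 1 ≤ q) (hq : q ≤ m) (hneg : G q < 0) (hnext : q < m → 0 ≤ G (q + 1)) :
    q < m ∧ Odd (m + q) := by
  have hqm : q < m := by
    rcases hq.eq_or_lt with rfl | hq
    · have := h.nonneg_last h1
      omega
    · exact hq
  refine ⟨hqm, ?_⟩
  by_contra hcon
  rw [Nat.not_odd_iff_even] at hcon
  have := (h.neg_iff hf h1 hqm hcon).mp hneg
  have := hnext hqm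
  omega

/-- With the other parity, row `r` would be paired with the zero row above it, although paired
nonnegative rows lie in one segment. At the top, `first_nonpos` applies. -/
theorem IsRowPattern.odd_of_pos_start (h : IsRowPattern m G) (hf : ∀ r, ¬ IsFailure m G r)
    {r : ℕ} (h1 : 1 ≤ r) (hr : r ≤ m) (hpos : 0 < G r) (hprev : r ≠ 1 → G (r - 1) = 0) :
    Odd (m + r) := by
  by_contra hcon
  rw [Nat.not_odd_iff_even] at hcon
  by_cases hr1 : r = 1
  · subst hr1
    have := h.first_nonpos hf (by rw [Nat.even_iff] at hcon; rw [Nat.odd_iff]; omega)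
    omega
  · have h0 := hprev hr1
    have := (h.eq_of_next hf (r := r - 1) (q := r) (by omega) (by omega) hr hcon (by omega)
      (by omega) fun x _ _ => by omega).1
    omega

theorem IsRowPattern.even_of_pos_end (h : IsRowPattern m G) (hf : ∀ r, ¬ IsFailure m G r)
    {s : ℕ} (h1 : 1 ≤ s) (hs : s ≤ m) (hpos : 0 < G s) (hnext : s < m → G (s + 1) = 0) :
    Even (m + s) := by
  rcases hs.eq_or_lt with rfl | hs
  · simp
  · by_contra hcon
    have h0 := hnext hs
    have := (h.eq_of_next hf (r := s) (q := s + 1) h1 (by omega) hs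
      (by rw [Nat.even_iff] at *; omega) (by omega) (by omega) fun x _ _ => by omega).1
    omega

/-- Negative rows lie in even blocks, except possibly at the top. -/
theorem IsRowPattern.neg_block_even (h : IsRowPattern m G) (hf : ∀ r, ¬ IsFailure m G r)
    (hmn : m ≤ n) (hz : ∀ r, m < r → r ≤ n → G r = 0) {t : ℕ} (h1 : 1 ≤ t) (ht : t ≤ n)
    (hneg : G t < 0) :
    (∃ r s, IsPosBlock n (-G) r s ∧ EvenRows r s ∧ r ≤ t ∧ t ≤ s) ∨
      ∀ q, 1 ≤ q → q < t → G q < 0 := by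
  obtain ⟨r, s, hb, hrt, hts⟩ := exists_isPosBlock (n := n) (G := -G) h1 ht (by simpa using hneg)
  obtain ⟨b1, b2, b3, b4, b5, b6⟩ := id hb
  simp only [Pi.neg_apply] at b4 b5 b6
  have hsm : s ≤ m := by
    by_contra hcon
    have := hz s (by omega) b3
    have := b4 s b2 le_rfl
    omega
  by_cases hr : r = 1
  · right
    intro q hq1 hq2
    have := b4 q (by omega) (by omega)
    omega
  · left
    refine ⟨r, s, hb, ?_, hrt, hts⟩
    have e1 := h.even_of_neg_start hf (p := r) (by omega) (by omega)
      (by have := b4 r le_rfl b2; omega) (by have := b6 hr; omega)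
    have e2 := (h.odd_of_neg_end hf (q := s) (by omega) (by omega)
      (by have := b4 s b2 le_rfl; omega) fun hs => by have := b5 (by omega); omega).2
    unfold EvenRows Nat.ModEq
    rw [Nat.even_iff] at e1
    rw [Nat.odd_iff] at e2
    omega

/-- The parity of each end depends only on whether it is an end of the surrounding block: an outer
end borders a zero row, an inner end a run of negative rows. The two cases have opposite parities at
either end. -/
theorem IsRowPattern.pos_block_odd_iff (h : IsRowPattern m G) (hf : ∀ r, ¬ IsFailure m G r)
    (hmn : m ≤ n) (hz : ∀ r, m < r → r ≤ n → G r = 0) {r s p q : ℕ}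
    (hB : IsNonzeroBlock n G r s) (hP : IsPosBlock n G p q) (hrp : r ≤ p) (hqs : q ≤ s)
    (hne : ¬ (p = r ∧ q = s)) : OddRows p q ↔ p = r ∨ q = s := by
  obtain ⟨b1, b2, b3, b4, b5, b6⟩ := hB
  obtain ⟨p1, p2, p3, p4, p5, p6⟩ := hP
  have hsm : s ≤ m := by
    by_contra hcon
    exact b4 s b2 le_rfl (hz s (by omega) b3)
  have hp : (p = r → Odd (m + p)) ∧ (p ≠ r → Even (m + p)) := by
    constructor
    · rintro rfl
      exact h.odd_of_pos_start hf p1 (by omega) (p4 p le_rfl p2) b6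
    · intro hpr
      have h2 := b4 (p - 1) (by omega) (by omega)
      have h3 := p6 (by omega)
      have := (h.odd_of_neg_end hf (q := p - 1) (by omega) (by omega) (by omega) fun _ => by
        rw [Nat.sub_add_cancel p1]; exact (p4 p le_rfl p2).le).2
      rw [Nat.odd_iff] at this
      rw [Nat.even_iff]
      omega
  have hq : (q = s → Even (m + q)) ∧ (q ≠ s → Odd (m + q)) := by
    constructor
    · rintro rfl
      exact h.even_of_pos_end hf (by omega) (by omega) (p4 q p2 le_rfl) fun _ => b5 (by omega)
    · intro hqs'
      have h2 := b4 (q + 1) (by omega) (by omega)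
      have h3 := p5 (by omega)
      have := h.even_of_neg_start hf (p := q + 1) (by omega) (by omega) (by omega) (by
        rw [Nat.add_sub_cancel]; exact (p4 q p2 le_rfl).le)
      rw [Nat.even_iff] at this
      rw [Nat.odd_iff]
      omega
  unfold OddRows Nat.ModEq
  rw [Nat.even_iff, Nat.odd_iff] at hp hq
  omega

/-- Otherwise the zero row `r - 1` and the positive row `q + 1` would be consecutive nonnegative
rows with the parity of a pair, hence in one segment. The row `r - 1` exists only for `r ≠ 1`. -/
theorem IsRowPattern.neg_block_top (h : IsRowPattern m G) (hf : ∀ r, ¬ IsFailure m G r)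
    (hz : ∀ r, m < r → r ≤ n → G r = 0) {r s q : ℕ}
    (hB : IsNonzeroBlock n G r s) (hr : r ≠ 1) (hN : IsPosBlock n (-G) r q) : q = s := by
  obtain ⟨b1, b2, b3, b4, b5, b6⟩ := hB
  obtain ⟨p1, p2, p3, p4, p5, p6⟩ := hN
  simp only [Pi.neg_apply] at p4 p5 p6
  have hsm : s ≤ m := by
    by_contra hcon
    exact b4 s b2 le_rfl (hz s (by omega) b3)
  rcases lt_trichotomy q s with hlt | heq | hlt
  · exfalso
    have h1 := p4 q p2 le_rfl
    have h2 := p5 (by omega)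
    have h3 := b4 (q + 1) (by omega) (by omega)
    have h4 := (h.odd_of_neg_end hf (q := q) (by omega) (by omega) (by omega) fun _ => by omega).2
    have h5 := b6 hr
    have := (h.eq_of_next hf (r := r - 1) (q := q + 1) (by omega) (by omega) (by omega)
      (by rw [Nat.odd_iff] at h4; rw [Nat.even_iff]; omega) (by omega) (by omega)
      fun x hx1 hx2 => by have := p4 x (by omega) (by omega); omega).1
    omega
  · exact heq
  · have := p4 (s + 1) (by omega) (by omega)
    have := b5 (by omega)
    omega

theorem IsRowPattern.neg_block_bot (h : IsRowPattern m G) (hf : ∀ r, ¬ IsFailure m G r)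
    (hmn : m ≤ n) (hz : ∀ r, m < r → r ≤ n → G r = 0) {r s p : ℕ}
    (hB : IsNonzeroBlock n G r s) (hN : IsPosBlock n (-G) p s) : p = r := by
  obtain ⟨b1, b2, b3, b4, b5, b6⟩ := hB
  obtain ⟨p1, p2, p3, p4, p5, p6⟩ := hN
  simp only [Pi.neg_apply] at p4 p5 p6
  have hsm : s ≤ m := by
    by_contra hcon
    exact b4 s b2 le_rfl (hz s (by omega) b3)
  rcases lt_trichotomy p r with hlt | heq | hlt
  · have := p4 (r - 1) (by omega) (by omega)
    have := b6 (by omega)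
    omega
  · exact heq
  · exfalso
    have h1 := p4 s p2 le_rfl
    have h2 := p6 (by omega)
    have h3 := b4 (p - 1) (by omega) (by omega)
    obtain ⟨h4, h5⟩ := h.odd_of_neg_end hf (q := s) (by omega) hsm (by omega) fun _ => by
      have := b5 (by omega)
      omega
    have h6 := b5 (by omega)
    have := (h.eq_of_next hf (r := p - 1) (q := s + 1) (by omega) (by omega) (by omega)
      (by rw [Nat.odd_iff] at h5; rw [Nat.even_iff]; omega) (by omega) (by omega)
      fun x hx1 hx2 => by have := p4 x (by omega) (by omega); omega).1
    omega

/-- The rows between paired positive rows are negative. -/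
theorem IsRowPattern.neg_of_between (h : IsRowPattern m G) (hf : ∀ r, ¬ IsFailure m G r)
    {x y : ℕ} (h1 : 1 ≤ x) (hy : y ≤ m) (hpar : Even (m + y)) (hpos : 0 < G y)
    (hne : ∀ q, x < q → q < y → G q ≠ G y) {q : ℕ} (hxq : x < q) (hqy : q < y) :
    G q < 0 := by
  by_contra hcon
  -- The last nonnegative row before `y` is paired with `y`, so it lies in the segment of `y`, which
  -- `hne` forbids.
  have hP := Nat.findGreatest_spec (P := fun t => t < y ∧ 0 ≤ G t) (n := y) (m := q) hqy.le
    ⟨hqy, by omega⟩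
  have hle := Nat.le_findGreatest (P := fun t => t < y ∧ 0 ≤ G t) (n := y) hqy.le
    ⟨hqy, by omega⟩
  have hlast : ∀ t, Nat.findGreatest (fun t => t < y ∧ 0 ≤ G t) y < t → t < y → G t < 0 := by
    intro t h2 h3
    have := Nat.findGreatest_is_greatest h2 h3.le
    omega
  generalize Nat.findGreatest (fun t => t < y ∧ 0 ≤ G t) y = t at *
  exact hne t (by omega) hP.1
    (h.eq_of_next hf (r := t) (by omega) hP.1 hy hpar hP.2 hpos.le hlast).1

/-- If `x > 1`, absence of failure at `x - 1` makes that row repeat the segment of row `x`. -/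
theorem eq_one_of_mixed (hf : ∀ r, ¬ IsFailure m G r)
    {x : ℕ} (h1 : 1 ≤ x) (hx : x ≤ m) (hpar : Odd (m + x)) (hneg : G x < 0)
    (hne : ∀ q, 1 ≤ q → q < x → G q ≠ G x) : x = 1 ∧ Even m := by
  have hx1 : x = 1 := by
    by_contra hcon
    have hs : x - 1 + 1 = x := by omega
    have := eq_of_not_isFailure hf (r := x - 1) (by omega) (by omega)
      (by rw [Nat.odd_iff] at hpar; rw [Nat.even_iff]; omega) (by rwa [hs])
    rw [hs] at this
    exact hne (x - 1) (by omega) (by omega) this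
  refine ⟨hx1, ?_⟩
  rw [Nat.odd_iff] at hpar
  rw [Nat.even_iff]
  omega

/-- The first nonnegative row lies in segment `-G 1`, that of `y`; since `y` is the first row of
that segment, the two coincide. -/
theorem IsRowPattern.neg_of_mixed (h : IsRowPattern m G) (hf : ∀ r, ¬ IsFailure m G r)
    {y : ℕ} (h1 : 1 ≤ y) (hy : y ≤ m) (hm : Even m) (hneg : G 1 < 0) (hGy : G y = -G 1)
    (hne : ∀ q, 1 ≤ q → q < y → G q ≠ G y) {q : ℕ} (hq1 : 1 ≤ q) (hqy : q < y) : G q < 0 := by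
  have hex : ∃ t, 1 ≤ t ∧ 0 ≤ G t := ⟨y, h1, by omega⟩
  classical
  have hS := Nat.find_spec hex
  have hmin : ∀ t, 1 ≤ t → t < Nat.find hex → G t < 0 := by
    intro t h2 h3
    have := Nat.find_min hex h3
    omega
  have hle : Nat.find hex ≤ y := Nat.find_min' hex ⟨h1, by omega⟩
  generalize Nat.find hex = t at *
  have ht1 : t ≠ 1 := by
    rintro rfl
    omega
  have := h.eq_neg_of_first hf hm (q := t) (by omega) (by omega) hS.2 hmin
  have hty : t = y := by
    by_contra hcon
    exact hne t hS.1 (by omega) (by omega)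
  exact hmin q hq1 (by omega)

/-- At the last failure, the negative rows strictly between `r` and `r₀` form a whole block. It is
odd because `r` and `r₀` have equal parity, and the exception for the top does not apply because row
`r` is nonnegative. -/
theorem IsRowPattern.not_isFailure_of_even_blocks (h : IsRowPattern m G) (hmn : m ≤ n)
    (h3 : ∀ t, 1 ≤ t → t ≤ n → G t < 0 →
      (∃ r s, IsPosBlock n (-G) r s ∧ EvenRows r s ∧ r ≤ t ∧ t ≤ s) ∨
        ∀ q, 1 ≤ q → q < t → G q < 0) (r : ℕ) : ¬ IsFailure m G r := by
  intro hfail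
  obtain ⟨r, r₀, hr⟩ := h.exists_isLastFailure ⟨r, hfail⟩
  obtain ⟨⟨f1, f2, f3, f4, f5⟩, -, hlt, hle, hn, hn', hev, hneg⟩ := hr
  rcases h3 (r + 1) (by omega) (by omega) f4 with ⟨p, q, ⟨p1, p2, p3, p4, p5, p6⟩, hE, hp, hq⟩ | h4
  · simp only [Pi.neg_apply] at p4 p5 p6
    have e1 : p = r + 1 := by
      by_contra hcon
      have := p4 r (by omega) (by omega)
      omega
    have e2 : q + 1 = r₀ := by
      rcases lt_trichotomy (q + 1) r₀ with hlt | heq | hlt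
      · have := p5 (by omega)
        have := hneg (q + 1) (by omega) hlt
        omega
      · exact heq
      · have := p4 r₀ (by omega) (by omega)
        omega
    unfold EvenRows Nat.ModEq at hE
    rw [Nat.even_iff] at hev
    omega
  · have := h4 r f1 (by omega)
    omega

end Blocks

/-! ### Alternation of the rows left of `k` -/

section LeftRows

variable {n : ℕ} {G : ℕ → ℤ}

/-- The number of zeros of `G` among the rows `1, …, r`. -/
def zeroCount (G : ℕ → ℤ) (r : ℕ) : ℕ := ((Finset.Icc 1 r).filter fun q => G q = 0).card

/-- The zeros of `G` alternate in parity, beginning with an odd one. -/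
def ZerosAlternate (n : ℕ) (G : ℕ → ℤ) : Prop :=
  ∀ r, 1 ≤ r → r ≤ n → G r = 0 → Even (zeroCount G r + r)

theorem zeroCount_zero : zeroCount G 0 = 0 := by simp [zeroCount]

theorem zeroCount_succ (r : ℕ) :
    zeroCount G (r + 1) = zeroCount G r + if G (r + 1) = 0 then 1 else 0 := by
  have e : Finset.Icc 1 (r + 1) = insert (r + 1) (Finset.Icc 1 r) := by
    ext x
    simp only [Finset.mem_Icc, Finset.mem_insert]
    omega
  unfold zeroCount
  rw [e, Finset.filter_insert]
  split_ifs
  · rw [Finset.card_insert_of_notMem (by simp)]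
  · rfl

theorem zeroCount_eq_of_ne_zero {a b : ℕ} (hab : a ≤ b) (h : ∀ q, a < q → q ≤ b → G q ≠ 0) :
    zeroCount G b = zeroCount G a := by
  induction b, hab using Nat.le_induction with
  | base => rfl
  | succ b hab ih =>
    rw [zeroCount_succ, if_neg (h _ (by omega) le_rfl), ih fun q h1 h2 => h q h1 (by omega),
      add_zero]

theorem rowCount_add_zeroCount {m r : ℕ} (hr : r ≤ m) :
    rowCount G m 0 r + zeroCount G r = zeroCount G m := by
  induction hr using Nat.decreasingInduction with
  | self => simp [rowCount_self]
  | of_succ r hr ih =>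
    rw [rowCount_succ hr, ← ih, zeroCount_succ]
    omega

theorem zeroCount_congr {G' : ℕ → ℤ} {r : ℕ} (h : ∀ q, 1 ≤ q → q ≤ r → (G q = 0 ↔ G' q = 0)) :
    zeroCount G r = zeroCount G' r := by
  unfold zeroCount
  congr 1
  refine Finset.filter_congr fun q hq => ?_
  rw [Finset.mem_Icc] at hq
  exact h q hq.1 hq.2

/-- `r` is the first zero violating alternation, and `r₀` the previous zero (or row `0`). -/
structure IsFirstRepeat (n : ℕ) (G : ℕ → ℤ) (r r₀ : ℕ) : Prop where
  lt : r₀ < r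
  le : r ≤ n
  zero : G r = 0
  zero' : r₀ ≠ 0 → G r₀ = 0
  even : Even (r + r₀)
  odd : Odd (zeroCount G r + r)
  first : ∀ q, 1 ≤ q → q < r → G q = 0 → Even (zeroCount G q + q)
  between : ∀ q, r₀ < q → q < r → G q ≠ 0

theorem exists_isFirstRepeat (h : ¬ ZerosAlternate n G) : ∃ r r₀, IsFirstRepeat n G r r₀ := by
  classical
  unfold ZerosAlternate at h
  push Not at h
  have hex : ∃ r, 1 ≤ r ∧ r ≤ n ∧ G r = 0 ∧ ¬ Even (zeroCount G r + r) := by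
    obtain ⟨r, h1, h2, h3, h4⟩ := h
    exact ⟨r, h1, h2, h3, by simpa using h4⟩
  obtain ⟨r1, r2, r3, r4⟩ := Nat.find_spec hex
  have hmin : ∀ q, 1 ≤ q → q < Nat.find hex → G q = 0 → Even (zeroCount G q + q) := by
    intro q h1 h2 h3
    by_contra h4
    exact Nat.find_min hex h2 ⟨h1, by omega, h3, h4⟩
  generalize Nat.find hex = r at *
  have hP := Nat.findGreatest_spec (P := fun t => t < r ∧ (t ≠ 0 → G t = 0)) (n := r) (m := 0)
    (by omega) ⟨by omega, by simp⟩
  have hlast : ∀ t, Nat.findGreatest (fun t => t < r ∧ (t ≠ 0 → G t = 0)) r < t → t < r →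
      G t ≠ 0 := by
    intro t h2 h3 h4
    exact Nat.findGreatest_is_greatest h2 h3.le ⟨h3, fun _ => h4⟩
  generalize Nat.findGreatest (fun t => t < r ∧ (t ≠ 0 → G t = 0)) r = r₀ at *
  have hc : zeroCount G r = zeroCount G r₀ + 1 := by
    obtain ⟨p, rfl⟩ : ∃ p, r = p + 1 := ⟨r - 1, by omega⟩
    rw [zeroCount_succ, if_pos r3, zeroCount_eq_of_ne_zero (show r₀ ≤ p by omega)]
    intro q h1 h2
    exact hlast q h1 (by omega)
  have h0 : Even (zeroCount G r₀ + r₀) := by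
    by_cases hr₀ : r₀ = 0
    · simp [hr₀, zeroCount_zero]
    · exact hmin r₀ (by omega) hP.1 (hP.2 hr₀)
  refine ⟨r, r₀, hP.1, r2, r3, hP.2, ?_, by simpa using r4, hmin, hlast⟩
  rw [Nat.even_iff] at *
  omega

theorem IsFirstRepeat.unique {r r₀ s s₀ : ℕ} (h : IsFirstRepeat n G r r₀)
    (h' : IsFirstRepeat n G s s₀) : r = s ∧ r₀ = s₀ := by
  have := h.lt
  have := h'.lt
  have e : r = s := by
    rcases lt_trichotomy r s with hlt | heq | hlt
    · exact absurd (h'.first r (by omega) hlt h.zero) (Nat.not_even_iff_odd.mpr h.odd)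
    · exact heq
    · exact absurd (h.first s (by omega) hlt h'.zero) (Nat.not_even_iff_odd.mpr h'.odd)
  subst e
  refine ⟨rfl, ?_⟩
  rcases lt_trichotomy r₀ s₀ with hlt | heq | hlt
  · exact absurd (h'.zero' (by omega)) (h.between s₀ hlt (by omega))
  · exact heq
  · exact absurd (h.zero' (by omega)) (h'.between r₀ hlt (by omega))

theorem IsFirstRepeat.congr {G' : ℕ → ℤ} {r r₀ : ℕ} (h : IsFirstRepeat n G r r₀)
    (hG : ∀ q, 1 ≤ q → q ≤ n → (G q = 0 ↔ G' q = 0)) : IsFirstRepeat n G' r r₀ := by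
  have hc : ∀ q, q ≤ n → zeroCount G q = zeroCount G' q := fun q hq =>
    zeroCount_congr fun x h1 h2 => hG x h1 (by omega)
  have h1 := h.lt
  have h2 := h.le
  refine ⟨h1, h2, (hG r (by omega) h2).mp h.zero, fun h0 => (hG r₀ (by omega) (by omega)).mp
    (h.zero' h0), h.even, hc r h2 ▸ h.odd, fun q q1 q2 q3 => ?_, fun q q1 q2 => ?_⟩
  · rw [← hc q (by omega)]
    exact h.first q q1 q2 ((hG q q1 (by omega)).mpr q3)
  · rw [ne_eq, ← hG q (by omega) (by omega)]
    exact h.between q q1 q2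

theorem IsFirstRepeat.not_zerosAlternate {r r₀ : ℕ} (h : IsFirstRepeat n G r r₀) :
    ¬ ZerosAlternate n G := fun hA =>
  Nat.not_even_iff_odd.mpr h.odd (hA r (by have := h.lt; omega) h.le h.zero)

/-- Blocks are the gaps between successive zeros, and zeros alternate exactly when these gaps are
even. Row `0` serves as a zero before the first gap; `hn` takes care of the gap after the last zero.
-/
theorem zerosAlternate_iff (hn : Even (zeroCount G n + n)) :
    ZerosAlternate n G ↔ ∀ r s, IsNonzeroBlock n G r s → ¬ OddRows r s := by
  constructor
  · rintro hA r s ⟨b1, b2, b3, b4, b5, b6⟩ hodd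
    unfold OddRows Nat.ModEq at hodd
    have hc : zeroCount G s = zeroCount G (r - 1) :=
      zeroCount_eq_of_ne_zero (by omega) fun q h1 h2 => b4 q (by omega) h2
    have h1 : Even (zeroCount G (r - 1) + (r - 1)) := by
      by_cases hr : r = 1
      · simp [hr, zeroCount_zero]
      · exact hA _ (by omega) (by omega) (b6 hr)
    by_cases hs : s = n
    · subst hs
      rw [Nat.even_iff] at *
      omega
    · have h2 := hA (s + 1) (by omega) (by omega) (b5 hs)
      rw [zeroCount_succ, if_pos (b5 hs)] at h2
      rw [Nat.even_iff] at *
      omega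
  · intro hB
    by_contra hA
    obtain ⟨r, r₀, h⟩ := exists_isFirstRepeat hA
    have h1 := h.lt
    have h2 := h.le
    have h3 := h.even
    rw [Nat.even_iff] at h3
    have h4 : r - 1 + 1 = r := by omega
    refine hB (r₀ + 1) (r - 1) ⟨by omega, by omega, by omega, fun t t1 t2 => h.between t (by omega)
      (by omega), fun _ => by rw [h4]; exact h.zero, fun h0 => ?_⟩ ?_
    · rw [Nat.add_sub_cancel]
      exact h.zero' (by omega)
    · unfold OddRows Nat.ModEq
      omega

/-- There is no zero strictly between `r` and `r₀`, so the exchange moves a zero, if at all, to a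
row of equal parity without changing its rank among the zeros. -/
theorem IsLastFailure.zerosAlternate {m r r₀ : ℕ} {G' : ℕ → ℤ} (h : IsLastFailure m G r r₀)
    (hr : G' r = G r₀) (hr₀ : G' r₀ = G r)
    (hG : ∀ q, 1 ≤ q → q ≤ n → q ≠ r → q ≠ r₀ → G' q = G q) (hmn : m ≤ n)
    (hA : ZerosAlternate n G) : ZerosAlternate n G' := by
  have f1 := h.failure.1
  have hlt := h.lt
  have hle := h.le
  have hev := h.even
  have low : ∀ q, q < r → zeroCount G' q = zeroCount G q := fun q hq =>
    zeroCount_congr fun x h1 h2 => by rw [hG x h1 (by omega) (by omega) (by omega)]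
  have hneg : ∀ q, r < q → q < r₀ → G q ≠ 0 ∧ G' q ≠ 0 := by
    intro q h1 h2
    have := h.neg q h1 h2
    rw [hG q (by omega) (by omega) (by omega) (by omega)]
    omega
  have c1 : zeroCount G' r = zeroCount G (r - 1) + if G r₀ = 0 then 1 else 0 := by
    obtain ⟨p, rfl⟩ : ∃ p, r = p + 1 := ⟨r - 1, by omega⟩
    rw [zeroCount_succ, hr, low p (by omega), Nat.add_sub_cancel]
  have c1' : zeroCount G r = zeroCount G (r - 1) + if G r = 0 then 1 else 0 := by
    obtain ⟨p, rfl⟩ : ∃ p, r = p + 1 := ⟨r - 1, by omega⟩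
    rw [zeroCount_succ, Nat.add_sub_cancel]
  have c2 : zeroCount G' r₀ = zeroCount G' r + if G r = 0 then 1 else 0 := by
    obtain ⟨p, rfl⟩ : ∃ p, r₀ = p + 1 := ⟨r₀ - 1, by omega⟩
    rw [zeroCount_succ, hr₀, zeroCount_eq_of_ne_zero (show r ≤ p by omega)]
    exact fun q h1 h2 => (hneg q h1 (by omega)).2
  have c2' : zeroCount G r₀ = zeroCount G r + if G r₀ = 0 then 1 else 0 := by
    obtain ⟨p, rfl⟩ : ∃ p, r₀ = p + 1 := ⟨r₀ - 1, by omega⟩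
    rw [zeroCount_succ, zeroCount_eq_of_ne_zero (show r ≤ p by omega)]
    exact fun q h1 h2 => (hneg q h1 (by omega)).1
  have high : ∀ q, r₀ ≤ q → q ≤ n → zeroCount G' q = zeroCount G q := by
    intro q hq
    induction q, hq using Nat.le_induction with
    | base => intro _; omega
    | succ q hq ih =>
      intro hqn
      rw [zeroCount_succ, zeroCount_succ, ih (by omega), hG (q + 1) (by omega) hqn (by omega)
        (by omega)]
  have hA1 := hA r (by omega) (by omega)
  have hA2 := hA r₀ (by omega) (by omega)
  intro q q1 q2 q3
  rcases lt_trichotomy q r with hq | rfl | hq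
  · rw [low q hq]
    exact hA q q1 q2 (by rwa [hG q q1 q2 (by omega) (by omega)] at q3)
  · rw [hr] at q3
    have := hA2 q3
    rw [if_pos q3] at *
    rw [Nat.even_iff] at *
    split_ifs at * with e
    · have := hA1 e
      omega
    · omega
  · rcases lt_trichotomy q r₀ with hq' | rfl | hq'
    · exact absurd q3 (hneg q hq hq').2
    · rw [hr₀] at q3
      have := hA1 q3
      rw [if_pos q3] at *
      rw [Nat.even_iff] at *
      split_ifs at * with e
      · have := hA2 e
        omega
      · omega
    · rw [high q hq'.le q2]
      exact hA q q1 q2 (by rwa [hG q q1 q2 (by omega) (by omega)] at q3)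

end LeftRows

/-! ### The row pattern of an element of `C_n` -/

section Bridge

variable {n k : ℕ} {I : Finset ℕ}

/-- The hypotheses of the theorem on the column `k`. -/
structure IsAdmissible (n : ℕ) (I : Finset ℕ) (k : ℕ) : Prop where
  mem : k ∈ insert n I
  le : k ≤ n
  even : Even (n + k)
  notMem : ∀ a, k ≤ a → Even (a + k) → a + 1 ∉ I

/-- The signed segment containing the nonzero entry of row `r`. -/
noncomputable def rowSegment (I : Finset ℕ) (k : ℕ) (w : Equiv.Perm ℤ) (r : ℕ) : ℤ :=
  segmentOf I k w r

theorem isLetter_of_row {r : ℕ} (h1 : 1 ≤ r) (hr : r ≤ n) : IsLetter n (r : ℤ) :=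
  ⟨by omega, by rw [abs_of_nonneg] <;> omega⟩

theorem isLetter_inv (w : hyperoctahedral n) {r : ℕ} (h1 : 1 ≤ r) (hr : r ≤ n) :
    IsLetter n (w.1⁻¹ r) := (isLetter_of_row h1 hr).map w⁻¹

theorem lt_colOf_iff (h : IsAdmissible n I k) (w : hyperoctahedral n) {r : ℕ} (h1 : 1 ≤ r)
    (hr : r ≤ n) : k < colOf w.1 r ↔ rowSegment I k w.1 r ≠ 0 := by
  rw [rowSegment, segmentOf, ne_eq, seg_eq_zero_iff h.mem (isLetter_inv w h1 hr).2, colOf,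
    abs_le]
  omega

theorem entry_colOf (w : hyperoctahedral n) {r : ℕ} (h1 : 1 ≤ r) (hr : r ≤ n) :
    entry w.1 r (colOf w.1 r) = if 0 < w.1⁻¹ r then 1 else -1 := by
  have h0 := (isLetter_inv w h1 hr).1
  unfold entry colOf
  have e := perm_apply_inv_apply w.1 r
  by_cases hp : 0 < w.1⁻¹ r
  · rw [show ((w.1⁻¹ r).natAbs : ℤ) = w.1⁻¹ r by omega, e, if_pos rfl, if_pos hp]
  · rw [show ((w.1⁻¹ r).natAbs : ℤ) = -w.1⁻¹ r by omega, hyperoctahedral_map_neg, e,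
      if_neg (by omega), if_pos rfl, if_neg hp]

theorem rowSegment_pos_iff (h : IsAdmissible n I k) (w : hyperoctahedral n) {r : ℕ} (h1 : 1 ≤ r)
    (hr : r ≤ n) : 0 < rowSegment I k w.1 r ↔ k < colOf w.1 r ∧ entry w.1 r (colOf w.1 r) = 1 := by
  rw [rowSegment, segmentOf, seg_pos_iff h.mem (isLetter_inv w h1 hr).2, entry_colOf w h1 hr,
    colOf]
  generalize w.1⁻¹ (r : ℤ) = x
  split_ifs <;> simp <;> omega

theorem rowSegment_neg_iff (h : IsAdmissible n I k) (w : hyperoctahedral n) {r : ℕ} (h1 : 1 ≤ r)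
    (hr : r ≤ n) : rowSegment I k w.1 r < 0 ↔ k < colOf w.1 r ∧ entry w.1 r (colOf w.1 r) = -1 := by
  rw [rowSegment, segmentOf, seg_neg_iff h.mem (isLetter_inv w h1 hr).2, entry_colOf w h1 hr,
    colOf]
  generalize w.1⁻¹ (r : ℤ) = x
  split_ifs <;> simp <;> omega

theorem rowSegment_nonpos_iff (h : IsAdmissible n I k) (w : hyperoctahedral n) {r : ℕ}
    (h1 : 1 ≤ r) (hr : r ≤ n) :
    rowSegment I k w.1 r ≤ 0 ↔ colOf w.1 r ≤ k ∨ entry w.1 r (colOf w.1 r) = -1 := by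
  rw [← not_lt, rowSegment_pos_iff h w h1 hr, entry_colOf w h1 hr]
  split_ifs <;> simp

theorem rowSegment_nonneg_iff (h : IsAdmissible n I k) (w : hyperoctahedral n) {r : ℕ}
    (h1 : 1 ≤ r) (hr : r ≤ n) :
    0 ≤ rowSegment I k w.1 r ↔ colOf w.1 r ≤ k ∨ entry w.1 r (colOf w.1 r) = 1 := by
  rw [← not_lt, rowSegment_neg_iff h w h1 hr, entry_colOf w h1 hr]
  split_ifs <;> simp

theorem isBlock_iff (h : IsAdmissible n I k) (w : hyperoctahedral n) {r s : ℕ} :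
    IsBlock n w.1 k r s ↔ IsNonzeroBlock n (rowSegment I k w.1) r s := by
  unfold IsBlock IsNonzeroBlock
  refine and_congr_right fun h1 => and_congr_right fun h2 => and_congr_right fun h3 =>
    and_congr ?_ (and_congr ?_ ?_)
  · exact forall_congr' fun t => forall_congr' fun t1 => forall_congr' fun t2 =>
      lt_colOf_iff h w (by omega) (by omega)
  · refine forall_congr' fun hs => ?_
    rw [← not_lt, lt_colOf_iff h w (by omega) (by omega), not_not]
  · refine forall_congr' fun hs => ?_
    rw [← not_lt, lt_colOf_iff h w (by omega) (by omega), not_not]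

theorem isSignBlock_one_iff (h : IsAdmissible n I k) (w : hyperoctahedral n) {r s : ℕ} :
    IsSignBlock 1 n w.1 k r s ↔ IsPosBlock n (rowSegment I k w.1) r s := by
  unfold IsSignBlock IsPosBlock
  refine and_congr_right fun h1 => and_congr_right fun h2 => and_congr_right fun h3 =>
    and_congr ?_ (and_congr ?_ ?_)
  · exact forall_congr' fun t => forall_congr' fun t1 => forall_congr' fun t2 =>
      (rowSegment_pos_iff h w (by omega) (by omega)).symm
  · exact forall_congr' fun hs => (rowSegment_nonpos_iff h w (by omega) (by omega)).symm
  · exact forall_congr' fun hs => (rowSegment_nonpos_iff h w (by omega) (by omega)).symm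

theorem isSignBlock_neg_one_iff (h : IsAdmissible n I k) (w : hyperoctahedral n) {r s : ℕ} :
    IsSignBlock (-1) n w.1 k r s ↔ IsPosBlock n (-rowSegment I k w.1) r s := by
  unfold IsSignBlock IsPosBlock
  simp only [neg_neg, Pi.neg_apply, Int.neg_pos, Int.neg_nonpos_iff]
  refine and_congr_right fun h1 => and_congr_right fun h2 => and_congr_right fun h3 =>
    and_congr ?_ (and_congr ?_ ?_)
  · exact forall_congr' fun t => forall_congr' fun t1 => forall_congr' fun t2 =>
      (rowSegment_neg_iff h w (by omega) (by omega)).symm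
  · exact forall_congr' fun hs => (rowSegment_nonneg_iff h w (by omega) (by omega)).symm
  · exact forall_congr' fun hs => (rowSegment_nonneg_iff h w (by omega) (by omega)).symm

/-- `colOf` and `rowOf` match the zero rows with the columns `1, …, k`. -/
theorem zeroCount_rowSegment (h : IsAdmissible n I k) (w : hyperoctahedral n) :
    zeroCount (rowSegment I k w.1) n = k := by
  rw [zeroCount]
  refine Eq.trans ?_ (show (Finset.Icc 1 k).card = k by simp)
  have row : ∀ c : ℕ, 1 ≤ c → c ≤ n → 1 ≤ rowOf w.1 c ∧ rowOf w.1 c ≤ n := fun c h1 h2 => by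
    obtain ⟨h3, h4⟩ := (isLetter_of_row h1 h2).map w
    unfold rowOf
    rw [abs_le] at h4
    omega
  have col : ∀ r : ℕ, 1 ≤ r → r ≤ n → 1 ≤ colOf w.1 r ∧ colOf w.1 r ≤ n := fun r h1 h2 => by
    obtain ⟨h3, h4⟩ := isLetter_inv w h1 h2
    unfold colOf
    rw [abs_le] at h4
    omega
  have rc : ∀ r : ℕ, rowOf w.1 (colOf w.1 r) = r := fun r => by
    unfold rowOf colOf
    have e := perm_apply_inv_apply w.1 r
    have e' := hyperoctahedral_map_neg w (w.1⁻¹ r)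
    rcases Int.natAbs_eq (w.1⁻¹ (r : ℤ)) with hp | hp
    · rw [← hp, e]; simp
    · rw [show ((w.1⁻¹ r).natAbs : ℤ) = -w.1⁻¹ r by omega, e', e]; simp
  have cr : ∀ c : ℕ, colOf w.1 (rowOf w.1 c) = c := fun c => by
    unfold rowOf colOf
    have e := perm_inv_apply_apply w.1 c
    have e' := hyperoctahedral_inv_neg w (w.1 c)
    rcases Int.natAbs_eq (w.1 (c : ℤ)) with hp | hp
    · rw [← hp, e]; simp
    · rw [show ((w.1 c).natAbs : ℤ) = -w.1 c by omega, e', e]; simp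
  have hkn := h.le
  refine Finset.card_nbij' (colOf w.1) (rowOf w.1) ?_ ?_ ?_ ?_
  · intro r hr
    simp only [Finset.coe_filter, Finset.mem_Icc, Set.mem_ofPred_eq] at hr
    obtain ⟨⟨h1, h2⟩, h3⟩ := hr
    have h4 := (lt_colOf_iff h w h1 h2).not
    rw [not_not] at h4
    have := col r h1 h2
    simp only [Finset.coe_Icc, Set.mem_Icc]
    exact ⟨this.1, not_lt.mp (h4.mpr h3)⟩
  · intro c hc
    simp only [Finset.coe_Icc, Set.mem_Icc] at hc
    simp only [Finset.coe_filter, Finset.mem_Icc, Set.mem_ofPred_eq]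
    obtain ⟨h1, h2⟩ := row c hc.1 (by omega)
    refine ⟨⟨h1, h2⟩, ?_⟩
    have h4 := (lt_colOf_iff h w h1 h2).not
    rw [not_not] at h4
    rw [← h4, cr]
    omega
  · exact fun r _ => rc r
  · exact fun c _ => cr c

/-- The positions in `{a + 1, …, b}` belonging to segment `j`. -/
noncomputable def segmentPositions (I : Finset ℕ) (k : ℕ) (j : ℤ) (a b : ℕ) : Finset ℕ :=
  (Finset.Ioc a b).filter fun p : ℕ => seg I k p = j

/-- No element of `I` separates columns `a + 1` and `a + 2`, so right of `k` the segments are unions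
of such column pairs. -/
theorem seg_pair (h : IsAdmissible n I k) {a : ℕ} (ha : k ≤ a) (hpar : Even (a + k)) :
    seg I k ((a + 2 : ℕ) : ℤ) = seg I k ((a + 1 : ℕ) : ℤ) := by
  have := seg_succ (h.notMem a ha hpar) k
  rw [← this]
  push_cast
  ring_nf

theorem even_card_segmentPositions (h : IsAdmissible n I k) (j : ℤ) {a : ℕ} (ha : k ≤ a)
    (hpar : Even (a + k)) (d : ℕ) : Even (segmentPositions I k j a (a + 2 * d)).card := by
  induction d with
  | zero => simp [segmentPositions]
  | succ d ih =>
    have e : Finset.Ioc a (a + 2 * (d + 1)) =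
        insert (a + 2 * d + 2) (insert (a + 2 * d + 1) (Finset.Ioc a (a + 2 * d))) := by
      ext x
      simp only [Finset.mem_Ioc, Finset.mem_insert]
      omega
    unfold segmentPositions at *
    rw [e, Finset.filter_insert, Finset.filter_insert, seg_pair h (a := a + 2 * d) (by omega)
      (by rw [Nat.even_iff] at *; omega)]
    split_ifs
    · rw [Finset.card_insert_of_notMem (by simp), Finset.card_insert_of_notMem (by simp)]
      rw [Nat.even_iff] at *
      omega
    · exact ih

theorem card_segmentPositions_even (h : IsAdmissible n I k) (j : ℤ) {a b : ℕ} (ha : k ≤ a)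
    (hab : a ≤ b) (hpa : Even (a + k)) (hpb : Even (b + k)) :
    Even (segmentPositions I k j a b).card := by
  have := even_card_segmentPositions h j ha hpa ((b - a) / 2)
  rwa [show a + 2 * ((b - a) / 2) = b by rw [Nat.even_iff] at *; omega] at this

/-! ### Parity of row counts, computed through columns -/

theorem rowCount_eq_of_pos (h : IsAdmissible n I k) (w : hyperoctahedral n) {j : ℤ} (hj : 0 < j)
    (r : ℕ) : rowCount (rowSegment I k w.1) n j r =
      ((segmentPositions I k j k n).filter fun p : ℕ => (r : ℤ) < w.1 p).card := by
  unfold rowCount segmentPositions rowSegment segmentOf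
  refine Finset.card_nbij' (fun q => (w.1⁻¹ (q : ℤ)).toNat) (fun p => (w.1 (p : ℤ)).toNat)
    ?_ ?_ ?_ ?_
  · intro q hq
    simp only [Finset.coe_filter, Finset.mem_Ioc, Set.mem_ofPred_eq, Finset.mem_filter] at hq ⊢
    obtain ⟨⟨h1, h2⟩, h3⟩ := hq
    have hl := isLetter_inv w (by omega) h2
    have hp : (k : ℤ) < w.1⁻¹ q := (seg_pos_iff h.mem hl.2).mp (by omega)
    have := abs_le.mp hl.2
    rw [Int.toNat_of_nonneg (by omega), perm_apply_inv_apply]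
    exact ⟨⟨by omega, h3⟩, by omega⟩
  · intro p hp
    simp only [Finset.coe_filter, Finset.mem_Ioc, Set.mem_ofPred_eq, Finset.mem_filter] at hp ⊢
    obtain ⟨⟨⟨h1, h2⟩, h3⟩, h4⟩ := hp
    have := abs_le.mp ((isLetter_of_row (n := n) (r := p) (by omega) h2).map w).2
    rw [Int.toNat_of_nonneg (by omega), perm_inv_apply_apply]
    exact ⟨by omega, h3⟩
  · intro q hq
    simp only [Finset.coe_filter, Finset.mem_Ioc, Set.mem_ofPred_eq] at hq
    obtain ⟨⟨h1, h2⟩, h3⟩ := hq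
    have hl := isLetter_inv w (by omega) h2
    have hp : (k : ℤ) < w.1⁻¹ q := (seg_pos_iff h.mem hl.2).mp (by omega)
    simp only
    rw [Int.toNat_of_nonneg (by omega), perm_apply_inv_apply]
    omega
  · intro p hp
    simp only [Finset.coe_filter, Finset.mem_Ioc, Set.mem_ofPred_eq, Finset.mem_filter] at hp
    simp only
    rw [Int.toNat_of_nonneg (by omega), perm_inv_apply_apply]
    omega

theorem rowCount_eq_of_neg (h : IsAdmissible n I k) (w : hyperoctahedral n) {j : ℤ} (hj : 0 < j)
    (r : ℕ) : rowCount (rowSegment I k w.1) n (-j) r =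
      ((segmentPositions I k j k n).filter fun p : ℕ => w.1 p < -(r : ℤ)).card := by
  unfold rowCount segmentPositions rowSegment segmentOf
  refine Finset.card_nbij' (fun q => (-w.1⁻¹ (q : ℤ)).toNat) (fun p => (-w.1 (p : ℤ)).toNat)
    ?_ ?_ ?_ ?_
  · intro q hq
    simp only [Finset.coe_filter, Finset.mem_Ioc, Set.mem_ofPred_eq, Finset.mem_filter] at hq ⊢
    obtain ⟨⟨h1, h2⟩, h3⟩ := hq
    have hl := isLetter_inv w (by omega) h2
    have hp : w.1⁻¹ q < -(k : ℤ) := (seg_neg_iff h.mem hl.2).mp (by omega)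
    have := abs_le.mp hl.2
    rw [Int.toNat_of_nonneg (by omega), hyperoctahedral_map_neg, perm_apply_inv_apply, seg_neg]
    exact ⟨⟨by omega, by omega⟩, by omega⟩
  · intro p hp
    simp only [Finset.coe_filter, Finset.mem_Ioc, Set.mem_ofPred_eq, Finset.mem_filter] at hp ⊢
    obtain ⟨⟨⟨h1, h2⟩, h3⟩, h4⟩ := hp
    have := abs_le.mp ((isLetter_of_row (n := n) (r := p) (by omega) h2).map w).2
    rw [Int.toNat_of_nonneg (by omega), hyperoctahedral_inv_neg, perm_inv_apply_apply, seg_neg]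
    exact ⟨by omega, by omega⟩
  · intro q hq
    simp only [Finset.coe_filter, Finset.mem_Ioc, Set.mem_ofPred_eq] at hq
    obtain ⟨⟨h1, h2⟩, h3⟩ := hq
    have hl := isLetter_inv w (by omega) h2
    have hp : w.1⁻¹ q < -(k : ℤ) := (seg_neg_iff h.mem hl.2).mp (by omega)
    simp only
    rw [Int.toNat_of_nonneg (by omega), hyperoctahedral_map_neg, perm_apply_inv_apply]
    omega
  · intro p hp
    simp only [Finset.coe_filter, Finset.mem_Ioc, Set.mem_ofPred_eq, Finset.mem_filter] at hp
    simp only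
    rw [Int.toNat_of_nonneg (by omega), hyperoctahedral_inv_neg, perm_inv_apply_apply]
    omega

theorem lt_iff_of_segment_eq (w : hyperoctahedral n) (hw : IsChessboardQuotient n I w.1)
    {p q : ℤ} (hp : k < p) (hpn : p ≤ n) (hq : k < q) (hqn : q ≤ n)
    (h : seg I k p = seg I k q) : w.1 p < w.1 q ↔ p < q := by
  rcases lt_trichotomy p q with hlt | heq | hlt
  · exact iff_of_true (lt_of_segment_eq hw hp hlt hqn h) hlt
  · subst heq; simp
  · exact iff_of_false (lt_of_segment_eq hw hq hlt hpn h.symm).not_gt hlt.not_gt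

/-- Let row `r` meet column `p`. As `w` increases on a segment, the larger rows of the segment come
from its columns after `p`. These are whole column pairs, preceded by the partner of `p` when `p ≢
k`; and `p ≡ r` for chessboard elements. -/
theorem even_rowCount_of_pos (h : IsAdmissible n I k) (w : hyperoctahedral n)
    (hw : IsChessboardQuotient n I w.1) {r : ℕ} (h1 : 1 ≤ r) (hr : r ≤ n)
    (hpos : 0 < rowSegment I k w.1 r) :
    Even (rowCount (rowSegment I k w.1) n (rowSegment I k w.1 r) r + n + r) := by
  rw [rowCount_eq_of_pos h w hpos]
  obtain ⟨h3, h4⟩ := isLetter_inv w h1 hr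
  have hp : (k : ℤ) < w.1⁻¹ r := (seg_pos_iff h.mem h4).mp hpos
  obtain ⟨p, hpe⟩ : ∃ p : ℕ, w.1⁻¹ r = p := ⟨(w.1⁻¹ r).toNat, by omega⟩
  have hwp : w.1 p = r := by rw [← hpe, perm_apply_inv_apply]
  rw [hpe] at hp h3 h4
  have h5 := abs_le.mp h4
  have hpar := hw.parity p h4
  have hj : rowSegment I k w.1 r = seg I k p := by rw [rowSegment, segmentOf, hpe]
  have e : ((segmentPositions I k (rowSegment I k w.1 r) k n).filter fun q : ℕ => (r : ℤ) < w.1 q) =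
      segmentPositions I k (rowSegment I k w.1 r) p n := by
    ext q
    simp only [segmentPositions, Finset.mem_filter, Finset.mem_Ioc, hj]
    constructor
    · rintro ⟨⟨⟨q1, q2⟩, q3⟩, q4⟩
      rw [← hwp, lt_iff_of_segment_eq (k := k) w hw hp h5.2 (by omega) (by omega) q3.symm] at q4
      exact ⟨by omega, q3⟩
    · rintro ⟨⟨q1, q2⟩, q3⟩
      rw [← hwp, lt_iff_of_segment_eq (k := k) w hw hp h5.2 (by omega) (by omega) q3.symm]
      exact ⟨⟨by omega, q3⟩, by omega⟩
  rw [e]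
  have hnk := h.even
  by_cases hpk : Even (p + k)
  · have := card_segmentPositions_even h (rowSegment I k w.1 r) (a := p) (b := n) (by omega)
      (by omega) hpk hnk
    rw [Nat.even_iff] at *
    rw [Int.even_iff] at hpar
    omega
  · have hpn : p + 1 ≤ n := by
      by_contra hcon
      obtain rfl : p = n := by omega
      exact hpk hnk
    have := card_segmentPositions_even h (rowSegment I k w.1 r) (a := p + 1) (b := n) (by omega)
      hpn (by rw [Nat.even_iff] at *; omega) hnk
    have e2 : segmentPositions I k (rowSegment I k w.1 r) p n =
        insert (p + 1) (segmentPositions I k (rowSegment I k w.1 r) (p + 1) n) := by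
      have e3 : Finset.Ioc p n = insert (p + 1) (Finset.Ioc (p + 1) n) := by
        ext x
        simp only [Finset.mem_Ioc, Finset.mem_insert]
        omega
      unfold segmentPositions
      rw [e3, Finset.filter_insert, if_pos]
      rw [hj]
      have := seg_pair h (a := p - 1) (by omega) (by rw [Nat.even_iff] at *; omega)
      rwa [show p - 1 + 2 = p + 1 by omega, show p - 1 + 1 = p by omega] at this
    rw [e2, Finset.card_insert_of_notMem (by simp [segmentPositions])]
    rw [Nat.even_iff] at *
    rw [Int.even_iff] at hpar
    omega

/-- For negative entries the larger rows come from the columns before `p` instead of those after it,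
which reverses the parity. -/
theorem odd_rowCount_of_neg (h : IsAdmissible n I k) (w : hyperoctahedral n)
    (hw : IsChessboardQuotient n I w.1) {r : ℕ} (h1 : 1 ≤ r) (hr : r ≤ n)
    (hneg : rowSegment I k w.1 r < 0) :
    Odd (rowCount (rowSegment I k w.1) n (rowSegment I k w.1 r) r + n + r) := by
  obtain ⟨j, hj⟩ : ∃ j, rowSegment I k w.1 r = -j := ⟨_, (neg_neg _).symm⟩
  rw [hj, rowCount_eq_of_neg h w (by omega)]
  obtain ⟨h3, h4⟩ := isLetter_inv w h1 hr
  have hp : w.1⁻¹ r < -(k : ℤ) := (seg_neg_iff h.mem h4).mp hneg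
  obtain ⟨p, hpe⟩ : ∃ p : ℕ, w.1⁻¹ r = -p := ⟨(-w.1⁻¹ r).toNat, by omega⟩
  have hwp : w.1 p = -r := by
    rw [show (p : ℤ) = -w.1⁻¹ r by omega, hyperoctahedral_map_neg, perm_apply_inv_apply]
  rw [hpe] at hp h3 h4
  rw [abs_neg] at h4
  have h5 := abs_le.mp h4
  have hpar := hw.parity p h4
  have hjp : seg I k p = j := by
    rw [rowSegment, segmentOf, hpe, seg_neg] at hj
    omega
  have e : ((segmentPositions I k j k n).filter fun q : ℕ => w.1 q < -(r : ℤ)) =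
      segmentPositions I k j k (p - 1) := by
    ext q
    simp only [segmentPositions, Finset.mem_filter, Finset.mem_Ioc]
    constructor
    · rintro ⟨⟨⟨q1, q2⟩, q3⟩, q4⟩
      rw [← hwp, lt_iff_of_segment_eq (k := k) w hw (by omega) (by omega) (by omega) (by omega)
        (q3.trans hjp.symm)] at q4
      exact ⟨by omega, q3⟩
    · rintro ⟨⟨q1, q2⟩, q3⟩
      rw [← hwp, lt_iff_of_segment_eq (k := k) w hw (by omega) (by omega) (by omega) (by omega)
        (q3.trans hjp.symm)]
      exact ⟨⟨by omega, q3⟩, by omega⟩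
  rw [e]
  have hnk := h.even
  -- If `p` is the right column of its pair, its partner `p - 1` is counted besides whole pairs;
  -- otherwise only whole pairs are.
  by_cases hpk : Even (p + k)
  · have := card_segmentPositions_even h j (a := k) (b := p - 2) le_rfl
      (by rw [Nat.even_iff] at *; omega) (by simp) (by rw [Nat.even_iff] at *; omega)
    have hp2 : k + 2 ≤ p := by
      rw [Nat.even_iff] at *
      omega
    have e2 : segmentPositions I k j k (p - 1) =
        insert (p - 1) (segmentPositions I k j k (p - 2)) := by
      have e3 : Finset.Ioc k (p - 1) = insert (p - 1) (Finset.Ioc k (p - 2)) := by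
        ext x
        simp only [Finset.mem_Ioc, Finset.mem_insert]
        omega
      unfold segmentPositions
      rw [e3, Finset.filter_insert, if_pos]
      have := seg_pair h (a := p - 2) (by omega) (by rw [Nat.even_iff] at *; omega)
      rw [show p - 2 + 2 = p by omega, show p - 2 + 1 = p - 1 by omega] at this
      rw [← this, hjp]
    rw [e2, Finset.card_insert_of_notMem (by simp [segmentPositions]; omega)]
    rw [Nat.even_iff] at *
    rw [Int.even_iff] at hpar
    rw [Nat.odd_iff]
    omega
  · have := card_segmentPositions_even h j (a := k) (b := p - 1) le_rfl (by omega) (by simp)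
      (by rw [Nat.even_iff] at *; omega)
    rw [Nat.even_iff] at *
    rw [Int.even_iff] at hpar
    rw [Nat.odd_iff]
    omega

theorem even_rowCount_add (h : IsAdmissible n I k) (w : hyperoctahedral n) {j : ℤ} (hj : j ≠ 0) :
    Even (rowCount (rowSegment I k w.1) n j 0 + rowCount (rowSegment I k w.1) n (-j) 0) := by
  have pos : ∀ j : ℤ, 0 < j →
      Even (rowCount (rowSegment I k w.1) n j 0 + rowCount (rowSegment I k w.1) n (-j) 0) := by
    intro j hj
    rw [rowCount_eq_of_pos h w hj, rowCount_eq_of_neg h w hj]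
    have e : ((segmentPositions I k j k n).filter fun p : ℕ => w.1 p < -((0 : ℕ) : ℤ)) =
        (segmentPositions I k j k n).filter fun p : ℕ => ¬ ((0 : ℕ) : ℤ) < w.1 p := by
      refine Finset.filter_congr fun p hp => ?_
      simp only [segmentPositions, Finset.mem_filter, Finset.mem_Ioc] at hp
      have := ((isLetter_of_row (n := n) (r := p) (by omega) (by omega)).map w).1
      omega
    rw [e, Finset.card_filter_add_card_filter_not]
    exact card_segmentPositions_even h j le_rfl h.le (by simp) h.even
  rcases lt_or_gt_of_ne hj with hj | hj
  · have := pos (-j) (by omega)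
    rwa [neg_neg, add_comm] at this
  · exact pos j hj

theorem isRowPattern_rowSegment (h : IsAdmissible n I k) (w : hyperoctahedral n)
    (hw : IsChessboardQuotient n I w.1) (hA : ZerosAlternate n (rowSegment I k w.1)) :
    IsRowPattern n (rowSegment I k w.1) := by
  have hz := zeroCount_rowSegment h w
  have hnk := h.even
  refine ⟨fun r h1 hr => ?_, fun j hj => even_rowCount_add h w hj, ?_⟩
  · rcases lt_trichotomy (rowSegment I k w.1 r) 0 with hlt | heq | hlt
    · have := odd_rowCount_of_neg h w hw h1 hr hlt
      rw [← Nat.not_even_iff_odd] at this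
      exact iff_of_false this (by omega)
    · refine iff_of_true ?_ heq.ge
      have h2 := rowCount_add_zeroCount (G := rowSegment I k w.1) hr
      have h3 := hA r h1 hr heq
      rw [heq]
      rw [Nat.even_iff] at *
      omega
    · exact iff_of_true (even_rowCount_of_pos h w hw h1 hr hlt) hlt.le
  · have h2 := rowCount_add_zeroCount (G := rowSegment I k w.1) (Nat.zero_le n)
    rw [zeroCount_zero] at h2
    rw [Nat.even_iff] at *
    omega

theorem rowCount_neg_pred {G : ℕ → ℤ} (hG : G n = 0) {j : ℤ} (hj : j ≠ 0) (r : ℕ) :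
    rowCount (-G) (n - 1) j r = rowCount G n (-j) r := by
  unfold rowCount
  congr 1
  ext q
  simp only [Finset.mem_filter, Finset.mem_Ioc, Pi.neg_apply]
  constructor
  · rintro ⟨h1, h2⟩
    omega
  · rintro ⟨h1, h2⟩
    have : q ≠ n := by
      rintro rfl
      omega
    omega

/-- Replacing `m = n` by `n - 1` reverses the parity condition, so that negative rows now satisfy
what positive rows did. Zero rows keep the right parity because the deleted row `n` is itself a zero
row. -/
theorem isRowPattern_neg_rowSegment (h : IsAdmissible n I k) (hn : 1 ≤ n) (w : hyperoctahedral n)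
    (hw : IsChessboardQuotient n I w.1) (hA : ZerosAlternate n (rowSegment I k w.1))
    (h0 : rowSegment I k w.1 n = 0) : IsRowPattern (n - 1) (-rowSegment I k w.1) := by
  have hz := zeroCount_rowSegment h w
  have hnk := h.even
  have hc : ∀ r, zeroCount (-rowSegment I k w.1) r = zeroCount (rowSegment I k w.1) r := fun r =>
    zeroCount_congr fun q _ _ => by simp
  have hz' : zeroCount (rowSegment I k w.1) n = zeroCount (rowSegment I k w.1) (n - 1) + 1 := by
    obtain ⟨p, rfl⟩ : ∃ p, n = p + 1 := ⟨n - 1, by omega⟩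
    rw [zeroCount_succ, if_pos h0, Nat.add_sub_cancel]
  refine ⟨fun r h1 hr => ?_, fun j hj => ?_, ?_⟩
  · rw [Pi.neg_apply]
    rcases lt_trichotomy (rowSegment I k w.1 r) 0 with hlt | heq | hlt
    · have := odd_rowCount_of_neg h w hw h1 (by omega) hlt
      rw [rowCount_neg_pred h0 (by omega), neg_neg]
      refine iff_of_true ?_ (by omega)
      rw [Nat.odd_iff] at this
      rw [Nat.even_iff]
      omega
    · refine iff_of_true ?_ (by omega)
      have h2 := rowCount_add_zeroCount (G := -rowSegment I k w.1) hr
      have h3 := hA r h1 (by omega) heq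
      rw [hc, hc] at h2
      rw [heq, neg_zero]
      rw [Nat.even_iff] at *
      omega
    · have := even_rowCount_of_pos h w hw h1 (by omega) hlt
      rw [rowCount_neg_pred h0 (by omega), neg_neg]
      refine iff_of_false ?_ (by omega)
      rw [Nat.even_iff] at *
      omega
  · rw [rowCount_neg_pred h0 hj, rowCount_neg_pred h0 (by omega)]
    exact even_rowCount_add h w (by omega)
  · have h2 := rowCount_add_zeroCount (G := -rowSegment I k w.1) (Nat.zero_le (n - 1))
    rw [hc, hc, zeroCount_zero] at h2
    rw [Nat.even_iff] at *
    omega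

end Bridge

/-! ### Uncanceled elements in terms of row patterns -/

section Uncanceled

variable {n k : ℕ} {I : Finset ℕ}

theorem entry_rowOf (w : hyperoctahedral n) {c : ℕ} (h1 : 1 ≤ c) (hc : c ≤ n) :
    entry w.1 (rowOf w.1 c) c = if 0 < w.1 c then 1 else -1 := by
  have h0 := ((isLetter_of_row h1 hc).map w).1
  unfold entry rowOf
  generalize w.1 (c : ℤ) = x at *
  by_cases hx : 0 < x
  · rw [if_pos (by omega), if_pos hx]
  · rw [if_neg (by omega), if_pos (by omega), if_neg hx]

/-- The two columns of a pair lie in one segment, and no value between theirs does. -/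
theorem pair_spec (h : IsAdmissible n I k) (w : hyperoctahedral n)
    (hw : IsChessboardQuotient n I w.1) {t : ℕ} (hkt : k < t) (htn : t + 1 ≤ n)
    (ht : ¬ t ≡ n [MOD 2]) :
    ∃ j x y, 0 < j ∧ w.1 t = x ∧ w.1 (t + 1 : ℕ) = y ∧ x < y ∧ IsLetter n x ∧ IsLetter n y ∧
      Odd (n + x) ∧ Even (n + y) ∧ segmentOf I k w.1 x = j ∧ segmentOf I k w.1 y = j ∧
      ∀ z, x < z → z < y → segmentOf I k w.1 z ≠ j := by
  have hnk := h.even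
  unfold Nat.ModEq at ht
  have hlt := isLetter_of_row (n := n) (r := t) (by omega) (by omega)
  have hlt1 := isLetter_of_row (n := n) (r := t + 1) (by omega) htn
  have e1 := seg_pair h (a := t - 1) (by omega) (by rw [Nat.even_iff] at *; omega)
  rw [show t - 1 + 2 = t + 1 by omega, show t - 1 + 1 = t by omega] at e1
  have p1 := hw.parity _ hlt.2
  have p2 := hw.parity _ hlt1.2
  rw [Int.even_iff] at p1 p2
  have hxy : w.1 t < w.1 (t + 1 : ℕ) :=
    (lt_iff_of_segment_eq (k := k) w hw (by omega) (by omega) (by omega) (by omega) e1.symm).mpr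
      (by omega)
  have lx := hlt.map w
  have ly := hlt1.map w
  refine ⟨seg I k t, _, _, (seg_pos_iff h.mem hlt.2).mpr (by omega), rfl, rfl, hxy, lx, ly,
    ?_, ?_, ?_, ?_, ?_⟩
  · rw [Int.odd_iff]
    omega
  · rw [Int.even_iff]
    omega
  · rw [segmentOf, perm_inv_apply_apply]
  · rw [segmentOf, perm_inv_apply_apply, e1]
  -- As `w` increases on the segment, such a value would sit strictly between columns `t` and `t +
  -- 1`.
  · intro z z1 z2 hz
    have bx := abs_le.mp lx.2
    have bz := hyperoctahedral_inv_abs_le w (x := z) (abs_le.mpr (by have := abs_le.mp ly.2; omega))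
    have hzw := perm_apply_inv_apply w.1 z
    rw [segmentOf] at hz
    generalize w.1⁻¹ z = p at *
    have hp : (k : ℤ) < p := by
      rw [← seg_pos_iff h.mem bz, hz]
      exact (seg_pos_iff h.mem hlt.2).mpr (by omega)
    rw [← hzw] at z1 z2
    rw [abs_le] at bz
    rw [lt_iff_of_segment_eq (k := k) w hw (by omega) (by omega) hp bz.2 hz.symm] at z1
    rw [lt_iff_of_segment_eq (k := k) w hw hp bz.2 (by omega) (by omega) (hz.trans e1.symm)] at z2
    omega

/-- No value of the segment lies strictly between `-x` and `y`, so `x` and `y` are the first rows of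
segments `-j` and `j`. This is the input for `eq_one_of_mixed` and `neg_of_mixed`. -/
theorem pair_mixed (h : IsAdmissible n I k) (w : hyperoctahedral n)
    (hw : IsChessboardQuotient n I w.1) {t : ℕ} (ht : IsPair n w.1 k (-1) 1 t) :
    ∃ (j : ℤ) (x y : ℕ), 0 < j ∧ w.1 t = -x ∧ w.1 (t + 1 : ℕ) = y ∧ rowOf w.1 t = x ∧
      rowOf w.1 (t + 1) = y ∧ 1 ≤ x ∧ x ≤ n ∧ 1 ≤ y ∧ y ≤ n ∧ Odd (n + x) ∧ Even (n + y) ∧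
      rowSegment I k w.1 x = -j ∧ rowSegment I k w.1 y = j ∧
      (∀ q, 1 ≤ q → q < x → rowSegment I k w.1 q ≠ -j) ∧
      (∀ q, 1 ≤ q → q < y → rowSegment I k w.1 q ≠ j) := by
  obtain ⟨t1, t2, t3, t4, t5⟩ := ht
  obtain ⟨j, x, y, hj, hx, hy, hxy, lx, ly, px, py, sx, sy, hz⟩ := pair_spec h w hw t1 t2 t3
  rw [entry_rowOf w (by omega) (by omega), hx] at t4
  rw [entry_rowOf w (by omega) (by omega), hy] at t5
  have x0 : x < 0 := by
    have := lx.1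
    split_ifs at t4
    omega
  have y0 : 0 < y := by
    split_ifs at t5
    assumption
  have bx := abs_le.mp lx.2
  have bl := abs_le.mp ly.2
  obtain ⟨a, rfl⟩ : ∃ a : ℕ, x = -a := ⟨(-x).toNat, by omega⟩
  obtain ⟨b, rfl⟩ : ∃ b : ℕ, y = b := ⟨y.toNat, by omega⟩
  rw [Int.odd_iff] at px
  rw [Int.even_iff] at py
  rw [segmentOf_neg] at sx
  refine ⟨j, a, b, hj, hx, hy, ?_, ?_, by omega, by omega, by omega, by omega, ?_, ?_, ?_, ?_,
    ?_, ?_⟩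
  · unfold rowOf; omega
  · unfold rowOf; omega
  · rw [Nat.odd_iff]; omega
  · rw [Nat.even_iff]; omega
  · unfold rowSegment; omega
  · exact sy
  · intro q q1 q2
    have := hz (-q) (by omega) (by omega)
    rw [segmentOf_neg] at this
    unfold rowSegment
    omega
  · exact fun q q1 q2 => hz q (by omega) (by omega)

theorem pair_pos (h : IsAdmissible n I k) (w : hyperoctahedral n)
    (hw : IsChessboardQuotient n I w.1) {t : ℕ} (ht : IsPair n w.1 k 1 1 t) :
    ∃ x y : ℕ, rowOf w.1 t = x ∧ rowOf w.1 (t + 1) = y ∧ 1 ≤ x ∧ x < y ∧ y ≤ n ∧ Even (n + y) ∧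
      0 < rowSegment I k w.1 y ∧
      (∀ q, x < q → q < y → rowSegment I k w.1 q ≠ rowSegment I k w.1 y) := by
  obtain ⟨t1, t2, t3, t4, t5⟩ := ht
  obtain ⟨j, x, y, hj, hx, hy, hxy, lx, ly, px, py, sx, sy, hz⟩ := pair_spec h w hw t1 t2 t3
  rw [entry_rowOf w (by omega) (by omega), hx] at t4
  have x0 : 0 < x := by
    split_ifs at t4
    assumption
  have bl := abs_le.mp ly.2
  obtain ⟨a, rfl⟩ : ∃ a : ℕ, x = a := ⟨x.toNat, by omega⟩
  obtain ⟨b, rfl⟩ : ∃ b : ℕ, y = b := ⟨y.toNat, by omega⟩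
  rw [Int.even_iff] at py
  have sy' : rowSegment I k w.1 b = j := sy
  refine ⟨a, b, ?_, ?_, by omega, by omega, by omega, ?_, by omega, ?_⟩
  · unfold rowOf; omega
  · unfold rowOf; omega
  · rw [Nat.even_iff]; omega
  · intro q q1 q2
    rw [sy']
    exact hz q (by omega) (by omega)

theorem pair_neg (h : IsAdmissible n I k) (w : hyperoctahedral n)
    (hw : IsChessboardQuotient n I w.1) {t : ℕ} (ht : IsPair n w.1 k (-1) (-1) t) :
    ∃ x y : ℕ, rowOf w.1 t = x ∧ rowOf w.1 (t + 1) = y ∧ 1 ≤ y ∧ y < x ∧ x ≤ n ∧ Odd (n + x) ∧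
      rowSegment I k w.1 x < 0 ∧
      (∀ q, y < q → q < x → rowSegment I k w.1 q ≠ rowSegment I k w.1 x) := by
  obtain ⟨t1, t2, t3, t4, t5⟩ := ht
  obtain ⟨j, x, y, hj, hx, hy, hxy, lx, ly, px, py, sx, sy, hz⟩ := pair_spec h w hw t1 t2 t3
  rw [entry_rowOf w (by omega) (by omega), hy] at t5
  have y0 : y < 0 := by
    have := ly.1
    split_ifs at t5
    omega
  have bl := abs_le.mp lx.2
  obtain ⟨a, rfl⟩ : ∃ a : ℕ, x = -a := ⟨(-x).toNat, by omega⟩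
  obtain ⟨b, rfl⟩ : ∃ b : ℕ, y = -b := ⟨(-y).toNat, by omega⟩
  rw [Int.odd_iff] at px
  rw [segmentOf_neg] at sx
  have sx' : rowSegment I k w.1 a = -j := by unfold rowSegment; omega
  refine ⟨a, b, ?_, ?_, by omega, by omega, by omega, ?_, by omega, ?_⟩
  · unfold rowOf; omega
  · unfold rowOf; omega
  · rw [Nat.odd_iff]; omega
  · intro q q1 q2
    rw [sx']
    have := hz (-q) (by omega) (by omega)
    rw [segmentOf_neg] at this
    unfold rowSegment
    omega

theorem even_zeroCount_add (h : IsAdmissible n I k) (w : hyperoctahedral n) :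
    Even (zeroCount (rowSegment I k w.1) n + n) := by
  rw [zeroCount_rowSegment h w, add_comm]
  exact h.even

/-- Properties 2 and 3 alone exclude the two defects; in their absence the pairing of rows yields
all seven properties. -/
theorem isFinallyUncanceled_iff (h : IsAdmissible n I k) (hn : 1 ≤ n) (w : hyperoctahedral n)
    (hw : IsChessboardQuotient n I w.1) :
    IsFinallyUncanceled n w.1 k ↔ ZerosAlternate n (rowSegment I k w.1) ∧
      ∀ r, ¬ IsFailure n (rowSegment I k w.1) r := by
  have hz : ∀ r, n < r → r ≤ n → rowSegment I k w.1 r = 0 := fun r _ _ => by omega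
  constructor
  · intro hV
    have hA := (zerosAlternate_iff (even_zeroCount_add h w)).mpr fun r s hb =>
      hV.prop2 r s ((isBlock_iff h w).mpr hb)
    refine ⟨hA, (isRowPattern_rowSegment h w hw hA).not_isFailure_of_even_blocks le_rfl
      fun t h1 ht hneg => ?_⟩
    obtain ⟨h2, h3⟩ := (rowSegment_neg_iff h w h1 ht).mp hneg
    rcases hV.prop3 t h1 ht h2 h3 with ⟨r, s, h4, h5⟩ | h4
    · exact Or.inl ⟨r, s, (isSignBlock_neg_one_iff h w).mp h4, h5⟩
    · exact Or.inr fun q q1 q2 => (rowSegment_neg_iff h w q1 (by omega)).mpr (h4 q q1 q2)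
  · rintro ⟨hA, hf⟩
    have hG := isRowPattern_rowSegment h w hw hA
    have hneg : ∀ q, 1 ≤ q → q ≤ n → rowSegment I k w.1 q < 0 →
        entry w.1 q (colOf w.1 q) = -1 ∧ k < colOf w.1 q :=
      fun q q1 q2 q3 => ((rowSegment_neg_iff h w q1 q2).mp q3).symm
    have hmixed : ∀ t, IsPair n w.1 k (-1) 1 t → w.1 t = -1 ∧ Even n ∧ rowOf w.1 t = 1 ∧
        ∀ q, 1 ≤ q → q < rowOf w.1 (t + 1) →
          entry w.1 q (colOf w.1 q) = -1 ∧ k < colOf w.1 q := by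
      intro t ht
      obtain ⟨j, x, y, hj, hx, hy, rx, ry, x1, xn, y1, yn, px, py, gx, gy, mx, my⟩ :=
        pair_mixed h w hw ht
      obtain ⟨rfl, hev⟩ := eq_one_of_mixed hf x1 xn px (by omega) fun q q1 q2 => by
        rw [gx]; exact mx q q1 q2
      refine ⟨by simpa using hx, hev, rx, fun q q1 q2 => ?_⟩
      rw [ry] at q2
      exact hneg q q1 (by omega) (hG.neg_of_mixed hf y1 yn hev (by omega) (by omega)
        (fun q q1 q2 => by rw [gy]; exact my q q1 q2) q1 q2)
    refine ⟨(rowSegment_nonneg_iff h w hn le_rfl).mp (hG.nonneg_last hn), fun r s hb =>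
      (zerosAlternate_iff (even_zeroCount_add h w)).mp hA r s ((isBlock_iff h w).mp hb),
      fun t h1 ht h2 h3 => ?_, fun _ => ⟨fun t t' ht ht' => ?_, fun t ht => (hmixed t ht).2.2⟩,
      fun hodd t ht => Nat.not_even_iff_odd.mpr hodd (hmixed t ht).2.1, fun t ht q hq => ?_,
      fun r s p q hB hP => ?_, fun r s q hB _ hr hN => ?_, fun r s p hB _ hN => ?_⟩
    · rcases hG.neg_block_even hf le_rfl hz h1 ht ((rowSegment_neg_iff h w h1 ht).mpr ⟨h2, h3⟩) with
        ⟨r, s, h4, h5⟩ | h4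
      · exact Or.inl ⟨r, s, (isSignBlock_neg_one_iff h w).mpr h4, h5⟩
      · exact Or.inr fun q q1 q2 => (rowSegment_neg_iff h w q1 (by omega)).mp (h4 q q1 q2)
    · have := w.1.injective ((hmixed t ht).1.trans (hmixed t' ht').1.symm)
      omega
    · obtain ⟨x, y, rx, ry, x1, xy, yn, py, gy, my⟩ := pair_pos h w hw ht
      rw [rx, ry] at hq
      unfold RowBetween at hq
      rw [min_eq_left xy.le, max_eq_right xy.le] at hq
      exact hneg q (by omega) (by omega) (hG.neg_of_between hf x1 yn py gy my hq.1 hq.2)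
    · exact hG.pos_block_odd_iff hf le_rfl hz ((isBlock_iff h w).mp hB)
        ((isSignBlock_one_iff h w).mp hP)
    · exact hG.neg_block_top hf hz ((isBlock_iff h w).mp hB) hr
        ((isSignBlock_neg_one_iff h w).mp hN)
    · exact hG.neg_block_bot hf le_rfl hz ((isBlock_iff h w).mp hB)
        ((isSignBlock_neg_one_iff h w).mp hN)

theorem rowSegment_eq_zero_of_apply (w : hyperoctahedral n)
    (hk : w.1 k = n) : rowSegment I k w.1 n = 0 := by
  rw [rowSegment, segmentOf, ← hk, perm_inv_apply_apply]
  exact seg_eq_zero (by simp)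

/-- The argument for finally uncanceled elements, applied to the negated pattern without row `n`:
the roles of ones and minus ones are interchanged. -/
theorem isInitiallyUncanceled_iff (h : IsAdmissible n I k) (hn : 1 ≤ n) (w : hyperoctahedral n)
    (hw : IsChessboardQuotient n I w.1) (hk : w.1 k = n) :
    IsInitiallyUncanceled n w.1 k ↔ ZerosAlternate n (rowSegment I k w.1) ∧
      ∀ r, ¬ IsFailure (n - 1) (-rowSegment I k w.1) r := by
  have h0 : rowSegment I k w.1 n = 0 := rowSegment_eq_zero_of_apply w hk
  have hz : ∀ r, n - 1 < r → r ≤ n → (-rowSegment I k w.1) r = 0 := fun r h1 h2 => by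
    obtain rfl : r = n := by omega
    simpa using h0
  have hB : ∀ {r s}, IsBlock n w.1 k r s → IsNonzeroBlock n (-rowSegment I k w.1) r s := by
    intro r s hb
    simpa [IsNonzeroBlock] using (isBlock_iff h w).mp hb
  constructor
  · intro hU
    have hA := (zerosAlternate_iff (even_zeroCount_add h w)).mpr fun r s hb =>
      hU.prop2 r s ((isBlock_iff h w).mpr hb)
    refine ⟨hA, (isRowPattern_neg_rowSegment h hn w hw hA h0).not_isFailure_of_even_blocks
      (Nat.sub_le n 1) fun t h1 ht hneg => ?_⟩
    simp only [Pi.neg_apply, Int.neg_neg_iff_pos, neg_neg] at hneg ⊢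
    obtain ⟨h2, h3⟩ := (rowSegment_pos_iff h w h1 ht).mp hneg
    rcases hU.prop3 t h1 ht h2 h3 with ⟨r, s, h4, h5⟩ | h4
    · exact Or.inl ⟨r, s, (isSignBlock_one_iff h w).mp h4, h5⟩
    · exact Or.inr fun q q1 q2 => (rowSegment_pos_iff h w q1 (by omega)).mpr (h4 q q1 q2)
  · rintro ⟨hA, hf⟩
    have hG := isRowPattern_neg_rowSegment h hn w hw hA h0
    have hpos : ∀ q, 1 ≤ q → q ≤ n → (-rowSegment I k w.1) q < 0 →
        entry w.1 q (colOf w.1 q) = 1 ∧ k < colOf w.1 q := fun q q1 q2 q3 =>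
      ((rowSegment_pos_iff h w q1 q2).mp (by rw [Pi.neg_apply] at q3; omega)).symm
    have hmn : n - 1 ≤ n := Nat.sub_le n 1
    have hle : ∀ x, x ≤ n → rowSegment I k w.1 x ≠ 0 → x ≤ n - 1 := by
      intro x h1 h2
      have : x ≠ n := by
        rintro rfl
        exact h2 h0
      omega
    have hmixed : ∀ t, IsPair n w.1 k (-1) 1 t → w.1 (t + 1 : ℕ) = 1 ∧ Odd n ∧
        rowOf w.1 (t + 1) = 1 ∧ ∀ q, 1 ≤ q → q < rowOf w.1 t →
          entry w.1 q (colOf w.1 q) = 1 ∧ k < colOf w.1 q := by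
      intro t ht
      obtain ⟨j, x, y, hj, hx, hy, rx, ry, x1, xn, y1, yn, px, py, gx, gy, mx, my⟩ :=
        pair_mixed h w hw ht
      have hy' : y ≤ n - 1 := hle y yn (by omega)
      have hx' : x ≤ n - 1 := hle x xn (by omega)
      obtain ⟨rfl, hev⟩ := eq_one_of_mixed hf y1 hy'
        (by rw [Nat.even_iff] at py; rw [Nat.odd_iff]; omega)
        (by rw [Pi.neg_apply]; omega) fun q q1 q2 => by
          rw [Pi.neg_apply, Pi.neg_apply, gy, ne_eq, neg_inj]; exact my q q1 q2
      refine ⟨by simpa using hy, by rw [Nat.even_iff] at hev; rw [Nat.odd_iff]; omega, ry,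
        fun q q1 q2 => ?_⟩
      rw [rx] at q2
      exact hpos q q1 (by omega) (hG.neg_of_mixed hf x1 hx' hev (by rw [Pi.neg_apply]; omega)
        (by rw [Pi.neg_apply, Pi.neg_apply]; omega)
        (fun q q1 q2 => by rw [Pi.neg_apply, Pi.neg_apply, gx, ne_eq, neg_inj]; exact mx q q1 q2)
        q1 q2)
    refine ⟨fun r h1 hr => ?_, fun r s hb =>
      (zerosAlternate_iff (even_zeroCount_add h w)).mp hA r s ((isBlock_iff h w).mp hb),
      fun t h1 ht h2 h3 => ?_, fun hev t ht => Nat.not_even_iff_odd.mpr (hmixed t ht).2.1 hev,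
      fun _ => ⟨fun t t' ht ht' => ?_, fun t ht => (hmixed t ht).2.2⟩, fun t ht q hq => ?_,
      fun r s p q hb hP => ?_, fun r s q hb _ hr hN => ?_, fun r s p hb _ hN => ?_⟩
    · have h2 := hG.nonneg_last (by omega)
      rw [Pi.neg_apply, show n - 1 = r by omega] at h2
      have h3 := (rowSegment_nonpos_iff h w h1 (by omega)).mp (by omega)
      -- The inequality is strict because column `k` is occupied by row `n`.
      refine h3.imp_left fun h4 => lt_of_le_of_ne h4 fun h5 => ?_
      unfold colOf at h5
      have e := perm_apply_inv_apply w.1 r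
      rcases Int.natAbs_eq (w.1⁻¹ (r : ℤ)) with e' | e'
      · rw [e', h5, hk] at e
        omega
      · rw [e', h5, hyperoctahedral_map_neg, hk] at e
        omega
    · rcases hG.neg_block_even hf hmn hz h1 ht (by
        have := (rowSegment_pos_iff h w h1 ht).mpr ⟨h2, h3⟩
        rw [Pi.neg_apply]
        omega) with ⟨r, s, h4, h5⟩ | h4
      · rw [neg_neg] at h4
        exact Or.inl ⟨r, s, (isSignBlock_one_iff h w).mpr h4, h5⟩
      · exact Or.inr fun q q1 q2 => (hpos q q1 (by omega) (h4 q q1 q2)).symm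
    · have := w.1.injective ((hmixed t ht).1.trans (hmixed t' ht').1.symm)
      omega
    · obtain ⟨x, y, rx, ry, y1, yx, xn, px, gx, mx⟩ := pair_neg h w hw ht
      rw [rx, ry] at hq
      unfold RowBetween at hq
      rw [min_eq_right yx.le, max_eq_left yx.le] at hq
      have hx' : x ≤ n - 1 := hle x xn (by omega)
      exact hpos q (by omega) (by omega) (hG.neg_of_between hf y1 hx'
        (by rw [Nat.odd_iff] at px; rw [Nat.even_iff]; omega) (by rw [Pi.neg_apply]; omega)
        (fun q q1 q2 => by rw [Pi.neg_apply, Pi.neg_apply, ne_eq, neg_inj]; exact mx q q1 q2)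
        hq.1 hq.2)
    · exact hG.pos_block_odd_iff hf hmn hz (hB hb) ((isSignBlock_neg_one_iff h w).mp hP)
    · exact hG.neg_block_top hf hz (hB hb) hr
        (by rw [neg_neg]; exact (isSignBlock_one_iff h w).mp hN)
    · exact hG.neg_block_bot hf hmn hz (hB hb)
        (by rw [neg_neg]; exact (isSignBlock_one_iff h w).mp hN)

end Uncanceled

/-! ### Cancellation -/

section Cancellation

variable {n k : ℕ} {I : Finset ℕ}

/-- Partners are chosen arbitrarily, but `Q` determines them, and being symmetric on chosen pairs it
makes the choice an involution. Reversal of the sign rules out fixed points. -/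
theorem signedSum_eq_of_partner {S T : Set (hyperoctahedral n)} (hTS : T ⊆ S)
    (Q : hyperoctahedral n → hyperoctahedral n → Prop)
    (hex : ∀ w ∈ S, w ∉ T → ∃ w' ∈ S, w' ∉ T ∧ Q w w' ∧ Q w' w ∧
      statL n w'.1 = statL n w.1 ∧ (-1 : ℤ[X]) ^ coxLength n w'.1 = -(-1) ^ coxLength n w.1)
    (huniq : ∀ w a b, Q w a → Q w b → a = b) : signedSum n S = signedSum n T := by
  classical
  unfold signedSum
  have hsub : T.toFinite.toFinset ⊆ S.toFinite.toFinset := by simpa using hTS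
  rw [← Finset.sum_sdiff hsub, add_eq_right]
  have hex' : ∀ w ∈ S.toFinite.toFinset \ T.toFinite.toFinset, ∃ w' ∈ S, w' ∉ T ∧ Q w w' ∧
      Q w' w ∧ statL n w'.1 = statL n w.1 ∧
        (-1 : ℤ[X]) ^ coxLength n w'.1 = -(-1) ^ coxLength n w.1 := by
    intro w hw
    simp only [Finset.mem_sdiff, Set.Finite.mem_toFinset] at hw
    exact hex w hw.1 hw.2
  choose φ h1 h2 h3 h4 h5 h6 using hex'
  refine Finset.sum_involution φ ?_ ?_ ?_ ?_
  · intro w hw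
    rw [h5, h6]
    ring
  · intro w hw _ heq
    have h := h6 w hw
    rw [heq, self_eq_neg] at h
    exact pow_ne_zero _ (neg_ne_zero.mpr one_ne_zero) h
  · intro w hw
    simp only [Finset.mem_sdiff, Set.Finite.mem_toFinset]
    exact ⟨h1 w hw, h2 w hw⟩
  · intro w hw
    exact huniq (φ w hw) _ _ (h3 _ _) (h4 w hw)

theorem rowSegment_reflection_mul {u v : ℤ} (hu : IsLetter n u) (hv : IsLetter n v)
    (w : hyperoctahedral n) (q : ℕ) :
    rowSegment I k (reflection hu hv * w).1 q = segmentOf I k w.1 (reflFun u v q) :=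
  segmentOf_reflection_mul hu hv I k w q

/-- The value exchanged with the zero row `r` whose predecessor is `r₀`. -/
def previousValue (r r₀ : ℕ) : ℤ := if r₀ = 0 then -r else r₀

theorem IsFirstRepeat.isExchangeable {w : hyperoctahedral n} {r r₀ : ℕ}
    (hR : IsFirstRepeat n (rowSegment I k w.1) r r₀) :
    IsExchangeable I k w.1 (previousValue r r₀) r := by
  have hlt := hR.lt
  have hev := hR.even
  rw [Nat.even_iff] at hev
  have h0 : segmentOf I k w.1 r = 0 := hR.zero
  have h0' : segmentOf I k w.1 (previousValue r r₀) = 0 := by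
    unfold previousValue
    split_ifs with e
    · rw [segmentOf_neg, h0, neg_zero]
    · exact hR.zero' e
  refine ⟨?_, ?_, fun z z1 z2 z3 => ?_⟩
  · unfold previousValue; split_ifs <;> omega
  · rw [Int.even_iff]; unfold previousValue; split_ifs <;> omega
  · rw [h0, h0']
    -- Both exchanged values lie in segment `0`, so a nonzero segment is automatically on one side
    -- of both.
    have hz : segmentOf I k w.1 z ≠ 0 := by
      rw [Int.odd_iff] at z3
      unfold previousValue at z1 z3
      rcases le_total 0 z with hz | hz
      · lift z to ℕ using hz
        refine hR.between z ?_ (by omega)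
        split_ifs at z1 z3 <;> omega
      · obtain ⟨y, rfl⟩ : ∃ y : ℕ, z = -y := ⟨(-z).toNat, by omega⟩
        rw [segmentOf_neg, neg_ne_zero]
        refine hR.between y ?_ ?_ <;> split_ifs at z1 z3 <;> omega
    omega

/-- First cancellation. The reflection permutes zero rows up to sign, so the first repeat is
unchanged and leads back. `P` stands for `True` or for `w k = n`. -/
theorem signedSum_eq_zerosAlternate (h : IsAdmissible n I k) (P : hyperoctahedral n → Prop)
    (hP : ∀ (w : hyperoctahedral n) (u v : ℤ) (hu : IsLetter n u) (hv : IsLetter n v),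
      |u| < n → |v| < n → P w → P (reflection hu hv * w)) :
    signedSum n {w | IsChessboardQuotient n I w.1 ∧ P w} =
      signedSum n {w | (IsChessboardQuotient n I w.1 ∧ P w) ∧
        ZerosAlternate n (rowSegment I k w.1)} := by
  refine signedSum_eq_of_partner (fun w hw => hw.1)
    (fun w w' => ∃ r r₀, IsFirstRepeat n (rowSegment I k w.1) r r₀ ∧
      ∃ (hu : IsLetter n (previousValue r r₀)) (hv : IsLetter n (r : ℤ)),
        w' = reflection hu hv * w) ?_ ?_
  · rintro w ⟨hw, hPw⟩ hwT
    have hA : ¬ ZerosAlternate n (rowSegment I k w.1) := fun hA => hwT ⟨⟨hw, hPw⟩, hA⟩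
    obtain ⟨r, r₀, hR⟩ := exists_isFirstRepeat hA
    have hlt := hR.lt
    have hle := hR.le
    -- The total number of zeros is `k ≡ n`, so row `n` cannot break the alternation; value `n` is
    -- never moved.
    have hrn : r < n := by
      refine lt_of_le_of_ne hle fun e => ?_
      have h1 := hR.odd
      rw [e] at h1
      exact Nat.not_even_iff_odd.mpr h1 (even_zeroCount_add h w)
    have hua : |previousValue r r₀| < n := by
      unfold previousValue
      rw [abs_lt]
      split_ifs <;> omega
    have hu : IsLetter n (previousValue r r₀) :=
      ⟨by unfold previousValue; split_ifs <;> omega, hua.le⟩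
    have hv : IsLetter n (r : ℤ) := isLetter_of_row (by omega) hle
    have hex := hR.isExchangeable
    obtain ⟨g1, g2, g3⟩ := hex.reflection_mul hw hu hv
    have hR' : IsFirstRepeat n (rowSegment I k (reflection hu hv * w).1) r r₀ := by
      refine hR.congr fun q q1 q2 => ?_
      rw [rowSegment_reflection_mul]
      have h0 : segmentOf I k w.1 r = 0 := hR.zero
      unfold previousValue reflFun
      by_cases hr₀ : r₀ = 0
      · rw [if_pos hr₀]
        by_cases hq : q = r
        · subst hq
          rw [if_neg (by omega), if_pos rfl, segmentOf_neg, h0]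
          simp [rowSegment, h0]
        · rw [if_neg (by omega), if_neg (by omega), if_neg (by omega), if_neg (by omega)]
          rfl
      · rw [if_neg hr₀]
        have h0' : segmentOf I k w.1 r₀ = 0 := hR.zero' hr₀
        by_cases hq : q = r
        · subst hq
          rw [if_neg (by omega), if_pos rfl, h0']
          simp [rowSegment, h0]
        · by_cases hq' : q = r₀
          · subst hq'
            rw [if_pos rfl, h0]
            simp [rowSegment, h0']
          · rw [if_neg (by omega), if_neg (by omega), if_neg (by omega), if_neg (by omega)]
            rfl
    refine ⟨reflection hu hv * w, ⟨g1, hP w _ _ hu hv hua ?_ hPw⟩,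
      fun hT => hR'.not_zerosAlternate hT.2, ⟨r, r₀, hR, hu, hv, rfl⟩, ⟨r, r₀, hR', hu, hv, ?_⟩,
      g2, g3⟩
    · rw [abs_of_nonneg] <;> omega
    · rw [← mul_assoc, reflection_mul_self, one_mul]
  · rintro w a b ⟨r, r₀, hR, hu, hv, rfl⟩ ⟨s, s₀, hS, hu', hv', rfl⟩
    obtain ⟨rfl, rfl⟩ := hR.unique hS
    rfl

/-- Second cancellation, by exchanging rows `r` and `r₀` of the last failure. It is used with `ε =
1`, `m = n` for the finally uncanceled elements, and with `ε = -1`, `m = n - 1` for the initially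
uncanceled ones, where row `n` stays in place. -/
theorem signedSum_eq_no_failure (ε : ℤ) (hε : ε = 1 ∨ ε = -1) {m : ℕ} (hmn : m ≤ n)
    (P : hyperoctahedral n → Prop)
    (hP : ∀ (w : hyperoctahedral n) (u v : ℤ) (hu : IsLetter n u) (hv : IsLetter n v),
      |u| ≤ m → |v| ≤ m → P w → P (reflection hu hv * w))
    (hG : ∀ w : hyperoctahedral n, IsChessboardQuotient n I w.1 → P w →
      ZerosAlternate n (rowSegment I k w.1) →
        IsRowPattern m (fun r => ε * rowSegment I k w.1 r)) :
    signedSum n {w | (IsChessboardQuotient n I w.1 ∧ P w) ∧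
        ZerosAlternate n (rowSegment I k w.1)} =
      signedSum n {w | ((IsChessboardQuotient n I w.1 ∧ P w) ∧
        ZerosAlternate n (rowSegment I k w.1)) ∧
          ∀ r, ¬ IsFailure m (fun r => ε * rowSegment I k w.1 r) r} := by
  refine signedSum_eq_of_partner (fun w hw => hw.1)
    (fun w w' => ∃ r r₀, IsLastFailure m (fun r => ε * rowSegment I k w.1 r) r r₀ ∧
      ∃ (hu : IsLetter n (r : ℤ)) (hv : IsLetter n (r₀ : ℤ)), w' = reflection hu hv * w) ?_ ?_
  · rintro w ⟨⟨hw, hPw⟩, hA⟩ hwT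
    have hex : ∃ r, IsFailure m (fun r => ε * rowSegment I k w.1 r) r := by
      by_contra hcon
      exact hwT ⟨⟨⟨hw, hPw⟩, hA⟩, fun r hr => hcon ⟨r, hr⟩⟩
    obtain ⟨r, r₀, hR⟩ := (hG w hw hPw hA).exists_isLastFailure hex
    have f1 := hR.failure.1
    have hlt := hR.lt
    have hle := hR.le
    have hev := hR.even
    rw [Nat.even_iff] at hev
    have hu : IsLetter n (r : ℤ) := isLetter_of_row f1 (by omega)
    have hv : IsLetter n (r₀ : ℤ) := isLetter_of_row (by omega) (by omega)
    -- All rows strictly between are negative for the pattern while `r` and `r₀` are nonnegative, so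
    -- their segments lie on one side.
    have hexch : IsExchangeable I k w.1 r r₀ := by
      refine ⟨by omega, by rw [Int.even_iff]; omega, fun z z1 z2 _ => ?_⟩
      have hz0 : 0 ≤ z := by omega
      lift z to ℕ using hz0
      have a1 := hR.neg z (by omega) (by omega)
      have a2 := hR.nonneg
      have a3 := hR.nonneg'
      unfold rowSegment at a1 a2 a3
      rcases hε with rfl | rfl
      · left; omega
      · right; omega
    obtain ⟨g1, g2, g3⟩ := hexch.reflection_mul hw hu hv
    have er : rowSegment I k (reflection hu hv * w).1 r = rowSegment I k w.1 r₀ := by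
      rw [rowSegment_reflection_mul, reflFun_left, rowSegment]
    have er₀ : rowSegment I k (reflection hu hv * w).1 r₀ = rowSegment I k w.1 r := by
      rw [rowSegment_reflection_mul, reflFun, if_neg (by omega), if_pos rfl, rowSegment]
    have eq : ∀ q, 1 ≤ q → q ≤ n → q ≠ r → q ≠ r₀ →
        rowSegment I k (reflection hu hv * w).1 q = rowSegment I k w.1 q := by
      intro q q1 q2 q3 q4
      rw [rowSegment_reflection_mul, reflFun_of_ne (by omega) (by omega) (by omega) (by omega),
        rowSegment]
    have hR' : IsLastFailure m (fun r => ε * rowSegment I k (reflection hu hv * w).1 r) r r₀ :=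
      hR.exchange (by simp only [er]) (by simp only [er₀]) fun q q1 q2 q3 q4 => by
        simp only [eq q q1 (by omega) q3 q4]
    have hA' : ZerosAlternate n (rowSegment I k (reflection hu hv * w).1) := by
      have hscale : ∀ w : hyperoctahedral n, ZerosAlternate n (rowSegment I k w.1) ↔
          ZerosAlternate n (fun r => ε * rowSegment I k w.1 r) := by
        intro w
        have h0 : ∀ q, rowSegment I k w.1 q = 0 ↔ ε * rowSegment I k w.1 q = 0 := fun q => by
          rcases hε with rfl | rfl <;> simp
        refine forall_congr' fun r => forall_congr' fun _ => forall_congr' fun _ => ?_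
        rw [zeroCount_congr (G' := fun r => ε * rowSegment I k w.1 r) fun q _ _ => h0 q, h0 r]
      rw [hscale] at hA ⊢
      exact hR.zerosAlternate (by simp only [er]) (by simp only [er₀])
        (fun q q1 q2 q3 q4 => by simp only [eq q q1 q2 q3 q4]) hmn hA
    refine ⟨reflection hu hv * w, ⟨⟨g1, hP w _ _ hu hv ?_ ?_ hPw⟩, hA'⟩,
      fun hT => hT.2 r hR'.failure, ⟨r, r₀, hR, hu, hv, rfl⟩, ⟨r, r₀, hR', hu, hv, ?_⟩, g2, g3⟩
    · rw [abs_of_nonneg] <;> omega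
    · rw [abs_of_nonneg] <;> omega
    · rw [← mul_assoc, reflection_mul_self, one_mul]
  · rintro w a b ⟨r, r₀, hR, hu, hv, rfl⟩ ⟨s, s₀, hS, hu', hv', rfl⟩
    obtain ⟨rfl, rfl⟩ := hR.unique hS
    rfl

/-- The alternative `w (k + 1) = -n` contradicts `k ≡ n` if `k < n`; for `k = n` the point `n + 1`
is fixed. -/
theorem mem_quotientCAt_iff (h : IsAdmissible n I k) (hn : 1 ≤ n) (hI : I ⊆ Finset.range n)
    (w : hyperoctahedral n) : w ∈ quotientCAt n (Finset.range n \ I) k ↔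
      IsChessboardQuotient n I w.1 ∧ w.1 k = n := by
  simp only [quotientCAt, Set.mem_ofPred_eq, mem_quotientC_iff hI]
  refine and_congr_right fun hw => or_iff_left fun hcon => ?_
  have hkn := h.le
  rcases hkn.eq_or_lt with rfl | hlt
  · rw [w.2.2 (k + 1) (by rw [abs_of_nonneg] <;> omega)] at hcon
    omega
  · have h1 := hw.parity (k + 1) (by rw [abs_of_nonneg] <;> omega)
    have h2 := h.even
    rw [hcon, Int.even_iff] at h1
    rw [Nat.even_iff] at h2
    omega

theorem isAdmissible_of_parity (hI : I ⊆ Finset.range n) (hk : k ∈ insert n I)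
    (hpar : ∀ i ∈ insert n I, k < i → k ≡ i [MOD 2]) : IsAdmissible n I k := by
  have hkn : k ≤ n := by
    rcases Finset.mem_insert.mp hk with rfl | hk
    · exact le_rfl
    · exact (Finset.mem_range.mp (hI hk)).le
  refine ⟨hk, hkn, ?_, fun a ha hpa hmem => ?_⟩
  · rcases hkn.eq_or_lt with rfl | hlt
    · simp
    · have := hpar n (Finset.mem_insert_self _ _) hlt
      unfold Nat.ModEq at this
      rw [Nat.even_iff]
      omega
  · have := hpar (a + 1) (Finset.mem_insert_of_mem hmem) (by omega)
    unfold Nat.ModEq at this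
    rw [Nat.even_iff] at hpa
    omega

end Cancellation

/-! ### The two identities -/

theorem mainTheorem5 (n : ℕ) (hn : 1 ≤ n) (I : Finset ℕ) (hI : I ⊆ Finset.range n)
    (k : ℕ) (hk : k ∈ insert n I)
    (hpar : ∀ i ∈ insert n I, k < i → k ≡ i [MOD 2]) :
    signedSum n (quotientC n (Finset.range n \ I)) =
        signedSum n (finallyUncanceled n (Finset.range n \ I) k) ∧
      signedSum n (quotientCAt n (Finset.range n \ I) k) =
        signedSum n (initiallyUncanceled n (Finset.range n \ I) k) := by
  have h := isAdmissible_of_parity hI hk hpar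
  constructor
  · have hS : quotientC n (Finset.range n \ I) =
        {w | IsChessboardQuotient n I w.1 ∧ True} := by
      ext w
      simp [mem_quotientC_iff hI]
    rw [hS, signedSum_eq_zerosAlternate h _ fun _ _ _ _ _ _ _ hP => hP,
      signedSum_eq_no_failure 1 (Or.inl rfl) le_rfl _ (fun _ _ _ _ _ _ _ hP => hP)
        fun w hw _ hA => by simpa using isRowPattern_rowSegment h w hw hA]
    congr 1
    ext w
    simp only [finallyUncanceled, Set.mem_ofPred_eq, mem_quotientC_iff hI, one_mul, and_true,
      and_assoc]
    exact and_congr_right fun hw => (isFinallyUncanceled_iff h hn w hw).symm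
  · have hS : quotientCAt n (Finset.range n \ I) k =
        {w | IsChessboardQuotient n I w.1 ∧ w.1 k = (n : ℤ)} := by
      ext w
      exact mem_quotientCAt_iff h hn hI w
    have hP : ∀ (w : hyperoctahedral n) (u v : ℤ) (hu : IsLetter n u) (hv : IsLetter n v),
        |u| < n → |v| < n → w.1 k = n → (reflection hu hv * w).1 k = n := by
      intro w u v hu hv hun hvn hwk
      rw [abs_lt] at hun hvn
      rw [Subgroup.coe_mul, Equiv.Perm.mul_apply, hwk, reflection_apply]
      exact reflFun_of_ne (by omega) (by omega) (by omega) (by omega)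
    have hneg : ∀ w : hyperoctahedral n,
        (fun r => -1 * rowSegment I k w.1 r) = -rowSegment I k w.1 := fun w => by
      ext r
      simp
    rw [hS, signedSum_eq_zerosAlternate h _ hP,
      signedSum_eq_no_failure (-1) (Or.inr rfl) (Nat.sub_le n 1) _
        (fun w u v hu hv hun hvn => hP w u v hu hv (by omega) (by omega))
        fun w hw hwk hA => by
          rw [hneg]
          exact isRowPattern_neg_rowSegment h hn w hw hA (rowSegment_eq_zero_of_apply w hwk)]
    congr 1
    ext w
    simp only [initiallyUncanceled, Set.mem_ofPred_eq, mem_quotientCAt_iff h hn hI, hneg]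
    rw [and_assoc (c := ∀ r, _)]
    exact and_congr_right fun hw => (isInitiallyUncanceled_iff h hn w hw.1 hw.2).symm
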